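/- **Conventions.** Let $I$ be a finite or countably infinite set. The theory is local: a *space* is an open subset $M\subset\mathbb R^I$ (product topology) with its coordinate functions $h^i$ $(i\in I)$. $\mathcal F(M)$ is the ring of functions $f:M\to\mathbb R$ for which there are finitely many coordinates such that $f$ is, near every point, a $C^\infty$ function of these coordinates. $\Phi(M)$ is the $\mathcal F(M)$-module of finite sums $\sum f_i\,dh^i$ with $f_i\in\mathcal F(M)$; $\mathcal T(M)$ is its dual module (vector fields, $Zf=Z(df)$); $\mathcal L_Z\varphi=Z\rfloor d\varphi+d(\varphi(Z))$ is the Lie derivative. For a submodule $\Omega\subset\Phi(M)$ let $\mathcal H(\Omega)=\{Z:\Omega(Z)=0\}$, and for a submodule $P\subset\Phi(M)$ let $\mathcal L_{\mathcal H}P$ be the submodule generated by all $\mathcal L_Z\varphi$ $(Z\in\mathcal H,\varphi\in P)$. "Finite-dimensional" means: having a finite basis over $\mathcal F(M)$. * $\Omega$ is *flat* if $\mathcal L_{\mathcal H(\Omega)}\Omega\subset\Omega$. * A *good filtration* of $\Omega$ is a sequence $\Omega_0\subset\Omega_1\subset\cdots\subset\Omega=\bigcup_l\Omega_l$ of finite-dimensional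 submodules such that, with $\mathcal H=\mathcal H(\Omega)$, $\mathcal L_{\mathcal H}\Omega_l\subset\Omega_{l+1}$ for all $l$ and $\Omega_l+\mathcal L_{\mathcal H}\Omega_l=\Omega_{l+1}$ for all large $l$. * $\Omega$ is a *diffiety* if $\Phi(M)/\Omega$ is finite-dimensional and $\Omega$ has a good filtration. * Functions $c^a\in\mathcal F(U)$ are *coordinates* on $U$ if every $f\in\mathcal F(U)$ is, for suitable finitely many $c^a$, near every point a $C^\infty$ function of these $c^a$, and the differentials $dc^a$ are linearly independent at every point of $U$. * A *projection* $\mathbf m:U\to N$ between spaces is a map with $\mathbf m^*\mathcal F(N)\subset\mathcal F(U)$ such that the functions $\mathbf m^*k^a$ ($k^a$ the coordinates of $N$) can be completed by further functions of $\mathcal F(U)$ to coordinates on $U$. * For an open $U\subset M$ and a submodule $R\subset\Phi(M)$ let $R|_U=\mathcal F(U)\cdot\{\varphi|_U:\varphi\in R\}$. **Theorem.** Let $M$ be a space. (1) Let $\Omega\subset\Phi(M)$ be a diffiety and $R\subset\Omega$ a flat submodule. Then every nonempty open subset of $M$ contains a nonempty open subset $U$ for which there are a space $N$, a projection $\mathbf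 m:U\to N$ and a diffiety $\Theta\subset\Phi(N)$ such that $R|_U=\mathcal F(U)\,\mathbf m^*\Theta$. (2) Let $R\subset\Phi(M)$ be a flat submodule and $\Gamma\subset\Phi(M)$ a finite-dimensional submodule such that the modules $R_l=\Gamma+\mathcal L_{\mathcal H}\Gamma+\cdots+\mathcal L_{\mathcal H}^l\Gamma$ $(\mathcal H=\mathcal H(R),\ l=0,1,\dots)$ form a good filtration of $R$. Let $x_j\in\mathcal F(M)$ $(j\in J)$ be functions whose differentials form a basis of $\Phi(M)/R$, let $X_j\in\mathcal H(R)$ be the vector fields with $X_ix_j=\delta_{ij}$, let $\gamma^1,\dots,\gamma^K$ be a basis of $\Gamma$, and let $s\subset I$ be a finite set such that $\gamma^1,\dots,\gamma^K$ are expressed in terms of the coordinates $h^r$ $(r\in s)$ only. Put $$h^r_w=X_{i_1}\cdots X_{i_q}h^r,\qquad \gamma^k_w=\mathcal L_{X_{i_1}}\cdots\mathcal L_{X_{i_q}}\gamma^k\qquad(w=i_1\cdots i_q\text{ a word in }J,\ q\ge 0).$$ Then every nonempty open subset of $M$ contains a nonempty open subset $U$ for which there are a space $N$, a projection $\mathbf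 m:U\to N$ and a diffiety $\Theta\subset\Phi(N)$ such that $R|_U=\mathcal F(U)\,\mathbf m^*\Theta$ and moreover: every function $\mathbf m^*k^a$ is the restriction to $U$ of one of the functions $h^r_w$ $(r\in s)$; the restriction to $U$ of every $h^r_w$ $(r\in s)$ lies in $\mathbf m^*\mathcal F(N)$; and there are forms $\vartheta^k_w\in\Phi(N)$ with $\mathbf m^*\vartheta^k_w=\gamma^k_w|_U$ which generate $\Theta$. -/

import Mathlib

open Topology Filter TopologicalSpace
open scoped ContDiff

noncomputable section

namespace Diffiety

/-! Local theory of smooth spaces modelled on `ℝ^ι` with `ι` finite or countably infinite.  A space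
is an open set `M` of `ι → ℝ` (product topology); its coordinates are the restrictions of the
coordinate functions of `ι → ℝ`. -/

variable {ι κ : Type*}

/-- `f` is, near every point of `M`, a smooth function of the coordinates with index in `s`. -/
def CylSmooth {M : Opens (ι → ℝ)} (s : Finset ι) (f : M → ℝ) : Prop :=
  ∀ p : M, ∃ G : (s → ℝ) → ℝ, ContDiffAt ℝ ∞ G (s.restrict p.1) ∧
    ∀ᶠ q : M in 𝓝 p, f q = G (s.restrict q.1)

theorem CylSmooth.mono {M : Opens (ι → ℝ)} {s t : Finset ι} {f : M → ℝ} (hf : CylSmooth s f)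
    (hst : s ⊆ t) : CylSmooth t f := by
  intro p
  obtain ⟨G, hG, he⟩ := hf p
  refine ⟨fun v => G (Finset.restrict₂ (π := fun _ => ℝ) hst v), ?_, ?_⟩
  · refine ContDiffAt.comp (g := G) (t.restrict p.1) hG ?_
    rw [contDiffAt_pi]
    intro i
    exact contDiffAt_apply (𝕜 := ℝ) (E := ℝ) (n := ∞) (⟨i.1, hst i.2⟩ : t) _
  · filter_upwards [he] with q hq
    rw [hq]; rfl

theorem CylSmooth.comp₂ {M : Opens (ι → ℝ)} {s : Finset ι} {f g : M → ℝ} (hf : CylSmooth s f)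
    (hg : CylSmooth s g) (b : ℝ → ℝ → ℝ) (hb : ContDiff ℝ ∞ (fun z : ℝ × ℝ => b z.1 z.2)) :
    CylSmooth s (fun q => b (f q) (g q)) := by
  intro p
  obtain ⟨G, hG, he⟩ := hf p
  obtain ⟨G', hG', he'⟩ := hg p
  refine ⟨fun v => b (G v) (G' v), ?_, ?_⟩
  · exact ContDiffAt.comp (g := fun z : ℝ × ℝ => b z.1 z.2) (s.restrict p.1)
      hb.contDiffAt (hG.prodMk hG')
  · filter_upwards [he, he'] with q hq hq'
    rw [hq, hq']

theorem CylSmooth.const {M : Opens (ι → ℝ)} (c : ℝ) : CylSmooth (M := M) ∅ (fun _ => c) :=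
  fun _ => ⟨fun _ => c, contDiffAt_const, Eventually.of_forall fun _ => rfl⟩

/-- The structural ring `F(M)`: functions for which there are finitely many coordinates such that
the function is locally given by a smooth formula in these coordinates. -/
def smoothFun (M : Opens (ι → ℝ)) : Subalgebra ℝ (M → ℝ) where
  carrier := {f | ∃ s : Finset ι, CylSmooth s f}
  mul_mem' := by
    classical
    rintro f g ⟨s, hs⟩ ⟨t, ht⟩
    exact ⟨s ∪ t, (hs.mono Finset.subset_union_left).comp₂ (ht.mono Finset.subset_union_right)
      (fun x y => x * y) (contDiff_fst.mul contDiff_snd)⟩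
  add_mem' := by
    classical
    rintro f g ⟨s, hs⟩ ⟨t, ht⟩
    exact ⟨s ∪ t, (hs.mono Finset.subset_union_left).comp₂ (ht.mono Finset.subset_union_right)
      (fun x y => x + y) (contDiff_fst.add contDiff_snd)⟩
  algebraMap_mem' c := ⟨∅, CylSmooth.const c⟩

/-- The ring `F(M)` as a type. -/
def Fn (M : Opens (ι → ℝ)) : Type _ := {f : M → ℝ // f ∈ smoothFun M}

instance (M : Opens (ι → ℝ)) : CommRing (Fn M) := inferInstanceAs (CommRing (smoothFun M))

/-- The coordinate function `h^i`. -/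
def coord (M : Opens (ι → ℝ)) (i : ι) : Fn M :=
  ⟨fun p => p.1 i, {i}, fun _ => ⟨fun v => v ⟨i, Finset.mem_singleton_self i⟩,
    contDiffAt_apply (𝕜 := ℝ) (E := ℝ) (n := ∞) _ _, Eventually.of_forall fun _ => rfl⟩⟩

open Classical in
/-- The partial derivative of a function on `M` with respect to the coordinate `h^i` (the extension
by `0` outside of the open set `M` has no influence on it). -/
def partialFun {M : Opens (ι → ℝ)} (i : ι) (f : M → ℝ) (p : M) : ℝ :=
  deriv (fun t => Function.extend Subtype.val f 0 (Function.update p.1 i t)) (p.1 i)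

open Classical in
/-- The partial derivative is computed by means of the local formulae. -/
theorem partialFun_eq {M : Opens (ι → ℝ)} {s : Finset ι} {f : M → ℝ} {p : M}
    {G : (s → ℝ) → ℝ} (hG : DifferentiableAt ℝ G (s.restrict p.1))
    (he : ∀ᶠ q : M in 𝓝 p, f q = G (s.restrict q.1)) (i : ι) :
    partialFun i f p = fderiv ℝ G (s.restrict p.1) (s.restrict (π := fun _ => ℝ) (Pi.single i 1)) := by
  have hcont : Continuous (fun t : ℝ => Function.update p.1 i t) :=
    continuous_const.update i continuous_id
  have h1 : ∀ᶠ x in 𝓝 p.1, Function.extend Subtype.val f 0 x = G (s.restrict x) := by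
    rw [← M.isOpen.isOpenEmbedding_subtypeVal.map_nhds_eq, eventually_map]
    filter_upwards [he] with q hq
    rw [Subtype.val_injective.extend_apply, hq]
  have h2 : ∀ᶠ t in 𝓝 (p.1 i), Function.extend Subtype.val f 0 (Function.update p.1 i t)
      = G (s.restrict (Function.update p.1 i t)) := by
    have := hcont.tendsto (p.1 i)
    rw [Function.update_eq_self] at this
    exact this.eventually h1
  have h3 : HasDerivAt (fun t : ℝ => s.restrict (π := fun _ => ℝ) (Function.update p.1 i t))
      (s.restrict (π := fun _ => ℝ) (Pi.single i 1)) (p.1 i) := by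
    rw [hasDerivAt_pi]
    intro j
    exact (hasDerivAt_pi.1 (hasDerivAt_update p.1 i (p.1 i))) j.1
  have h4 : HasFDerivAt G (fderiv ℝ G (s.restrict p.1))
      (s.restrict (π := fun _ => ℝ) (Function.update p.1 i (p.1 i))) := by
    rw [Function.update_eq_self]; exact hG.hasFDerivAt
  have h5 := h4.comp_hasDerivAt (p.1 i) h3
  unfold partialFun
  rw [EventuallyEq.deriv_eq h2]
  exact h5.deriv

theorem eventually_contDiffAt {M : Opens (ι → ℝ)} {s : Finset ι} {G : (s → ℝ) → ℝ} {p : M}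
    (hG : ContDiffAt ℝ ∞ G (s.restrict p.1)) :
    ∀ᶠ q : M in 𝓝 p, DifferentiableAt ℝ G (s.restrict q.1) := by
  have h := (hG.of_le (m := 1) (by exact_mod_cast le_top)).eventually (by simp)
  have hc : Continuous (fun q : M => s.restrict (π := fun _ => ℝ) q.1) := by fun_prop
  filter_upwards [(hc.tendsto p).eventually h] with q hq
  exact hq.differentiableAt (by simp)

theorem CylSmooth.partialFun {M : Opens (ι → ℝ)} {s : Finset ι} {f : M → ℝ}
    (hf : CylSmooth s f) (i : ι) : CylSmooth s (partialFun i f) := by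
  classical
  intro p
  obtain ⟨G, hG, he⟩ := hf p
  refine ⟨fun v => fderiv ℝ G v (s.restrict (π := fun _ => ℝ) (Pi.single i 1)), ?_, ?_⟩
  · exact (hG.fderiv_right (m := ∞) (by simp)).clm_apply contDiffAt_const
  · filter_upwards [he.eventually_nhds, eventually_contDiffAt hG] with q hq hq'
    convert partialFun_eq hq' hq i

theorem CylSmooth.partialFun_eq_zero {M : Opens (ι → ℝ)} {s : Finset ι} {f : M → ℝ}
    (hf : CylSmooth s f) {i : ι} (hi : i ∉ s) : Diffiety.partialFun i f = 0 := by
  classical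
  funext p
  obtain ⟨G, hG, he⟩ := hf p
  rw [partialFun_eq (hG.differentiableAt (by simp)) he i]
  have : s.restrict (π := fun _ => ℝ) (Pi.single i 1) = 0 := by
    funext j
    have : j.1 ≠ i := fun h => hi (h ▸ j.2)
    simp [this]
  rw [this]; simp

/-- The partial derivative `∂f/∂h^i` in `F(M)`. -/
def pd {M : Opens (ι → ℝ)} (i : ι) (f : Fn M) : Fn M :=
  ⟨partialFun i f.1, f.2.choose, f.2.choose_spec.partialFun i⟩

/-- The module `Φ(M)` of differential forms, that is, of finite sums `∑ a_i dh^i`; the function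
`φ i` is the coefficient of `dh^i`. -/
abbrev Form (M : Opens (ι → ℝ)) : Type _ := ι →₀ Fn M

/-- The differential `df = ∑ (∂f/∂h^i) dh^i`. -/
def d {M : Opens (ι → ℝ)} (f : Fn M) : Form M :=
  Finsupp.ofSupportFinite (fun i => pd i f) <| by
    refine f.2.choose.finite_toSet.subset fun i hi => ?_
    by_contra h
    exact hi (Subtype.ext (f.2.choose_spec.partialFun_eq_zero h))

/-- The module `T(M)` of vector fields, which are the `F(M)`-linear functionals on `Φ(M)`. -/
abbrev VField (M : Opens (ι → ℝ)) : Type _ := Module.Dual (Fn M) (Form M)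

/-- The contraction of a vector field `Z` with the exterior differential
`dφ = ∑ da_i ∧ dh^i` of the form `φ = ∑ a_i dh^i`. -/
def contractD {M : Opens (ι → ℝ)} (Z : VField M) (φ : Form M) : Form M :=
  φ.sum fun i a => Z (d a) • d (coord M i) - Z (d (coord M i)) • d a

/-- The Lie derivative of a differential form. -/
def lieD {M : Opens (ι → ℝ)} (Z : VField M) (φ : Form M) : Form M :=
  contractD Z φ + d (Z φ)

/-- The module `H(Ω)` of vector fields annihilating `Ω`. -/
def orth {M : Opens (ι → ℝ)} (Ω : Submodule (Fn M) (Form M)) : Submodule (Fn M) (VField M) :=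
  Ω.dualAnnihilator

/-- The submodule generated by all Lie derivatives of forms of `P` along vector fields of `H`. -/
def lieMod {M : Opens (ι → ℝ)} (H : Submodule (Fn M) (VField M))
    (P : Submodule (Fn M) (Form M)) : Submodule (Fn M) (Form M) :=
  Submodule.span (Fn M) {ψ | ∃ Z ∈ H, ∃ φ ∈ P, ψ = lieD Z φ}

/-- Flat submodules. -/
def IsFlat {M : Opens (ι → ℝ)} (Ω : Submodule (Fn M) (Form M)) : Prop :=
  lieMod (orth Ω) Ω ≤ Ω

/-- A module of finite dimension: it has a finite basis. -/
def FinDim (A V : Type*) [CommRing A] [AddCommGroup V] [Module A V] : Prop :=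
  Module.Finite A V ∧ Module.Free A V

/-- Good filtrations `Ω_0 ⊆ Ω_1 ⊆ ⋯ ⊆ Ω = ⋃ Ω_l`. -/
structure IsGoodFiltration {M : Opens (ι → ℝ)} (Ω : Submodule (Fn M) (Form M))
    (W : ℕ → Submodule (Fn M) (Form M)) : Prop where
  mono : Monotone W
  exhaust : ∀ φ, φ ∈ Ω ↔ ∃ l, φ ∈ W l
  finDim : ∀ l, FinDim (Fn M) (W l)
  lie_le : ∀ l, lieMod (orth Ω) (W l) ≤ W (l + 1)
  lie_eq : ∃ l₀, ∀ l, l₀ ≤ l → W l ⊔ lieMod (orth Ω) (W l) = W (l + 1)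

/-- Diffieties: submodules of finite codimension which admit a good filtration. -/
def IsDiffiety {M : Opens (ι → ℝ)} (Ω : Submodule (Fn M) (Form M)) : Prop :=
  FinDim (Fn M) (Form M ⧸ Ω) ∧ ∃ W, IsGoodFiltration Ω W

/-- The module `Γ + L_H Γ + ⋯ + L_H^l Γ`. -/
def lieTower {M : Opens (ι → ℝ)} (H : Submodule (Fn M) (VField M))
    (Γ : Submodule (Fn M) (Form M)) (l : ℕ) : Submodule (Fn M) (Form M) :=
  ⨆ k ∈ Finset.range (l + 1), (lieMod H)^[k] Γ

/-- Morphisms `U → N` of spaces: the pullback of every function of `F(N)` is in `F(U)`. -/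
structure Mor (U : Opens (ι → ℝ)) (N : Opens (κ → ℝ)) where
  toFun : U → N
  comp_mem : ∀ f : Fn N, f.1 ∘ toFun ∈ smoothFun U

/-- The pullback `m^* : F(N) → F(U)`. -/
def Mor.pull {U : Opens (ι → ℝ)} {N : Opens (κ → ℝ)} (m : Mor U N) : Fn N →+* Fn U where
  toFun f := ⟨f.1 ∘ m.toFun, m.comp_mem f⟩
  map_one' := rfl
  map_mul' _ _ := rfl
  map_zero' := rfl
  map_add' _ _ := rfl

/-- The pullback of differential forms, `m^*(∑ a_j dk^j) = ∑ m^*a_j d(m^*k^j)`. -/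
def Mor.pullForm {U : Opens (ι → ℝ)} {N : Opens (κ → ℝ)} (m : Mor U N) (φ : Form N) : Form U :=
  φ.sum fun j a => m.pull a • d (m.pull (coord N j))

/-- The submodule `F(U) m^* Θ` generated by the pullbacks of the forms of `Θ`. -/
def Mor.extend {U : Opens (ι → ℝ)} {N : Opens (κ → ℝ)} (m : Mor U N)
    (Θ : Submodule (Fn N) (Form N)) : Submodule (Fn U) (Form U) :=
  Submodule.span (Fn U) (m.pullForm '' (Θ : Set (Form N)))

/-- The inclusion of an open subspace; its pullback is the restriction to `U`. -/
def incl {U M : Opens (ι → ℝ)} (h : U ≤ M) : Mor U M where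
  toFun := Set.inclusion h
  comp_mem := by
    rintro ⟨f, s, hf⟩
    refine ⟨s, fun p => ?_⟩
    obtain ⟨G, hG, he⟩ := hf (Set.inclusion h p)
    exact ⟨G, hG, ((continuous_inclusion h).tendsto p).eventually he⟩

/-- The functions `c a` are local coordinates on `U`: every function of `F(U)` is locally given by a
smooth formula in finitely many of them, and they are functionally independent (their differentials
are linearly independent at every point). -/
def IsCoordinates {U : Opens (ι → ℝ)} (c : κ → Fn U) : Prop :=
  (∀ f : Fn U, ∃ t : Finset κ, ∀ p : U, ∃ G : (t → ℝ) → ℝ,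
    ContDiffAt ℝ ∞ G (fun a => (c a).1 p) ∧
      ∀ᶠ q : U in 𝓝 p, f.1 q = G (fun a => (c a).1 q)) ∧
  ∀ p : U, LinearIndependent ℝ (fun (a : κ) (i : ι) => (pd i (c a)).1 p)

/-- Projections: morphisms `m : U → N` such that the functions `m^* k^j` can be completed by
further functions to coordinates on `U`. -/
def Mor.IsProjection {U : Opens (ι → ℝ)} {N : Opens (κ → ℝ)} (m : Mor U N) : Prop :=
  ∃ (J : Type) (y : J → Fn U), IsCoordinates (Sum.elim (fun j => m.pull (coord N j)) y)

/-- The form `φ` can be expressed in terms of the coordinates with index in `s`. -/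
def ExpressedIn {M : Opens (ι → ℝ)} (s : Finset ι) (φ : Form M) : Prop :=
  (∀ i, CylSmooth s (φ i).1) ∧ ∀ i, i ∉ s → φ i = 0

/-- The function `X_{i_1} ⋯ X_{i_r} f` for the word `i_1 ⋯ i_r`. -/
def iterFn {M : Opens (ι → ℝ)} {J : Type*} (X : J → VField M) (w : List J) (f : Fn M) : Fn M :=
  w.foldr (fun i g => X i (d g)) f

/-- The form `L_{X_{i_1}} ⋯ L_{X_{i_r}} φ` for the word `i_1 ⋯ i_r`. -/
def iterForm {M : Opens (ι → ℝ)} {J : Type*} (X : J → VField M) (w : List J) (φ : Form M) :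
    Form M :=
  w.foldr (fun i ψ => lieD (X i) ψ) φ

end Diffiety

end

noncomputable section

namespace Diffiety

variable {ι κ : Type*} {M : Opens (ι → ℝ)}

/-! ### The ring of functions -/

/-! The coordinates of `N` are derivatives of finitely many functions $h^r$ along commuting fields.
The difficulty is to select infinitely many of them on one common open set, and to find an open `N`
on which the whole structure is defined.

Frames. Let the $dx_j$ form a basis modulo a flat $R$, with dual fields $X_j$. By flatness the
brackets $[X_i,X_j]$ kill $R$; they also kill every $dx_k$, so the fields commute
(`IsFrame.commute`). A form sees only finitely many $X_j$, so on $R$ a Lie derivative along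
$\mathcal H(R)$ is a combination of the $\mathcal L_{X_j}$ (`IsFrame.lieD_mem`), and $R$ is
generated by the iterated derivatives of $\gamma$ (`IsFrame.kers_eq_iterSpan`). Only finitely many
$X_j$ act nontrivially on the $h^r$, $r\in s$, so the derivatives of these functions are indexed by
monomials in finitely many variables.

Selection. A monomial is dependent if the differential of its derivative is a combination of those
of smaller monomials. Dependent monomials are closed under multiplication by variables, and there
are more of them on smaller open sets. By Dickson's lemma their set is maximal on some nonempty open
set (`exists_isGeneric_monFn`), and there the remaining differentials are linearly independent
(`IsGeneric.eq_zero`). Completed by some of the $x_j$ they yield coordinates (`exists_adapted`,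
`IsCoframe.isCoordinates`).

The space. The image of $U$ under infinitely many coordinates need not be open. Therefore `N` is a
box in finitely many coordinates times full lines in all others (`BoxChart.base`). The finitely many
generating dependent derivatives are functions on the box. Differentiating them yields the other
ones as polynomials in the unrestricted coordinates (`exists_jetLift`). An identity between such
polynomial functions may be checked on $U$ although $U\to N$ need not be onto
(`BoxChart.pull_injOn`); thus the fields descend to `N` and still commute. Their common kernel is
filtered by the degree of its contact forms and is a diffiety (`IsJetSystem.isDiffiety`). Finitely
many contact forms control it (`IsJetSystem.kers_le`), and these are combinations of the lifted
$\mathcal L_w\gamma^k$ (`JetLift.exists_diffiety`). This gives `exists_projection`.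

Submodules of a diffiety $\Omega$. Locally some coordinates serve as independent variables for
$\Omega$, with commuting dual fields $Y$; the good filtration yields finitely many coordinates whose
$Y$-derivatives have differentials spanning all forms (`IsGoodFiltration.exists_finset`). The same
selection of monomials, now modulo $R$, gives a frame for $R$ (`exists_frame_of_isGeneric`), and
Dickson's lemma gives finitely many generators of $R$ (`exists_kers_eq_iterSpan`). So
`exists_projection` applies again. -/

theorem Fn.ext {f g : Fn M} (h : ∀ p, f.1 p = g.1 p) : f = g := Subtype.ext (funext h)

/-- Evaluation at a point. -/
def ev (p : M) : Fn M →+* ℝ where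
  toFun f := f.1 p
  map_one' := rfl
  map_mul' _ _ := rfl
  map_zero' := rfl
  map_add' _ _ := rfl

theorem ev_apply (p : M) (f : Fn M) : ev p f = f.1 p := rfl

theorem ext_ev {f g : Fn M} (h : ∀ p, ev p f = ev p g) : f = g := Fn.ext h

theorem CylSmooth.continuous {s : Finset ι} {f : M → ℝ} (hf : CylSmooth s f) : Continuous f := by
  rw [continuous_iff_continuousAt]
  intro p
  obtain ⟨G, hG, he⟩ := hf p
  have hc : Continuous (fun q : M => s.restrict (π := fun _ => ℝ) q.1) := by fun_prop
  have h : ContinuousAt (fun q : M => G (s.restrict q.1)) p :=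
    ContinuousAt.comp (g := G) hG.continuousAt hc.continuousAt
  exact h.congr (he.mono fun q hq => hq.symm)

theorem Fn.continuous (f : Fn M) : Continuous f.1 := f.2.choose_spec.continuous

theorem continuous_ev (f : Fn M) : Continuous (fun p => ev p f) := f.continuous

/-- A function locally given by smooth formulae in finitely many elements of `F(M)`. -/
theorem mem_smoothFun_of_local {T : Type*} [Fintype T] (c : T → Fn M) {f : M → ℝ}
    (h : ∀ p : M, ∃ G : (T → ℝ) → ℝ, ContDiffAt ℝ ∞ G (fun a => (c a).1 p) ∧
      ∀ᶠ q : M in 𝓝 p, f q = G (fun a => (c a).1 q)) : f ∈ smoothFun M := by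
  classical
  let s : Finset ι := Finset.univ.biUnion fun a => (c a).2.choose
  have hs : ∀ a, CylSmooth s (c a).1 := fun a =>
    (c a).2.choose_spec.mono (Finset.subset_biUnion_of_mem (fun a => (c a).2.choose)
      (Finset.mem_univ a))
  refine ⟨s, fun p => ?_⟩
  obtain ⟨G, hG, he⟩ := h p
  choose H hH hHe using fun a => hs a p
  have hp : (fun a => (c a).1 p) = fun a => H a (s.restrict p.1) :=
    funext fun a => (hHe a).self_of_nhds
  refine ⟨fun v => G fun a => H a v, ?_, ?_⟩
  · refine ContDiffAt.comp (g := G) (s.restrict p.1) (by rwa [← hp]) ?_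
    rw [contDiffAt_pi]
    exact hH
  · filter_upwards [he, eventually_all.2 hHe] with q hq hq'
    rw [hq]
    congr 1
    exact funext hq'

theorem isUnit_of_ne_zero {f : Fn M} (hf : ∀ p, f.1 p ≠ 0) : IsUnit f := by
  have h : (fun p => (f.1 p)⁻¹) ∈ smoothFun M := by
    refine mem_smoothFun_of_local (T := Unit) (fun _ => f) fun p => ⟨fun v => (v ())⁻¹, ?_, ?_⟩
    · exact ContDiffAt.inv (contDiffAt_apply (𝕜 := ℝ) (E := ℝ) (n := ∞) () (fun _ : Unit => f.1 p)) (hf p)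
    · exact Eventually.of_forall fun q => rfl
  refine IsUnit.of_mul_eq_one (⟨_, h⟩ : Fn M) (Fn.ext fun p => ?_)
  exact mul_inv_cancel₀ (hf p)

instance [Nonempty M] : Nontrivial (Fn M) :=
  ⟨0, 1, fun h => zero_ne_one (congrArg (ev (Classical.arbitrary M)) h)⟩

/-! ### Partial derivatives -/

open Classical in
theorem hasDerivAt_line (f : Fn M) (i : ι) (p : M) :
    HasDerivAt (fun t => Function.extend Subtype.val f.1 0 (Function.update p.1 i t))
      ((pd i f).1 p) (p.1 i) := by
  refine DifferentiableAt.hasDerivAt ?_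
  obtain ⟨s, hs⟩ := f.2
  obtain ⟨G, hG, he⟩ := hs p
  have hcont : Continuous (fun t : ℝ => Function.update p.1 i t) :=
    continuous_const.update i continuous_id
  have h1 : ∀ᶠ x in 𝓝 p.1, Function.extend Subtype.val f.1 0 x = G (s.restrict x) := by
    rw [← M.isOpen.isOpenEmbedding_subtypeVal.map_nhds_eq, eventually_map]
    filter_upwards [he] with q hq
    rw [Subtype.val_injective.extend_apply, hq]
  have h2 : ∀ᶠ t in 𝓝 (p.1 i), Function.extend Subtype.val f.1 0 (Function.update p.1 i t)
      = G (s.restrict (Function.update p.1 i t)) := by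
    have := hcont.tendsto (p.1 i)
    rw [Function.update_eq_self] at this
    exact this.eventually h1
  have h3 : DifferentiableAt ℝ (fun t : ℝ => s.restrict (π := fun _ => ℝ)
      (Function.update p.1 i t)) (p.1 i) := by
    rw [differentiableAt_pi]
    intro j
    exact ((hasDerivAt_pi.1 (hasDerivAt_update p.1 i (p.1 i))) j.1).differentiableAt
  refine DifferentiableAt.congr_of_eventuallyEq ?_ h2
  have hG' : DifferentiableAt ℝ G (s.restrict (Function.update p.1 i (p.1 i))) := by
    rw [Function.update_eq_self]; exact hG.differentiableAt (by simp)
  exact hG'.comp (p.1 i) h3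

/-- Chain rule. -/
theorem ev_pd_comp {T : Type*} [Fintype T] [DecidableEq T] (c : T → Fn M) (f : Fn M) (p : M)
    (G : (T → ℝ) → ℝ) (hG : DifferentiableAt ℝ G (fun a => (c a).1 p))
    (he : ∀ᶠ q in 𝓝 p, f.1 q = G (fun a => (c a).1 q)) (i : ι) :
    ev p (pd i f) = ∑ a, fderiv ℝ G (fun a => (c a).1 p) (Pi.single a 1) * ev p (pd i (c a)) := by
  classical
  have hcont : Continuous (fun t : ℝ => Function.update p.1 i t) :=
    continuous_const.update i continuous_id
  have hu : Function.update p.1 i (p.1 i) = p.1 := Function.update_eq_self _ _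
  have h1 : ∀ᶠ x in 𝓝 p.1, Function.extend Subtype.val f.1 0 x
      = G (fun a => Function.extend Subtype.val (c a).1 0 x) := by
    rw [← M.isOpen.isOpenEmbedding_subtypeVal.map_nhds_eq, eventually_map]
    filter_upwards [he] with q hq
    simp only [Subtype.val_injective.extend_apply]
    exact hq
  have h2 : ∀ᶠ t in 𝓝 (p.1 i), Function.extend Subtype.val f.1 0 (Function.update p.1 i t)
      = G (fun a => Function.extend Subtype.val (c a).1 0 (Function.update p.1 i t)) := by
    have := hcont.tendsto (p.1 i)
    rw [hu] at this
    exact this.eventually h1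
  have h3 : HasDerivAt (fun t : ℝ => fun a => Function.extend Subtype.val (c a).1 0
      (Function.update p.1 i t)) (fun a => (pd i (c a)).1 p) (p.1 i) := by
    rw [hasDerivAt_pi]
    exact fun a => hasDerivAt_line (c a) i p
  have hp : (fun a => Function.extend Subtype.val (c a).1 0 (Function.update p.1 i (p.1 i)))
      = fun a => (c a).1 p := by
    funext a
    rw [hu, Subtype.val_injective.extend_apply]
  have h4 : HasFDerivAt G (fderiv ℝ G (fun a => (c a).1 p)) (fun a =>
      Function.extend Subtype.val (c a).1 0 (Function.update p.1 i (p.1 i))) := by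
    rw [hp]; exact hG.hasFDerivAt
  have h5 := (h4.comp_hasDerivAt (p.1 i) h3).congr_of_eventuallyEq h2
  rw [ev_apply, (hasDerivAt_line f i p).unique h5]
  conv_lhs => rw [pi_eq_sum_univ' (fun a => (pd i (c a)).1 p), map_sum]
  refine Finset.sum_congr rfl fun a _ => ?_
  rw [map_smul, smul_eq_mul, mul_comm, ev_apply]

theorem pd_coord [DecidableEq ι] (i j : ι) : pd i (coord M j) = if i = j then 1 else 0 := by
  obtain rfl : ‹DecidableEq ι› = fun a b => Classical.propDecidable (a = b) :=
    Subsingleton.elim _ _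
  let : DecidableEq ι := fun a b => Classical.propDecidable (a = b)
  refine Fn.ext fun p => ?_
  have h2 : HasDerivAt (fun t : ℝ => Function.update p.1 i t j) ((Pi.single i 1 : ι → ℝ) j)
      (p.1 i) := hasDerivAt_pi.1 (hasDerivAt_update p.1 i (p.1 i)) j
  have hcont : Continuous (fun t : ℝ => Function.update p.1 i t) :=
    continuous_const.update i continuous_id
  have h3 : (fun t => Function.extend Subtype.val (coord M j).1 0
      (Function.update p.1 i t)) =ᶠ[𝓝 (p.1 i)] fun t => Function.update p.1 i t j := by
    have h4 : ∀ᶠ x in 𝓝 p.1, x ∈ M := M.isOpen.mem_nhds p.2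
    have := hcont.tendsto (p.1 i)
    rw [Function.update_eq_self] at this
    filter_upwards [this.eventually h4] with t ht
    exact Subtype.val_injective.extend_apply _ _ (⟨_, ht⟩ : M)
  rw [(hasDerivAt_line (coord M j) i p).unique (h2.congr_of_eventuallyEq h3)]
  by_cases h : i = j
  · subst h
    rw [if_pos rfl, Pi.single_eq_same]; rfl
  · rw [if_neg h, Pi.single_eq_of_ne (Ne.symm h)]; rfl

theorem pd_add (i : ι) (f g : Fn M) : pd i (f + g) = pd i f + pd i g := by
  refine ext_ev fun p => ?_
  let L : (Bool → ℝ) →L[ℝ] ℝ := ContinuousLinearMap.proj (R := ℝ) (φ := fun _ : Bool => ℝ) false +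
    ContinuousLinearMap.proj (R := ℝ) (φ := fun _ : Bool => ℝ) true
  rw [ev_pd_comp (fun b : Bool => cond b f g) (f + g) p L L.differentiableAt
    (Eventually.of_forall fun q => by
      change f.1 q + g.1 q = _
      simp [L, add_comm]), L.hasFDerivAt.fderiv]
  simp [L]

theorem pd_mul (i : ι) (f g : Fn M) : pd i (f * g) = f * pd i g + g * pd i f := by
  refine ext_ev fun p => ?_
  have h0 : HasFDerivAt (fun v : Bool → ℝ => v false) (ContinuousLinearMap.proj false : (Bool → ℝ) →L[ℝ] ℝ) (fun a => (cond a f g).1 p) :=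
    (ContinuousLinearMap.proj false : (Bool → ℝ) →L[ℝ] ℝ).hasFDerivAt
  have h1 : HasFDerivAt (fun v : Bool → ℝ => v true) (ContinuousLinearMap.proj true : (Bool → ℝ) →L[ℝ] ℝ) (fun a => (cond a f g).1 p) :=
    (ContinuousLinearMap.proj true : (Bool → ℝ) →L[ℝ] ℝ).hasFDerivAt
  have hd := h1.mul h0
  rw [ev_pd_comp (fun b : Bool => cond b f g) (f * g) p _ hd.differentiableAt
    (Eventually.of_forall fun q => rfl), hd.fderiv]
  rw [map_add, map_mul, map_mul]
  simp [ev_apply]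
  ring

theorem pd_eq_zero_of_const (i : ι) {f : Fn M} {a : ℝ} (h : ∀ p, f.1 p = a) : pd i f = 0 := by
  refine ext_ev fun p => ?_
  rw [ev_pd_comp (T := Empty) (fun b : Empty => b.elim) f p (fun _ => a)
    (differentiableAt_const _) (Eventually.of_forall fun q => h q)]
  simp

theorem pd_comm (i j : ι) (f : Fn M) : pd i (pd j f) = pd j (pd i f) := by
  classical
  refine ext_ev fun p => ?_
  obtain ⟨s, hs⟩ := f.2
  obtain ⟨G, hG, he⟩ := hs p
  let c : s → Fn M := fun a => coord M a
  let v : ι → (s → ℝ) := fun i => s.restrict (π := fun _ => ℝ) (Pi.single i 1)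
  have hv : ∀ (L : (s → ℝ) →L[ℝ] ℝ) i, ∑ a : s, L (Pi.single a 1) * ev p (pd i (c a)) = L (v i) := by
    intro L i
    conv_rhs => rw [pi_eq_sum_univ' (v i), map_sum]
    refine Finset.sum_congr rfl fun a _ => ?_
    rw [map_smul, smul_eq_mul, mul_comm]
    congr 1
    · simp only [c, pd_coord, v]
      simp only [Finset.restrict, Pi.single_apply]
      by_cases h : i = a.1
      · simp [h]
      · simp [h, Ne.symm h]
  have key : ∀ j, ∀ᶠ q : M in 𝓝 p, (pd j f).1 q = fderiv ℝ G (s.restrict q.1) (v j) := by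
    intro j
    filter_upwards [he.eventually_nhds, eventually_contDiffAt hG] with q hq hq'
    refine (Eq.trans ?_ (partialFun_eq hq' hq j)).trans ?_
    · rfl
    · congr!
  have hdiff : DifferentiableAt ℝ (fderiv ℝ G) (s.restrict p.1) :=
    (hG.fderiv_right (m := ∞) (by simp)).differentiableAt (by simp)
  have main : ∀ i j, ev p (pd i (pd j f)) = fderiv ℝ (fderiv ℝ G) (s.restrict p.1) (v i) (v j) := by
    intro i j
    have hd : HasFDerivAt (fun x => fderiv ℝ G x (v j)) _ (s.restrict p.1) :=
      hdiff.hasFDerivAt.clm_apply (hasFDerivAt_const (v j) _)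
    rw [ev_pd_comp c (pd j f) p (fun x => fderiv ℝ G x (v j)) hd.differentiableAt (key j), hv]
    change fderiv ℝ (fun x => fderiv ℝ G x (v j)) (s.restrict p.1) (v i) = _
    rw [hd.fderiv]
    simp
  rw [main, main]
  have hsymm : IsSymmSndFDerivAt ℝ G (s.restrict p.1) :=
    hG.isSymmSndFDerivAt (by
    rw [minSmoothness_of_isRCLikeNormedField]
    exact WithTop.coe_le_coe.2 (le_top (a := (2 : ℕ∞))))
  exact hsymm.eq _ _

/-! ### Differentials -/

@[simp] theorem d_apply (f : Fn M) (i : ι) : d f i = pd i f := rfl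

theorem d_add (f g : Fn M) : d (f + g) = d f + d g := Finsupp.ext fun i => pd_add i f g

theorem d_mul (f g : Fn M) : d (f * g) = f • d g + g • d f := Finsupp.ext fun i => pd_mul i f g

theorem d_of_const {f : Fn M} {a : ℝ} (h : ∀ p, f.1 p = a) : d f = 0 :=
  Finsupp.ext fun i => pd_eq_zero_of_const i h

@[simp] theorem d_zero : d (0 : Fn M) = 0 := d_of_const (a := 0) fun _ => rfl

@[simp] theorem d_one : d (1 : Fn M) = 0 := d_of_const (a := 1) fun _ => rfl

/-- The differential as an additive map. -/
def dHom : Fn M →+ Form M where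
  toFun := d
  map_zero' := d_zero
  map_add' := d_add

theorem d_sum {α : Type*} (s : Finset α) (f : α → Fn M) : d (∑ a ∈ s, f a) = ∑ a ∈ s, d (f a) :=
  map_sum dHom f s

theorem d_neg (f : Fn M) : d (-f) = -d f := map_neg dHom f

theorem d_coord (i : ι) : d (coord M i) = Finsupp.single i 1 := by
  classical
  ext j : 1
  rw [d_apply, pd_coord, Finsupp.single_apply]
  simp only [eq_comm]

theorem form_eq_sum (φ : Form M) : φ = ∑ i ∈ φ.support, φ i • d (coord M i) := by
  conv_lhs => rw [← Finsupp.sum_single φ]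
  simp [Finsupp.sum, d_coord]

theorem span_d_coord : Submodule.span (Fn M) (Set.range fun i => d (coord M i)) = ⊤ := by
  rw [eq_top_iff]
  intro φ _
  rw [form_eq_sum φ]
  exact Submodule.sum_mem _ fun i _ => Submodule.smul_mem _ _ (Submodule.subset_span ⟨i, rfl⟩)

theorem vfield_ext {X Y : VField M} (h : ∀ i, X (d (coord M i)) = Y (d (coord M i))) : X = Y := by
  refine LinearMap.ext_on_range (v := fun i => d (coord M i)) span_d_coord h

/-- The vector field with given components. -/
def vfield (a : ι → Fn M) : VField M := Finsupp.linearCombination (Fn M) a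

@[simp] theorem vfield_coord (a : ι → Fn M) (i : ι) : vfield a (d (coord M i)) = a i := by
  simp [vfield, d_coord]

/-! ### The Lie derivative -/

theorem contractD_add (Z : VField M) (φ ψ : Form M) :
    contractD Z (φ + ψ) = contractD Z φ + contractD Z ψ := by
  refine Finsupp.sum_add_index' (fun i => by simp) fun i a b => ?_
  rw [d_add, map_add, add_smul, smul_add]
  abel

theorem contractD_smul (Z : VField M) (a : Fn M) (φ : Form M) :
    contractD Z (a • φ) = a • contractD Z φ + Z (d a) • φ - Z φ • d a := by
  classical
  induction φ using Finsupp.induction_linear with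
  | zero => simp [contractD]
  | add φ ψ h1 h2 =>
    rw [smul_add, contractD_add, contractD_add, h1, h2, smul_add, smul_add, map_add, add_smul]
    abel
  | single i b =>
    have hs : ∀ c : Fn M, contractD Z (Finsupp.single i c)
        = Z (d c) • d (coord M i) - Z (d (coord M i)) • d c := fun c =>
      Finsupp.sum_single_index (by simp)
    have h1 : (Finsupp.single i b : Form M) = b • d (coord M i) := by simp [d_coord]
    rw [Finsupp.smul_single, smul_eq_mul, hs, hs, d_mul, h1]
    simp only [map_add, map_smul, smul_eq_mul]
    module

/-- This is $d\circ d=0$ contracted with `Z`: the two sums agree by symmetry of second partial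
derivatives. -/
theorem contractD_d (Z : VField M) (f : Fn M) : contractD Z (d f) = 0 := by
  have h : ∀ g : Fn M, Z (d g) = ∑ i ∈ (d g).support, pd i g * Z (d (coord M i)) := fun g => by
    conv_lhs => rw [form_eq_sum (d g), map_sum]
    simp
  have h' : ∀ g : Fn M, ∀ s : Finset ι, (d g).support ⊆ s →
      Z (d g) = ∑ i ∈ s, pd i g * Z (d (coord M i)) := fun g s hs => by
    rw [h]
    refine Finset.sum_subset hs fun i _ hi => ?_
    rw [Finsupp.notMem_support_iff] at hi
    rw [← d_apply, hi, zero_mul]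
  ext l : 1
  simp only [contractD, Finsupp.sum, Finsupp.finsetSum_apply, Finsupp.sub_apply,
    Finsupp.smul_apply, d_apply, smul_eq_mul, Finset.sum_sub_distrib, Finsupp.zero_apply]
  rw [sub_eq_zero]
  classical
  have h1 : ∑ i ∈ (d f).support, Z (d (pd i f)) * pd l (coord M i) = Z (d (pd l f)) := by
    by_cases hl : l ∈ (d f).support
    · rw [Finset.sum_eq_single_of_mem l hl]
      · simp [pd_coord]
      · intro i _ hi; simp [pd_coord, Ne.symm hi]
    · rw [Finset.sum_eq_zero]
      · rw [Finsupp.notMem_support_iff, d_apply] at hl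
        simp [hl]
      · intro i hi
        have : l ≠ i := fun h => hl (h ▸ hi)
        simp [pd_coord, this]
  rw [h1, h' (pd l f) (d f).support]
  · exact Finset.sum_congr rfl fun i _ => by rw [pd_comm, mul_comm]
  · intro i hi
    rw [Finsupp.mem_support_iff, d_apply, pd_comm] at hi
    rw [Finsupp.mem_support_iff, d_apply]
    intro h0
    rw [h0] at hi
    exact hi (by rw [← d_apply, d_zero]; rfl)

theorem lieD_d (Z : VField M) (f : Fn M) : lieD Z (d f) = d (Z (d f)) := by
  rw [lieD, contractD_d, zero_add]

theorem lieD_add (Z : VField M) (φ ψ : Form M) : lieD Z (φ + ψ) = lieD Z φ + lieD Z ψ := by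
  rw [lieD, lieD, lieD, contractD_add, map_add, d_add]
  abel

theorem lieD_smul (Z : VField M) (a : Fn M) (φ : Form M) :
    lieD Z (a • φ) = Z (d a) • φ + a • lieD Z φ := by
  rw [lieD, lieD, contractD_smul, map_smul, smul_eq_mul, d_mul]
  module

@[simp] theorem lieD_zero (Z : VField M) : lieD Z 0 = 0 := by
  simp [lieD, contractD]

/-- The Lie derivative as an additive map. -/
def lieHom (Z : VField M) : Form M →+ Form M where
  toFun := lieD Z
  map_zero' := lieD_zero Z
  map_add' := lieD_add Z

theorem lieD_sum (Z : VField M) {α : Type*} (s : Finset α) (φ : α → Form M) :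
    lieD Z (∑ a ∈ s, φ a) = ∑ a ∈ s, lieD Z (φ a) := map_sum (lieHom Z) φ s

theorem lieD_sub (Z : VField M) (φ ψ : Form M) : lieD Z (φ - ψ) = lieD Z φ - lieD Z ψ :=
  map_sub (lieHom Z) φ ψ

/-- A span is stable under a Lie derivative if this holds for the generators. -/
theorem lieD_mem_span {Z : VField M} {s : Set (Form M)} {P : Submodule (Fn M) (Form M)}
    (hs : s ⊆ P) (h : ∀ φ ∈ s, lieD Z φ ∈ P) {φ : Form M}
    (hφ : φ ∈ Submodule.span (Fn M) s) : lieD Z φ ∈ P := by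
  induction hφ using Submodule.span_induction with
  | mem φ hφ => exact h φ hφ
  | zero => simp
  | add φ ψ _ _ h1 h2 => rw [lieD_add]; exact P.add_mem h1 h2
  | smul a φ hφ h1 =>
    rw [lieD_smul]
    exact P.add_mem (P.smul_mem _ (Submodule.span_le.2 hs hφ)) (P.smul_mem _ h1)

/-- The contraction uses `Z` only on the differentials of the coordinates and coefficients of `φ`.
Hence an expansion of `Z` valid on these finitely many differentials is enough, even if `Z` itself
is an infinite combination. -/
theorem contractD_eq_sum {α : Type*} (s : Finset α) (a : α → Fn M) (Y : α → VField M)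
    (Z : VField M) (φ : Form M)
    (h : ∀ i ∈ φ.support, Z (d (coord M i)) = ∑ j ∈ s, a j * Y j (d (coord M i)) ∧
      Z (d (φ i)) = ∑ j ∈ s, a j * Y j (d (φ i))) :
    contractD Z φ = ∑ j ∈ s, a j • contractD (Y j) φ := by
  simp only [contractD, Finsupp.sum, Finset.smul_sum]
  rw [Finset.sum_comm]
  refine Finset.sum_congr rfl fun i hi => ?_
  rw [(h i hi).1, (h i hi).2, Finset.sum_smul, Finset.sum_smul, ← Finset.sum_sub_distrib]
  refine Finset.sum_congr rfl fun j _ => ?_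
  module

/-- The Lie bracket of vector fields. -/
def bracket (X Y : VField M) : VField M :=
  vfield fun i => X (d (Y (d (coord M i)))) - Y (d (X (d (coord M i))))

/-- Cartan's identity. It translates stability of a common kernel under Lie derivatives into
vanishing of brackets on that kernel, and conversely. -/
theorem apply_lieD (X Y : VField M) (φ : Form M) :
    X (lieD Y φ) = Y (d (X φ)) + bracket X Y φ := by
  induction φ using Finsupp.induction_linear with
  | zero => simp
  | add φ ψ h1 h2 =>
    rw [lieD_add, map_add, h1, h2, map_add, map_add, d_add, map_add]
    abel
  | single i b =>
    have h1 : (Finsupp.single i b : Form M) = b • d (coord M i) := by simp [d_coord]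
    rw [h1, lieD_smul, lieD_d, map_smul, map_smul, bracket, vfield_coord, smul_eq_mul, d_mul]
    simp only [map_add, map_smul, smul_eq_mul]
    ring

theorem bracket_d (X Y : VField M) (f : Fn M) :
    bracket X Y (d f) = X (d (Y (d f))) - Y (d (X (d f))) := by
  have := apply_lieD X Y (d f)
  rw [lieD_d] at this
  rw [this]; ring

/-! ### Pullbacks -/

variable {U : Opens (ι → ℝ)} {N : Opens (κ → ℝ)}

@[simp] theorem ev_pull (m : Mor U N) (f : Fn N) (p : U) : ev p (m.pull f) = ev (m.toFun p) f := rfl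

theorem Mor.continuous (m : Mor U N) : Continuous m.toFun := by
  refine Continuous.subtype_mk (f := fun p => (m.toFun p).1) ?_ _
  exact continuous_pi fun a => (m.pull (coord N a)).continuous

/-- The pullback of forms as a semilinear map. -/
def Mor.pullFormHom (m : Mor U N) : Form N →ₛₗ[m.pull] Form U where
  toFun := m.pullForm
  map_add' φ ψ := Finsupp.sum_add_index' (fun i => by simp) fun i a b => by
    rw [map_add, add_smul]
  map_smul' a φ := by
    classical
    rw [Mor.pullForm, Mor.pullForm, Finsupp.sum_smul_index' (fun i => by simp), Finsupp.smul_sum]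
    simp [mul_smul]

theorem Mor.pullForm_add (m : Mor U N) (φ ψ : Form N) :
    m.pullForm (φ + ψ) = m.pullForm φ + m.pullForm ψ := map_add m.pullFormHom φ ψ

theorem Mor.pullForm_sub (m : Mor U N) (φ ψ : Form N) :
    m.pullForm (φ - ψ) = m.pullForm φ - m.pullForm ψ := map_sub m.pullFormHom φ ψ

theorem Mor.pullForm_smul (m : Mor U N) (a : Fn N) (φ : Form N) :
    m.pullForm (a • φ) = m.pull a • m.pullForm φ := map_smulₛₗ m.pullFormHom a φ

theorem Mor.pullForm_sum (m : Mor U N) {α : Type*} (s : Finset α) (φ : α → Form N) :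
    m.pullForm (∑ a ∈ s, φ a) = ∑ a ∈ s, m.pullForm (φ a) := map_sum m.pullFormHom φ s

@[simp] theorem Mor.pullForm_zero (m : Mor U N) : m.pullForm 0 = 0 := map_zero m.pullFormHom

theorem Mor.pullForm_coord (m : Mor U N) (j : κ) :
    m.pullForm (d (coord N j)) = d (m.pull (coord N j)) := by
  rw [d_coord, Mor.pullForm, Finsupp.sum_single_index] <;> simp

theorem Mor.pullForm_d (m : Mor U N) (f : Fn N) : m.pullForm (d f) = d (m.pull f) := by
  classical
  ext i : 1
  rw [form_eq_sum (d f), Mor.pullForm_sum]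
  simp only [Mor.pullForm_smul, Mor.pullForm_coord, Finsupp.finsetSum_apply, Finsupp.smul_apply,
    d_apply, smul_eq_mul]
  refine ext_ev fun p => ?_
  obtain ⟨t, ht⟩ := f.2
  obtain ⟨G, hG, he⟩ := ht (m.toFun p)
  have hGd := hG.differentiableAt (by simp)
  have h1 := ev_pd_comp (fun a : t => m.pull (coord N a)) (m.pull f) p G hGd
    ((m.continuous.tendsto p).eventually he) i
  have h2 : ∀ a : t, fderiv ℝ G (t.restrict (m.toFun p).1) (Pi.single a 1)
      = ev (m.toFun p) (pd a.1 f) := fun a => by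
    have := ev_pd_comp (fun a : t => coord N a) f (m.toFun p) G hGd he a.1
    rw [this, Finset.sum_eq_single a]
    · rw [pd_coord, if_pos rfl, map_one, mul_one]
      rfl
    · intro b _ hb
      rw [pd_coord, if_neg (fun h => hb (Subtype.ext h.symm)), map_zero, mul_zero]
    · simp
  rw [h1, map_sum]
  have h3 : (d f).support ⊆ t := fun a ha => by
    by_contra hn
    rw [Finsupp.mem_support_iff, d_apply] at ha
    exact ha (Subtype.ext (ht.partialFun_eq_zero hn))
  rw [Finset.sum_subset h3, ← Finset.sum_coe_sort t]
  · refine Finset.sum_congr rfl fun a _ => ?_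
    rw [map_mul, ev_pull, ← h2 a]
    rfl
  · intro a _ ha
    rw [Finsupp.notMem_support_iff, d_apply] at ha
    simp [ha]

/-- A vector field `X` on `U` and a vector field `Y` on `N` are related by `m`. -/
def Related (m : Mor U N) (X : VField U) (Y : VField N) : Prop :=
  ∀ φ, X (m.pullForm φ) = m.pull (Y φ)

theorem related_of_coord {m : Mor U N} {X : VField U} {Y : VField N}
    (h : ∀ j, X (d (m.pull (coord N j))) = m.pull (Y (d (coord N j)))) : Related m X Y := by
  intro φ
  rw [form_eq_sum φ, Mor.pullForm_sum, map_sum, map_sum, map_sum]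
  refine Finset.sum_congr rfl fun j _ => ?_
  rw [Mor.pullForm_smul, Mor.pullForm_coord, map_smul, map_smul, h, smul_eq_mul, smul_eq_mul,
    map_mul]

theorem Related.apply_d {m : Mor U N} {X : VField U} {Y : VField N} (h : Related m X Y)
    (f : Fn N) : X (d (m.pull f)) = m.pull (Y (d f)) := by
  rw [← Mor.pullForm_d, h]

theorem Related.lieD {m : Mor U N} {X : VField U} {Y : VField N} (h : Related m X Y)
    (φ : Form N) : lieD X (m.pullForm φ) = m.pullForm (lieD Y φ) := by
  rw [form_eq_sum φ, Mor.pullForm_sum, lieD_sum, lieD_sum, Mor.pullForm_sum]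
  refine Finset.sum_congr rfl fun j _ => ?_
  rw [Mor.pullForm_smul, Mor.pullForm_coord, lieD_smul, lieD_smul, lieD_d, lieD_d,
    Mor.pullForm_add, Mor.pullForm_smul, Mor.pullForm_smul, Mor.pullForm_d, Mor.pullForm_d,
    h.apply_d, h.apply_d]

theorem Related.iterFn {J : Type*} {m : Mor U N} {X : J → VField U} {Y : J → VField N}
    (h : ∀ j, Related m (X j) (Y j)) (w : List J) (f : Fn N) :
    iterFn X w (m.pull f) = m.pull (iterFn Y w f) := by
  induction w with
  | nil => rfl
  | cons j w ih =>
    change X j (d (Diffiety.iterFn X w _)) = m.pull (Y j (d (Diffiety.iterFn Y w f)))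
    rw [ih, (h j).apply_d]

theorem Related.iterForm {J : Type*} {m : Mor U N} {X : J → VField U} {Y : J → VField N}
    (h : ∀ j, Related m (X j) (Y j)) (w : List J) (φ : Form N) :
    iterForm X w (m.pullForm φ) = m.pullForm (iterForm Y w φ) := by
  induction w with
  | nil => rfl
  | cons j w ih =>
    change Diffiety.lieD (X j) (Diffiety.iterForm X w _)
      = m.pullForm (Diffiety.lieD (Y j) (Diffiety.iterForm Y w φ))
    rw [ih, (h j).lieD]

/-! ### Restriction to open subsets -/

section Restriction

variable {U V M : Opens (ι → ℝ)}

/-- The restriction of functions. -/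
abbrev res (h : U ≤ M) : Fn M →+* Fn U := (incl h).pull

/-- The restriction of forms. -/
abbrev resForm (h : U ≤ M) : Form M → Form U := (incl h).pullForm

@[simp] theorem res_coord (h : U ≤ M) (i : ι) : res h (coord M i) = coord U i := rfl

theorem resForm_coord (h : U ≤ M) (i : ι) : resForm h (d (coord M i)) = d (coord U i) := by
  rw [resForm, Mor.pullForm_coord]; rfl

theorem resForm_apply (h : U ≤ M) (φ : Form M) (i : ι) : resForm h φ i = res h (φ i) := by
  classical
  conv_lhs => rw [form_eq_sum φ, resForm, Mor.pullForm_sum]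
  simp only [Mor.pullForm_smul, Mor.pullForm_coord, Finsupp.finsetSum_apply, Finsupp.smul_apply]
  change ∑ j ∈ φ.support, res h (φ j) • d (coord U j) i = _
  simp only [d_coord, smul_eq_mul, Finsupp.single_apply, mul_ite, mul_one, mul_zero]
  rw [Finset.sum_ite_eq']
  split_ifs with hi
  · rfl
  · rw [Finsupp.notMem_support_iff] at hi
    rw [hi, map_zero]

theorem resForm_resForm (h : U ≤ V) (h' : V ≤ M) (φ : Form M) :
    resForm h (resForm h' φ) = resForm (h.trans h') φ := by
  ext i : 1
  rw [resForm_apply, resForm_apply, resForm_apply]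
  rfl

theorem resForm_d (h : U ≤ M) (f : Fn M) : resForm h (d f) = d (res h f) := Mor.pullForm_d _ f

/-- The restriction of vector fields. -/
def resV (h : U ≤ M) (X : VField M) : VField U := vfield fun i => res h (X (d (coord M i)))

theorem related_resV (h : U ≤ M) (X : VField M) : Related (incl h) (resV h X) X :=
  related_of_coord fun j => vfield_coord _ j

theorem Mor.extend_mono (m : Mor U N) {P Q : Submodule (Fn N) (Form N)} (h : P ≤ Q) :
    m.extend P ≤ m.extend Q := Submodule.span_mono (Set.image_mono h)

theorem Mor.pullForm_mem_extend (m : Mor U N) {P : Submodule (Fn N) (Form N)} {φ : Form N}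
    (h : φ ∈ P) : m.pullForm φ ∈ m.extend P := Submodule.subset_span ⟨φ, h, rfl⟩

theorem Mor.extend_span (m : Mor U N) (s : Set (Form N)) :
    m.extend (Submodule.span (Fn N) s) = Submodule.span (Fn U) (m.pullForm '' s) := by
  refine le_antisymm (Submodule.span_le.2 ?_)
    (Submodule.span_mono (Set.image_mono Submodule.subset_span))
  rintro _ ⟨φ, hφ, rfl⟩
  change _ ∈ Submodule.span (Fn U) (m.pullForm '' s)
  induction hφ using Submodule.span_induction with
  | mem φ hφ => exact Submodule.subset_span ⟨φ, hφ, rfl⟩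
  | zero => rw [Mor.pullForm_zero]; exact Submodule.zero_mem _
  | add φ ψ _ _ h1 h2 => rw [Mor.pullForm_add]; exact Submodule.add_mem _ h1 h2
  | smul a φ _ h1 => rw [Mor.pullForm_smul]; exact Submodule.smul_mem _ _ h1

theorem extend_extend (h : U ≤ V) (h' : V ≤ M) (R : Submodule (Fn M) (Form M)) :
    (incl h).extend ((incl h').extend R) = (incl (h.trans h')).extend R := by
  rw [Mor.extend, Mor.extend, ← Mor.extend, Mor.extend_span, ← Set.image_comp]
  have : (incl h).pullForm ∘ (incl h').pullForm = (incl (h.trans h')).pullForm :=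
    funext fun φ => resForm_resForm h h' φ
  rw [this]
  rfl

theorem extend_top (h : U ≤ M) : (incl h).extend ⊤ = ⊤ := by
  rw [eq_top_iff, ← span_d_coord, Submodule.span_le]
  rintro _ ⟨i, rfl⟩
  rw [SetLike.mem_coe]
  change d (coord U i) ∈ _
  rw [← resForm_coord h]
  exact Mor.pullForm_mem_extend _ trivial

end Restriction

/-! ### Frames -/

section Frames

variable {J : Type*}

/-- The common kernel of a family of vector fields. -/
def kers (X : J → VField M) : Submodule (Fn M) (Form M) := ⨅ j, LinearMap.ker (X j)

theorem mem_kers {X : J → VField M} {φ : Form M} : φ ∈ kers X ↔ ∀ j, X j φ = 0 := by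
  simp [kers]

/-- Functions `x j` and dual vector fields `X j`, the latter being locally finite. -/
structure IsFrame (x : J → Fn M) (X : J → VField M) : Prop where
  dual_same : ∀ j, X j (d (x j)) = 1
  dual_ne : ∀ i j, i ≠ j → X i (d (x j)) = 0
  finite_coord : ∀ i, {j | X j (d (coord M i)) ≠ 0}.Finite

/-- The vector fields commute. -/
def IsCommuting (X : J → VField M) : Prop :=
  ∀ i j f, X i (d (X j (d f))) = X j (d (X i (d f)))

variable {x : J → Fn M} {X : J → VField M}

theorem IsFrame.finite (h : IsFrame x X) (φ : Form M) : {j | X j φ ≠ 0}.Finite := by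
  refine Set.Finite.subset (Set.Finite.biUnion φ.support.finite_toSet
    fun i _ => h.finite_coord i) fun j hj => ?_
  by_contra hn
  simp only [Set.mem_iUnion, not_exists, Set.mem_ofPred_eq, not_not] at hn
  refine hj ?_
  rw [form_eq_sum φ, map_sum]
  refine Finset.sum_eq_zero fun i hi => ?_
  rw [map_smul, hn i hi, smul_zero]

theorem IsFrame.apply_sum [DecidableEq J] (h : IsFrame x X) (s : Finset J) (c : J → Fn M) (j : J) :
    X j (∑ i ∈ s, c i • d (x i)) = if j ∈ s then c j else 0 := by
  rw [map_sum]
  have : ∀ i ∈ s, X j (c i • d (x i)) = if j = i then c i else 0 := fun i _ => by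
    rw [map_smul, smul_eq_mul]
    split_ifs with hij
    · rw [hij, h.dual_same, mul_one]
    · rw [h.dual_ne _ _ hij, mul_zero]
  rw [Finset.sum_congr rfl this, Finset.sum_ite_eq]

theorem IsFrame.sub_mem (h : IsFrame x X) {φ : Form M} {s : Finset J}
    (hs : ∀ j, X j φ ≠ 0 → j ∈ s) : φ - ∑ j ∈ s, X j φ • d (x j) ∈ kers X := by
  classical
  rw [mem_kers]
  intro j
  rw [map_sub, h.apply_sum]
  split_ifs with hj
  · exact sub_self _
  · rw [sub_zero]
    by_contra hn
    exact hj (hs j hn)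

theorem IsFrame.apply_eq_sum (h : IsFrame x X) {Z : VField M} (hZ : Z ∈ orth (kers X))
    {φ : Form M} {s : Finset J} (hs : ∀ j, X j φ ≠ 0 → j ∈ s) :
    Z φ = ∑ j ∈ s, Z (d (x j)) * X j φ := by
  have h1 := (Submodule.mem_dualAnnihilator Z).1 hZ _ (h.sub_mem hs)
  rw [map_sub, sub_eq_zero, map_sum] at h1
  rw [h1]
  exact Finset.sum_congr rfl fun j _ => by rw [map_smul, smul_eq_mul, mul_comm]

theorem mem_orth_kers (X : J → VField M) (j : J) : X j ∈ orth (kers X) :=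
  (Submodule.mem_dualAnnihilator _).2 fun _ hφ => mem_kers.1 hφ j

/-- Modulo `kers X` every form is a finite combination of the $dx_j$, so `Z` acts as $\sum
Z(dx_j)X_j$ on each single form. The finite set of indices has to depend on `φ`, since `J` may be
infinite. -/
theorem IsFrame.lieD_eq_sum (h : IsFrame x X) {Z : VField M} (hZ : Z ∈ orth (kers X))
    {φ : Form M} (hφ : φ ∈ kers X) :
    ∃ s : Finset J, lieD Z φ = ∑ j ∈ s, Z (d (x j)) • lieD (X j) φ := by
  classical
  let S : Form M → Finset J := fun ψ => (h.finite ψ).toFinset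
  let s : Finset J := φ.support.biUnion fun i => S (d (coord M i)) ∪ S (d (φ i))
  have h0 : Z φ = 0 := (Submodule.mem_dualAnnihilator Z).1 hZ _ hφ
  refine ⟨s, ?_⟩
  have : ∀ j, lieD (X j) φ = contractD (X j) φ := fun j => by
    rw [lieD, mem_kers.1 hφ j, d_zero, add_zero]
  rw [lieD, h0, d_zero, add_zero]
  simp only [this]
  refine contractD_eq_sum s _ X Z φ fun i hi => ⟨?_, ?_⟩
  · refine h.apply_eq_sum hZ fun j hj => Finset.mem_biUnion.2 ⟨i, hi, Finset.mem_union_left _ ?_⟩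
    exact (h.finite _).mem_toFinset.2 hj
  · refine h.apply_eq_sum hZ fun j hj => Finset.mem_biUnion.2 ⟨i, hi, Finset.mem_union_right _ ?_⟩
    exact (h.finite _).mem_toFinset.2 hj

theorem IsFrame.lieD_mem (h : IsFrame x X) {Z : VField M} (hZ : Z ∈ orth (kers X))
    {φ : Form M} (hφ : φ ∈ kers X) {P : Submodule (Fn M) (Form M)}
    (hP : ∀ j, lieD (X j) φ ∈ P) : lieD Z φ ∈ P := by
  obtain ⟨s, hs⟩ := h.lieD_eq_sum hZ hφ
  rw [hs]
  exact P.sum_mem fun j _ => P.smul_mem _ (hP j)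

/-- By Cartan's identity and stability, the bracket kills `kers X`. It also kills each $dx_k$,
because the functions $X_lx_k$ are constant. These forms span everything. -/
theorem IsFrame.commute (h : IsFrame x X)
    (hX : ∀ j, ∀ φ ∈ kers X, lieD (X j) φ ∈ kers X) : IsCommuting X := by
  classical
  intro i j f
  have hb : ∀ φ, bracket (X i) (X j) φ = 0 := by
    intro φ
    have h1 : ∀ ψ ∈ kers X, bracket (X i) (X j) ψ = 0 := fun ψ hψ => by
      have := apply_lieD (X i) (X j) ψ
      rw [mem_kers.1 (hX j ψ hψ) i, mem_kers.1 hψ i, d_zero, map_zero, zero_add] at this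
      exact this.symm
    have h2 : ∀ k, bracket (X i) (X j) (d (x k)) = 0 := fun k => by
      have h3 : ∀ l, d (X l (d (x k))) = 0 := fun l => by
        by_cases hl : l = k
        · rw [hl, h.dual_same, d_one]
        · rw [h.dual_ne _ _ hl, d_zero]
      rw [bracket_d, h3, h3, map_zero, map_zero, sub_zero]
    have h4 := h1 _ (h.sub_mem (φ := φ) (s := (h.finite φ).toFinset) fun j hj =>
      (h.finite φ).mem_toFinset.2 hj)
    rw [map_sub, map_sum, sub_eq_zero] at h4
    rw [h4]
    exact Finset.sum_eq_zero fun k _ => by rw [map_smul, h2, smul_zero]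
  have := hb (d f)
  rwa [bracket_d, sub_eq_zero] at this

theorem IsCommuting.of_coord (h : ∀ i j k, X i (d (X j (d (coord M k)))) =
    X j (d (X i (d (coord M k))))) (i j : J) : bracket (X i) (X j) = 0 :=
  vfield_ext fun k => by
    rw [bracket_d, h, sub_self]; rfl

theorem lieD_mem_kers (h : ∀ i j, bracket (X i) (X j) = 0) (j : J) {φ : Form M}
    (hφ : φ ∈ kers X) : lieD (X j) φ ∈ kers X := by
  rw [mem_kers]
  intro i
  rw [apply_lieD, h, mem_kers.1 hφ i, d_zero, map_zero]
  exact zero_add _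

theorem exists_sub_mem_of_span {A V : Type*} [CommRing A] [AddCommGroup V] [Module A V]
    {R : Submodule A V} {e : J → V}
    (hspan : Submodule.span A (Set.range fun j => R.mkQ (e j)) = ⊤) (φ : V) :
    ∃ ψ ∈ Submodule.span A (Set.range e), φ - ψ ∈ R := by
  have h1 : R.mkQ φ ∈ Submodule.map R.mkQ (Submodule.span A (Set.range e)) := by
    rw [Submodule.map_span, ← Set.range_comp]
    exact hspan ▸ trivial
  obtain ⟨ψ, hψ, h⟩ := h1
  exact ⟨ψ, hψ, (Submodule.Quotient.eq R).1 h.symm⟩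

/-- Local finiteness comes from spanning: modulo `R` a form is a finite sum $\sum c_j\,dx_j$, and
duality identifies $c_j$ with its value under $X_j$. -/
theorem isFrame_of_span {R : Submodule (Fn M) (Form M)}
    (hspan : Submodule.span (Fn M) (Set.range fun j => R.mkQ (d (x j))) = ⊤)
    (hX : ∀ j, X j ∈ orth R) (hs : ∀ j, X j (d (x j)) = 1)
    (hn : ∀ i j, i ≠ j → X i (d (x j)) = 0) : IsFrame x X ∧ kers X = R := by
  classical
  have hR : ∀ j, ∀ φ ∈ R, X j φ = 0 := fun j => (Submodule.mem_dualAnnihilator _).1 (hX j)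
  have key : ∀ φ : Form M, ∃ c : J →₀ Fn M,
      φ - c.sum (fun j a => a • d (x j)) ∈ R ∧ ∀ j, X j φ = c j := by
    intro φ
    obtain ⟨ψ, hψ, hψR⟩ := exists_sub_mem_of_span hspan φ
    obtain ⟨c, rfl⟩ := (Finsupp.mem_span_range_iff_exists_finsupp).1 hψ
    have h2 : φ - c.sum (fun j a => a • d (x j)) ∈ R := hψR
    refine ⟨c, h2, fun j => ?_⟩
    have h3 := hR j _ h2
    rw [map_sub, sub_eq_zero] at h3
    rw [h3, map_finsuppSum, Finsupp.sum, Finset.sum_eq_single j]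
    · simp [hs]
    · intro i _ hi
      rw [map_smul, hn _ _ hi.symm, smul_zero]
    · intro hj
      rw [Finsupp.notMem_support_iff.1 hj, zero_smul, map_zero]
  refine ⟨⟨hs, hn, fun i => ?_⟩, le_antisymm (fun φ hφ => ?_) fun φ hφ => ?_⟩
  · obtain ⟨c, -, hc⟩ := key (d (coord M i))
    simp only [hc]
    exact c.hasFiniteSupport
  · obtain ⟨c, h1, h2⟩ := key φ
    have : c = 0 := Finsupp.ext fun j => by rw [← h2, mem_kers.1 hφ j]; rfl
    simpa [this] using h1
  · exact mem_kers.2 fun j => hR j φ hφ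

theorem IsFrame.finDim_quotient [Finite J] (h : IsFrame x X) :
    FinDim (Fn M) (Form M ⧸ kers X) := by
  classical
  have := Fintype.ofFinite J
  let L : Form M →ₗ[Fn M] (J → Fn M) := LinearMap.pi X
  have hL : LinearMap.ker L = kers X := LinearMap.ker_pi _
  have hs : Function.Surjective L := fun c => ⟨∑ i, c i • d (x i), funext fun j => by
    change X j _ = _
    rw [h.apply_sum, if_pos (Finset.mem_univ j)]⟩
  let e := (Submodule.quotEquivOfEq _ _ hL.symm).trans (L.quotKerEquivOfSurjective hs)
  exact ⟨Module.Finite.equiv e.symm, Module.Free.of_equiv e.symm⟩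

/-! Restriction of frames. -/

variable {U : Opens (ι → ℝ)}

theorem resV_d (h : U ≤ M) (Z : VField M) (f : Fn M) :
    resV h Z (d (res h f)) = res h (Z (d f)) := (related_resV h Z).apply_d f

theorem IsFrame.res (hx : IsFrame x X) (h : U ≤ M) :
    IsFrame (fun j => res h (x j)) (fun j => resV h (X j)) where
  dual_same j := by rw [resV_d, hx.dual_same, map_one]
  dual_ne i j hij := by rw [resV_d, hx.dual_ne i j hij, map_zero]
  finite_coord i := (hx.finite_coord i).subset fun j hj h0 => hj (by
    rw [← res_coord h, resV_d, h0, map_zero])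

theorem IsFrame.kers_res (hx : IsFrame x X) (h : U ≤ M) :
    kers (fun j => resV h (X j)) = (incl h).extend (kers X) := by
  classical
  refine le_antisymm (fun φ hφ => ?_) (Submodule.span_le.2 ?_)
  · let S : ι → Finset J := fun i => (hx.finite (d (coord M i))).toFinset
    let s : Finset J := φ.support.biUnion S
    have hr : ∀ i ∈ φ.support, d (coord M i) - ∑ j ∈ s, X j (d (coord M i)) • d (x j) ∈ kers X :=
      fun i hi => hx.sub_mem fun j hj =>
        Finset.mem_biUnion.2 ⟨i, hi, (hx.finite _).mem_toFinset.2 hj⟩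
    -- Each $dh^i$ is corrected on `M`, where its component in `kers X` is available; the sum of the
    -- corrections is $\sum X_j(\varphi)\,dx_j$ and vanishes if `φ` is in the kernel.
    have h0 : φ = ∑ i ∈ φ.support, φ i • resForm h
        (d (coord M i) - ∑ j ∈ s, X j (d (coord M i)) • d (x j))
        + ∑ j ∈ s, resV h (X j) φ • resForm h (d (x j)) := by
      have h1 : ∀ j, resV h (X j) φ
          = ∑ i ∈ φ.support, φ i * Diffiety.res h (X j (d (coord M i))) := fun j => by
        conv_lhs => rw [form_eq_sum φ, map_sum]
        exact Finset.sum_congr rfl fun i _ => by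
          rw [map_smul, smul_eq_mul, ← res_coord h, resV_d]
      simp only [h1, resForm, Mor.pullForm_sub, Mor.pullForm_sum, Mor.pullForm_smul, smul_sub,
        Finset.sum_sub_distrib, Finset.sum_smul, Finset.smul_sum]
      rw [Finset.sum_comm (s := s)]
      simp only [mul_smul, sub_add_cancel]
      conv_lhs => rw [form_eq_sum φ]
      exact Finset.sum_congr rfl fun i _ => by rw [Mor.pullForm_coord]; rfl
    rw [h0]
    refine Submodule.add_mem _ (Submodule.sum_mem _ fun i hi => Submodule.smul_mem _ _ ?_)
      (Submodule.sum_mem _ fun j _ => ?_)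
    · exact Mor.pullForm_mem_extend _ (hr i hi)
    · rw [mem_kers.1 hφ j, zero_smul]; exact Submodule.zero_mem _
  · rintro _ ⟨φ, hφ, rfl⟩
    exact mem_kers.2 fun j => by rw [related_resV, mem_kers.1 hφ j, map_zero]

theorem IsCommuting.res (hX : IsCommuting X) (h : U ≤ M) : IsCommuting fun j => resV h (X j) := by
  intro i j f
  have hb : bracket (resV h (X i)) (resV h (X j)) = 0 :=
    IsCommuting.of_coord (X := fun j => resV h (X j)) (fun i j k => by
      rw [← res_coord h, resV_d, resV_d, resV_d, resV_d, hX]) i j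
  have := bracket_d (resV h (X i)) (resV h (X j)) f
  rw [hb] at this
  exact (sub_eq_zero.1 this.symm)

/-! Iterated Lie derivatives. -/

/-- The module generated by all iterated Lie derivatives of a family of forms. -/
def iterSpan {K : Type*} (X : J → VField M) (γ : K → Form M) : Submodule (Fn M) (Form M) :=
  Submodule.span (Fn M) {φ | ∃ k w, φ = iterForm X w (γ k)}

theorem iterForm_mem_iterSpan {K : Type*} (γ : K → Form M) (k : K) (w : List J) :
    iterForm X w (γ k) ∈ iterSpan X γ := Submodule.subset_span ⟨k, w, rfl⟩

theorem lieD_mem_iterSpan {K : Type*} {γ : K → Form M} (j : J) {φ : Form M}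
    (hφ : φ ∈ iterSpan X γ) : lieD (X j) φ ∈ iterSpan X γ := by
  refine lieD_mem_span Submodule.subset_span ?_ hφ
  rintro _ ⟨k, w, rfl⟩
  exact iterForm_mem_iterSpan (X := X) γ k (j :: w)

theorem iterForm_mem {P : Submodule (Fn M) (Form M)} (hP : ∀ j, ∀ φ ∈ P, lieD (X j) φ ∈ P)
    (w : List J) {φ : Form M} (hφ : φ ∈ P) : iterForm X w φ ∈ P := by
  induction w with
  | nil => exact hφ
  | cons j w ih => exact hP j _ ih

theorem iterSpan_le {K : Type*} {γ : K → Form M} {P : Submodule (Fn M) (Form M)}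
    (hP : ∀ j, ∀ φ ∈ P, lieD (X j) φ ∈ P) (hγ : ∀ k, γ k ∈ P) : iterSpan X γ ≤ P := by
  refine Submodule.span_le.2 ?_
  rintro _ ⟨k, w, rfl⟩
  exact iterForm_mem hP w (hγ k)

theorem iterSpan_res {K : Type*} (X : J → VField M) (γ : K → Form M) (h : U ≤ M) :
    iterSpan (fun j => resV h (X j)) (fun k => resForm h (γ k))
      = (incl h).extend (iterSpan X γ) := by
  rw [iterSpan, iterSpan, Mor.extend_span]
  congr 1
  ext φ
  constructor
  · rintro ⟨k, w, rfl⟩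
    exact ⟨_, ⟨k, w, rfl⟩, (Related.iterForm (fun j => related_resV h (X j)) w (γ k)).symm⟩
  · rintro ⟨_, ⟨k, w, rfl⟩, rfl⟩
    exact ⟨k, w, (Related.iterForm (fun j => related_resV h (X j)) w (γ k)).symm⟩

/-! Changing the frame. -/

/-- Cramer's rule: the inverse matrix turns the fields into the fields dual to the $dk_i$, and an
invertible change of the fields leaves their common kernel unchanged. -/
theorem exists_dual [Fintype J] [DecidableEq J] (k : J → Fn M) (X : J → VField M)
    (h : IsUnit (Matrix.of fun j i => X j (d (k i))).det) :
    ∃ B : Matrix J J (Fn M), B = (Matrix.of fun j i => X j (d (k i)))⁻¹ ∧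
      (∀ i i', (∑ j, B i j • X j) (d (k i')) = if i = i' then 1 else 0) ∧
      kers (fun i => ∑ j, B i j • X j) = kers X := by
  set A : Matrix J J (Fn M) := Matrix.of fun j i => X j (d (k i)) with hA
  refine ⟨A⁻¹, rfl, fun i i' => ?_, le_antisymm (fun φ hφ => ?_) fun φ hφ => ?_⟩
  · rw [LinearMap.sum_apply]
    have := congrFun (congrFun (Matrix.nonsing_inv_mul A h) i) i'
    rw [Matrix.mul_apply, Matrix.one_apply] at this
    rw [← this]
    rfl
  · rw [mem_kers] at hφ ⊢
    have h1 : A⁻¹.mulVec (fun j => X j φ) = 0 := funext fun i => by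
      have := hφ i
      rw [LinearMap.sum_apply] at this
      exact this
    have h2 : A.mulVec (A⁻¹.mulVec (fun j => X j φ)) = fun j => X j φ := by
      rw [Matrix.mulVec_mulVec, Matrix.mul_nonsing_inv A h, Matrix.one_mulVec]
    rw [h1, Matrix.mulVec_zero] at h2
    exact fun j => (congrFun h2 j).symm
  · rw [mem_kers] at hφ ⊢
    intro i
    rw [LinearMap.sum_apply]
    exact Finset.sum_eq_zero fun j _ => by rw [LinearMap.smul_apply, hφ j, smul_zero]

end Frames

/-! ### Upward closed sets for well quasi-orders -/

section WQO

variable {I : Type*} {r : I → I → Prop}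

/-- In a strictly increasing chain of upward closed sets, new elements chosen at successive steps
would contain $g_m$ below $g_n$ with $m<n$. Then $g_n$ would already belong to the earlier set that
contains $g_m$. -/
theorem exists_maximal_of_wqo (hr : WellQuasiOrdered r) {C : Set (Set I)} (hne : C.Nonempty)
    (hC : ∀ S ∈ C, ∀ a b, a ∈ S → r a b → b ∈ S) : ∃ S ∈ C, ∀ T ∈ C, S ⊆ T → T ⊆ S := by
  have wf : WellFounded fun S T : C => T.1 ⊂ S.1 := by
    rw [wellFounded_iff_isEmpty_descending_chain]
    refine ⟨fun ⟨f, hf⟩ => ?_⟩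
    have hmono : Monotone fun n => (f n).1 := monotone_nat_of_le_succ fun n => (hf n).1
    choose g hg hg' using fun n => Set.exists_of_ssubset (hf n)
    obtain ⟨m, n, hmn, h⟩ := hr g
    exact hg' n (hmono (Nat.succ_le_of_lt hmn) (hC _ (f (m + 1)).2 _ _ (hg m) h))
  obtain ⟨S₀, hS₀⟩ := hne
  obtain ⟨S, -, hS⟩ := wf.has_min Set.univ ⟨⟨S₀, hS₀⟩, trivial⟩
  refine ⟨S.1, S.2, fun T hT hST => ?_⟩
  by_contra hn
  exact hS ⟨T, hT⟩ trivial ⟨hST, hn⟩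

/-- A maximal set among those generated by finitely many elements of `S` must absorb every further
element of `S`. -/
theorem exists_finite_generators (hr : WellQuasiOrdered r) (refl : ∀ a, r a a)
    (trans : ∀ a b c, r a b → r b c → r a c) (S : Set I) :
    ∃ G : Finset I, (∀ g ∈ G, g ∈ S) ∧ ∀ a ∈ S, ∃ g ∈ G, r g a := by
  classical
  let C : Set (Set I) := {T | ∃ G : Finset I, (∀ g ∈ G, g ∈ S) ∧ T = {a | ∃ g ∈ G, r g a}}
  obtain ⟨T, ⟨G, hG, rfl⟩, hmax⟩ := exists_maximal_of_wqo hr (C := C)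
    ⟨_, ∅, by simp, rfl⟩ (by
      rintro _ ⟨G, -, rfl⟩ a b ⟨g, hg, ha⟩ hab
      exact ⟨g, hg, trans _ _ _ ha hab⟩)
  refine ⟨G, hG, fun a ha => ?_⟩
  refine hmax {b | ∃ g ∈ insert a G, r g b} ⟨insert a G, ?_, rfl⟩ ?_
    ⟨a, Finset.mem_insert_self _ _, refl a⟩
  · intro g hg
    rcases Finset.mem_insert.1 hg with rfl | hg
    exacts [ha, hG g hg]
  · rintro b ⟨g, hg, hb⟩
    exact ⟨g, Finset.mem_insert_of_mem hg, hb⟩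

end WQO

/-! ### Monomials -/

/-- Pairs of an index and a monomial in `n` variables. -/
def Mon (K n : ℕ) : Type := Fin K × (Fin n →₀ ℕ)

namespace Mon

variable {K n : ℕ}

/-- The index and the monomial. -/
def mk (r : Fin K) (α : Fin n →₀ ℕ) : Mon K n := (r, α)

/-- The order key: monomials are compared first. -/
def key (μ : Mon K n) : MonomialOrder.degLex.syn (σ := Fin n) ×ₗ Fin K :=
  toLex (MonomialOrder.degLex.toSyn μ.2, μ.1)

theorem key_injective : Function.Injective (key : Mon K n → _) := by
  rintro ⟨r, α⟩ ⟨r', α'⟩ h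
  have h' := toLex.injective h
  exact Prod.ext (congrArg Prod.snd h')
    (MonomialOrder.degLex.toSyn.injective (congrArg Prod.fst h'))

instance : LinearOrder (Mon K n) := LinearOrder.lift' key key_injective

theorem lt_iff {μ ν : Mon K n} : μ < ν ↔ key μ < key ν := Iff.rfl

instance : WellFoundedLT (Mon K n) := ⟨InvImage.wf key wellFounded_lt⟩

instance : Countable (Mon K n) := inferInstanceAs (Countable (Fin K × (Fin n →₀ ℕ)))

/-- Multiplication by a variable. -/
def shift (j : Fin n) (μ : Mon K n) : Mon K n := (μ.1, μ.2 + Finsupp.single j 1)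

/-- The degree of the monomial. -/
def deg (μ : Mon K n) : ℕ := μ.2.degree

theorem deg_shift (j : Fin n) (μ : Mon K n) : deg (shift j μ) = deg μ + 1 := by
  simp [deg, shift]

/-- With `lt_shift` this makes the order a monomial order: differentiation preserves the ranking, so
a differentiated relation keeps its leading term. -/
theorem shift_lt_shift (j : Fin n) {μ ν : Mon K n} (h : μ < ν) : shift j μ < shift j ν := by
  rw [lt_iff, key, key, Prod.Lex.toLex_lt_toLex] at h ⊢
  simp only [shift, map_add, add_lt_add_iff_right, add_left_inj]
  exact h

theorem lt_shift (j : Fin n) (μ : Mon K n) : μ < shift j μ := by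
  rw [lt_iff, key, key, Prod.Lex.toLex_lt_toLex]
  left
  have h : μ.2 < μ.2 + Finsupp.single j 1 := lt_of_le_of_ne (le_add_of_nonneg_right
    (zero_le)) fun h => by simp at h
  exact MonomialOrder.degLex.toSyn_strictMono h

theorem deg_le_of_lt {μ ν : Mon K n} (h : μ < ν) : deg μ ≤ deg ν := by
  rw [lt_iff, key, key, Prod.Lex.toLex_lt_toLex] at h
  rcases h with h | h
  · exact Finsupp.DegLex.monotone_degree h.le
  · exact le_of_eq (congrArg Finsupp.degree (MonomialOrder.degLex.toSyn.injective h.1))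

theorem deg_le_of_le {μ ν : Mon K n} (h : μ ≤ ν) : deg μ ≤ deg ν := by
  rcases h.lt_or_eq with h | rfl
  exacts [deg_le_of_lt h, le_rfl]

theorem finite_deg_le (l : ℕ) : {μ : Mon K n | deg μ ≤ l}.Finite := by
  have h : {α : Fin n →₀ ℕ | α.degree ≤ l}.Finite := by
    refine Set.Finite.subset (Set.finite_Iic (Finsupp.equivFunOnFinite.symm fun _ => l))
      fun α hα i => ?_
    exact (Finsupp.le_degree i α).trans hα
  exact (Set.finite_univ.prod h).subset fun μ hμ => ⟨trivial, hμ⟩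

theorem exists_eq_shift {μ : Mon K n} (h : 0 < deg μ) : ∃ j ν, μ = shift j ν := by
  have h0 : μ.2 ≠ 0 := fun h0 => by simp [deg, h0] at h
  obtain ⟨j, hj⟩ := Finsupp.ne_iff.1 h0
  refine ⟨j, (μ.1, μ.2 - Finsupp.single j 1), Prod.ext rfl ?_⟩
  refine (tsub_add_cancel_of_le ?_).symm
  rw [Finsupp.single_le_iff]
  exact Nat.one_le_iff_ne_zero.2 hj

/-- Divisibility. -/
def Dvd (μ ν : Mon K n) : Prop := μ.1 = ν.1 ∧ μ.2 ≤ ν.2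

/-- Dickson's lemma, with finitely many indices. -/
theorem wqo_dvd : WellQuasiOrdered (Dvd : Mon K n → Mon K n → Prop) :=
  (Finite.wellQuasiOrdered (· = ·)).prod wellQuasiOrdered_le

theorem mem_of_dvd {S : Set (Mon K n)} (hS : ∀ j, ∀ μ ∈ S, shift j μ ∈ S) {μ ν : Mon K n}
    (hμ : μ ∈ S) (h : Dvd μ ν) : ν ∈ S := by
  obtain ⟨r, α⟩ := μ
  obtain ⟨r', β⟩ := ν
  obtain ⟨h1, h2⟩ := h
  change r = r' at h1
  change α ≤ β at h2
  subst h1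
  obtain ⟨δ, rfl⟩ := exists_add_of_le h2
  clear h2
  induction δ using Finsupp.induction_on_max with
  | zero => simpa using hμ
  | single_add i b δ _ _ ih =>
    clear * - ih hS
    induction b with
    | zero => simpa using ih
    | succ b ihb =>
      have := hS i _ ihb
      rw [Finsupp.single_add]
      have e : α + (Finsupp.single i b + Finsupp.single i 1 + δ)
          = α + (Finsupp.single i b + δ) + Finsupp.single i 1 := by abel
      rw [e]
      exact this

theorem exists_generators {S : Set (Mon K n)} (hS : ∀ j, ∀ μ ∈ S, shift j μ ∈ S) :
    ∃ G : Finset (Mon K n), (∀ μ ∈ G, μ ∈ S) ∧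
      ∀ μ ∈ S, μ ∈ G ∨ ∃ j, ∃ ν ∈ S, μ = shift j ν := by
  obtain ⟨G, hG, h⟩ := exists_finite_generators wqo_dvd (fun a : Mon K n => ⟨rfl, le_rfl⟩)
    (fun a b c h1 h2 => ⟨h1.1.trans h2.1, h1.2.trans h2.2⟩) S
  refine ⟨G, hG, fun μ hμ => ?_⟩
  obtain ⟨g, hg, h1, h2⟩ := h μ hμ
  by_cases hgm : g = μ
  · exact Or.inl (hgm ▸ hg)
  right
  have hne : μ.2 - g.2 ≠ 0 := fun h0 => hgm (Prod.ext h1 (le_antisymm h2 (tsub_eq_zero_iff_le.1 h0)))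
  obtain ⟨j, hj⟩ := Finsupp.ne_iff.1 hne
  have hj' : g.2 j + 1 ≤ μ.2 j := by
    simp only [Finsupp.tsub_apply, Finsupp.zero_apply] at hj
    omega
  refine ⟨j, (μ.1, μ.2 - Finsupp.single j 1), mem_of_dvd hS (hG g hg) ⟨h1, fun i => ?_⟩,
    Prod.ext rfl (tsub_add_cancel_of_le ?_).symm⟩
  · rw [Finsupp.tsub_apply, Finsupp.single_apply]
    have := h2 i
    split_ifs with hij
    · subst hij; omega
    · simpa using this
  · rw [Finsupp.single_le_iff]; omega

end Mon

/-! ### Dependence along a well-ordered family -/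

section Dependence

theorem extend_sup {U : Opens (ι → ℝ)} (h : U ≤ M) (P Q : Submodule (Fn M) (Form M)) :
    (incl h).extend (P ⊔ Q) ≤ (incl h).extend P ⊔ (incl h).extend Q := by
  refine Submodule.span_le.2 ?_
  rintro _ ⟨φ, hφ, rfl⟩
  obtain ⟨a, ha, b, hb, rfl⟩ := Submodule.mem_sup.1 hφ
  rw [Mor.pullForm_add]
  exact Submodule.add_mem_sup (Mor.pullForm_mem_extend _ ha) (Mor.pullForm_mem_extend _ hb)

variable {I : Type*}

theorem resForm_mem_sup_span {U : Opens (ι → ℝ)} (h : U ≤ M) {e : I → Form M}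
    {Q : Submodule (Fn M) (Form M)}
    {S : Set I} {φ : Form M} (hφ : φ ∈ Q ⊔ Submodule.span (Fn M) (e '' S)) :
    resForm h φ ∈ (incl h).extend Q ⊔
      Submodule.span (Fn U) ((fun ν => resForm h (e ν)) '' S) := by
  have := extend_sup h _ _ (Mor.pullForm_mem_extend (incl h) hφ)
  rwa [Mor.extend_span, ← Set.image_comp] at this

variable [LinearOrder I]

/-- The indices of those members of a family which depend on preceding ones modulo `Q`. -/
def depSet (e : I → Form M) (Q : Submodule (Fn M) (Form M)) : Set I :=
  {μ | e μ ∈ Q ⊔ Submodule.span (Fn M) (e '' Set.Iio μ)}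

variable {U : Opens (ι → ℝ)}

theorem depSet_subset_res (h : U ≤ M) (e : I → Form M) (Q : Submodule (Fn M) (Form M)) :
    depSet e Q ⊆ depSet (fun ν => resForm h (e ν)) ((incl h).extend Q) :=
  fun _ hμ => resForm_mem_sup_span h hμ

/-- The set of dependent indices does not increase on smaller open sets. -/
def IsGeneric (e : I → Form M) (Q : Submodule (Fn M) (Form M)) : Prop :=
  ∀ (U : Opens (ι → ℝ)) (h : U ≤ M), (U : Set (ι → ℝ)).Nonempty →
    depSet (fun ν => resForm h (e ν)) ((incl h).extend Q) ⊆ depSet e Q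

/-- Restriction can only create dependences. A maximal set of dependent indices is attained on some
open `U`, and no smaller open set can exceed it. -/
theorem exists_isGeneric {r : I → I → Prop} (hr : WellQuasiOrdered r) (e : I → Form M)
    (Q : Submodule (Fn M) (Form M))
    (hup : ∀ (U : Opens (ι → ℝ)) (h : U ≤ M), ∀ a b,
      a ∈ depSet (fun ν => resForm h (e ν)) ((incl h).extend Q) → r a b →
      b ∈ depSet (fun ν => resForm h (e ν)) ((incl h).extend Q))
    (hM : (M : Set (ι → ℝ)).Nonempty) :
    ∃ (U : Opens (ι → ℝ)) (h : U ≤ M), (U : Set (ι → ℝ)).Nonempty ∧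
      IsGeneric (fun ν => resForm h (e ν)) ((incl h).extend Q) := by
  obtain ⟨S, ⟨U, h, hU, rfl⟩, hS⟩ := exists_maximal_of_wqo hr
    (C := {S | ∃ (U : Opens (ι → ℝ)) (h : U ≤ M), (U : Set (ι → ℝ)).Nonempty ∧
      S = depSet (fun ν => resForm h (e ν)) ((incl h).extend Q)})
    ⟨_, M, le_rfl, hM, rfl⟩ (by
      rintro _ ⟨U, h, -, rfl⟩
      exact hup U h)
  refine ⟨U, h, hU, fun U' h' hU' => ?_⟩
  have h1 := depSet_subset_res h' (fun ν => resForm h (e ν)) ((incl h).extend Q)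
  simp only [resForm_resForm, extend_extend] at h1 ⊢
  exact hS _ ⟨U', h'.trans h, hU', rfl⟩ h1

theorem mem_sup_span_of_notMem_depSet [WellFoundedLT I] (e : I → Form M)
    (Q : Submodule (Fn M) (Form M)) (μ : I) :
    e μ ∈ Q ⊔ Submodule.span (Fn M) (e '' {ν | ν ∉ depSet e Q ∧ ν ≤ μ}) := by
  induction μ using WellFoundedLT.induction with
  | ind μ ih =>
    by_cases hμ : μ ∈ depSet e Q
    · refine (sup_le le_sup_left (Submodule.span_le.2 ?_) :
        Q ⊔ Submodule.span (Fn M) (e '' Set.Iio μ) ≤ _) hμ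
      rintro _ ⟨ν, hν, rfl⟩
      refine (sup_le_sup_left (Submodule.span_mono (Set.image_mono ?_)) Q) (ih ν hν)
      exact fun l hl => ⟨hl.1, hl.2.trans (le_of_lt hν)⟩
    · exact Submodule.mem_sup_right (Submodule.subset_span ⟨μ, ⟨hμ, le_rfl⟩, rfl⟩)

theorem mem_sup_span_of_mem_depSet [WellFoundedLT I] (e : I → Form M)
    (Q : Submodule (Fn M) (Form M)) {μ : I} (hμ : μ ∈ depSet e Q) :
    e μ ∈ Q ⊔ Submodule.span (Fn M) (e '' {ν | ν ∉ depSet e Q ∧ ν < μ}) := by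
  refine (sup_le_sup_left (Submodule.span_mono (Set.image_mono ?_)) Q)
    (mem_sup_span_of_notMem_depSet e Q μ)
  exact fun l hl => ⟨hl.1, lt_of_le_of_ne hl.2 fun h => hl.1 (h ▸ hμ)⟩

theorem exists_opens_of_isOpen {S : Set M} (hS : IsOpen S) :
    ∃ (U : Opens (ι → ℝ)) (_ : U ≤ M), ∀ p : M, p.1 ∈ U ↔ p ∈ S := by
  refine ⟨⟨Subtype.val '' S, M.isOpen.isOpenMap_subtype_val _ hS⟩, ?_, fun p => ?_⟩
  · rintro _ ⟨p, -, rfl⟩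
    exact p.2
  · exact Subtype.val_injective.mem_set_image

theorem exists_isUnit_res {f : Fn M} {p : M} (h : ev p f ≠ 0) :
    ∃ (U : Opens (ι → ℝ)) (hU : U ≤ M), p.1 ∈ U ∧ IsUnit (res hU f) := by
  have ho : IsOpen {q : M | ev q f ≠ 0} := isOpen_ne_fun (continuous_ev f) continuous_const
  obtain ⟨U, hU, hmem⟩ := exists_opens_of_isOpen ho
  refine ⟨U, hU, (hmem p).2 h, isUnit_of_ne_zero fun q => ?_⟩
  exact (hmem ⟨q.1, hU q.2⟩).1 q.2

theorem exists_ev_ne_zero {f : Fn M} (h : f ≠ 0) : ∃ p, ev p f ≠ 0 := by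
  by_contra! hn
  exact h (ext_ev fun p => by rw [hn p, map_zero])

/-- Otherwise, near a point where the leading coefficient is nonzero, the relation can be solved for
the leading form. Its index is then dependent on a smaller open set, hence already on `M` by
genericity. -/
theorem IsGeneric.eq_zero {e : I → Form M} {Q : Submodule (Fn M) (Form M)} (h : IsGeneric e Q)
    {s : Finset I} (hs : ∀ ν ∈ s, ν ∉ depSet e Q) {c : I → Fn M}
    (hc : ∑ ν ∈ s, c ν • e ν ∈ Q) : ∀ ν ∈ s, c ν = 0 := by
  classical
  by_contra! hn
  let t : Finset I := s.filter fun ν => c ν ≠ 0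
  have ht : t.Nonempty := by
    obtain ⟨ν, hν, h0⟩ := hn
    exact ⟨ν, Finset.mem_filter.2 ⟨hν, h0⟩⟩
  set μ := t.max' ht with hμdef
  have hμ : μ ∈ t := t.max'_mem ht
  have hμs := (Finset.mem_filter.1 hμ).1
  obtain ⟨p, hp⟩ := exists_ev_ne_zero (Finset.mem_filter.1 hμ).2
  obtain ⟨U, hU, hpU, hu⟩ := exists_isUnit_res hp
  refine hs μ hμs (h U hU ⟨_, hpU⟩ ?_)
  have h1 : ∑ ν ∈ t, c ν • e ν ∈ Q := by
    convert hc using 1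
    refine Finset.sum_subset (Finset.filter_subset _ _) fun ν hν hνt => ?_
    have : c ν = 0 := by
      by_contra h0
      exact hνt (Finset.mem_filter.2 ⟨hν, h0⟩)
    rw [this, zero_smul]
  rw [← Finset.add_sum_erase t _ hμ] at h1
  have h2 := Mor.pullForm_mem_extend (incl hU) h1
  rw [Mor.pullForm_add, Mor.pullForm_smul, Mor.pullForm_sum] at h2
  obtain ⟨u, hu⟩ := hu
  have h3 : resForm hU (e μ) = (↑u⁻¹ : Fn U) • (res hU (c μ) • resForm hU (e μ)
      + ∑ ν ∈ t.erase μ, resForm hU (c ν • e ν))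
      - (↑u⁻¹ : Fn U) • ∑ ν ∈ t.erase μ, resForm hU (c ν • e ν) := by
    rw [smul_add, add_sub_cancel_right, smul_smul, ← hu, Units.inv_mul, one_smul]
  rw [depSet, Set.mem_ofPred_eq, h3]
  refine Submodule.sub_mem _ (Submodule.mem_sup_left (Submodule.smul_mem _ _ h2))
    (Submodule.mem_sup_right (Submodule.smul_mem _ _ (Submodule.sum_mem _ fun ν hν => ?_)))
  rw [resForm, Mor.pullForm_smul]
  refine Submodule.smul_mem _ _ (Submodule.subset_span ⟨ν, ?_, rfl⟩)
  exact lt_of_le_of_ne (t.le_max' ν (Finset.mem_of_mem_erase hν)) (Finset.ne_of_mem_erase hν)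

end Dependence

/-! ### Derivatives indexed by monomials -/

section Monomials

variable {K n : ℕ} {X : Fin n → VField M} {h : Fin K → Fn M}

theorem iterFn_perm {J : Type*} {X : J → VField M} (hX : IsCommuting X) {w w' : List J}
    (hw : w.Perm w') (f : Fn M) : iterFn X w f = iterFn X w' f :=
  have : LeftCommutative fun (j : J) (g : Fn M) => X j (d g) := ⟨fun i j g => hX i j g⟩
  hw.foldr_eq f

/-- The derivative of `h r` with respect to a monomial in the vector fields. -/
def monFn (X : Fin n → VField M) (h : Fin K → Fn M) (μ : Mon K n) : Fn M :=
  iterFn X (Finsupp.toMultiset μ.2).toList (h μ.1)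

theorem iterFn_eq_monFn (hX : IsCommuting X) (w : List (Fin n)) (r : Fin K) :
    iterFn X w (h r) = monFn X h (Mon.mk r (Multiset.toFinsupp w)) := by
  refine iterFn_perm hX ?_ _
  rw [← Multiset.coe_eq_coe]
  simp [Mon.mk]

theorem monFn_zero (r : Fin K) : monFn X h (Mon.mk r 0) = h r := by
  simp [monFn, Mon.mk, iterFn]

theorem apply_d_monFn (hX : IsCommuting X) (j : Fin n) (μ : Mon K n) :
    X j (d (monFn X h μ)) = monFn X h (Mon.shift j μ) := by
  change iterFn X (j :: (Finsupp.toMultiset μ.2).toList) (h μ.1) = _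
  refine iterFn_perm hX ?_ _
  rw [← Multiset.coe_eq_coe, ← Multiset.cons_coe, Multiset.coe_toList, Multiset.coe_toList]
  simp [Mon.shift, ← Multiset.singleton_add, add_comm]

theorem res_monFn {U : Opens (ι → ℝ)} (hU : U ≤ M) (μ : Mon K n) :
    monFn (fun j => resV hU (X j)) (fun r => res hU (h r)) μ = res hU (monFn X h μ) :=
  Related.iterFn (fun j => related_resV hU (X j)) _ _

/-- The Lie derivative along `X j` of a dependence relation for `μ` is one for `shift j μ`:
differentials of smaller derivatives go to differentials still below the shifted monomial, and the
coefficients contribute only multiples of the old terms. -/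
theorem shift_mem_depSet (hX : IsCommuting X) {Q : Submodule (Fn M) (Form M)}
    (hQ : ∀ j, ∀ φ ∈ Q, lieD (X j) φ ∈ Q) (j : Fin n) (μ : Mon K n)
    (hμ : μ ∈ depSet (fun ν => d (monFn X h ν)) Q) :
    Mon.shift j μ ∈ depSet (fun ν => d (monFn X h ν)) Q := by
  rw [depSet, Set.mem_ofPred_eq, ← apply_d_monFn hX, ← lieD_d]
  obtain ⟨q, hq, ψ, hψ, he⟩ := Submodule.mem_sup.1 hμ
  change q + ψ = d (monFn X h μ) at he
  rw [← he, lieD_add]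
  refine Submodule.add_mem_sup (hQ j q hq) (lieD_mem_span ?_ ?_ hψ)
  · rintro _ ⟨ν, hν, rfl⟩
    exact Submodule.subset_span ⟨ν, lt_trans hν (Mon.lt_shift j μ), rfl⟩
  · rintro _ ⟨ν, hν, rfl⟩
    rw [lieD_d, apply_d_monFn hX]
    exact Submodule.subset_span ⟨_, Mon.shift_lt_shift j hν, rfl⟩

theorem lieD_mem_extend {U : Opens (ι → ℝ)} (hU : U ≤ M) {Z : VField M}
    {Q : Submodule (Fn M) (Form M)} (hQ : ∀ φ ∈ Q, lieD Z φ ∈ Q) {φ : Form U}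
    (hφ : φ ∈ (incl hU).extend Q) : lieD (resV hU Z) φ ∈ (incl hU).extend Q := by
  refine lieD_mem_span Submodule.subset_span ?_ hφ
  rintro _ ⟨ψ, hψ, rfl⟩
  rw [(related_resV hU Z).lieD]
  exact Mor.pullForm_mem_extend _ (hQ ψ hψ)

theorem exists_isGeneric_monFn (hX : IsCommuting X) (h : Fin K → Fn M)
    {Q : Submodule (Fn M) (Form M)} (hQ : ∀ j, ∀ φ ∈ Q, lieD (X j) φ ∈ Q)
    (hM : (M : Set (ι → ℝ)).Nonempty) :
    ∃ (U : Opens (ι → ℝ)) (hU : U ≤ M), (U : Set (ι → ℝ)).Nonempty ∧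
      IsGeneric (fun ν => d (monFn (fun j => resV hU (X j)) (fun r => res hU (h r)) ν))
        ((incl hU).extend Q) := by
  have he : ∀ (U : Opens (ι → ℝ)) (hU : U ≤ M),
      (fun ν => d (monFn (fun j => resV hU (X j)) (fun r => res hU (h r)) ν))
        = fun ν => resForm hU (d (monFn X h ν)) := fun U hU => funext fun ν => by
    rw [res_monFn, resForm_d]
  obtain ⟨U, hU, hne, hg⟩ := exists_isGeneric Mon.wqo_dvd (fun ν => d (monFn X h ν)) Q
    (fun U hU a b ha hab => by
      rw [← he] at ha ⊢
      exact Mon.mem_of_dvd (fun j μ hμ => shift_mem_depSet (hX.res hU)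
        (fun j φ hφ => lieD_mem_extend hU (hQ j) hφ) j μ hμ) ha hab) hM
  exact ⟨U, hU, hne, by rw [he]; exact hg⟩

end Monomials

/-! ### Functional dependence -/

theorem eventually_differentiableAt {E F : Type*} [NormedAddCommGroup E] [NormedSpace ℝ E]
    [NormedAddCommGroup F] [NormedSpace ℝ F] {g : E → F} {x : E} (hg : ContDiffAt ℝ ∞ g x) :
    ∀ᶠ y in 𝓝 x, DifferentiableAt ℝ g y := by
  have h := (hg.of_le (m := 1) (by exact_mod_cast le_top)).eventually (by simp)
  exact h.mono fun y hy => hy.differentiableAt (by simp)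

/-- A function whose differential vanishes on the kernels of the differential of a submersion
factors locally through the submersion. -/
theorem exists_factor_of_ker_le {E F : Type*} [NormedAddCommGroup E] [NormedSpace ℝ E]
    [FiniteDimensional ℝ E] [NormedAddCommGroup F] [NormedSpace ℝ F] [FiniteDimensional ℝ F]
    {ψ : E → F} {f : E → ℝ} {p : E} (hψ : ContDiffAt ℝ ∞ ψ p) (hf : ContDiffAt ℝ ∞ f p)
    (hs : (fderiv ℝ ψ p).range = ⊤)
    (hker : ∀ᶠ q in 𝓝 p, ∀ z, fderiv ℝ ψ q z = 0 → fderiv ℝ f q z = 0) :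
    ∃ G : F → ℝ, ContDiffAt ℝ ∞ G (ψ p) ∧ ∀ᶠ q in 𝓝 p, f q = G (ψ q) := by
  have : CompleteSpace E := FiniteDimensional.complete ℝ E
  have : CompleteSpace F := FiniteDimensional.complete ℝ F
  have hψs : HasStrictFDerivAt ψ (fderiv ℝ ψ p) p := hψ.hasStrictFDerivAt (by simp)
  have hcompl := (fderiv ℝ ψ p).ker_closedComplemented_of_finiteDimensional_range
  -- The implicit function theorem straightens `ψ` to the first projection of $F\times K$, with $K$
  -- the kernel at `p`. In these coordinates `f` has zero derivative along $K$, hence is constant in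
  -- that direction on a product of balls, and freezing the second variable gives the factor.
  let φ := hψs.implicitFunctionDataOfComplemented ψ (fderiv ℝ ψ p) hs hcompl
  let K := (fderiv ℝ ψ p).ker
  let Ψ : F × K → E := φ.implicitFunction.uncurry
  let pr : E → K := φ.rightFun
  have hprs : ContDiffAt ℝ ∞ pr p := by
    change ContDiffAt ℝ ∞ (fun x => Classical.choose hcompl (x - p)) p
    fun_prop
  have hprc : ContinuousAt pr p := hprs.continuousAt
  have hΨ : ContDiffAt ℝ ∞ Ψ (ψ p, pr p) :=
    ImplicitFunctionData.contDiffAt_implicitFunction (φ := φ) hψ hprs (by simp)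
  have hΨp : Ψ (ψ p, pr p) = p := φ.implicitFunction_apply_image.self_of_nhds
  have hl : ∀ᶠ u : F × K in 𝓝 (ψ p, pr p), ψ (Ψ u) = u.1 := φ.leftFun_implicitFunction
  have hinv : ∀ᶠ x in 𝓝 p, Ψ (ψ x, pr x) = x := φ.implicitFunction_apply_image
  let H : F × K → ℝ := fun u => f (Ψ u)
  have hH : ContDiffAt ℝ ∞ H (ψ p, pr p) :=
    ContDiffAt.comp (g := f) _ (by rwa [hΨp]) hΨ
  have hΨt : Tendsto Ψ (𝓝 (ψ p, pr p)) (𝓝 p) := by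
    have := hΨ.continuousAt.tendsto
    rwa [hΨp] at this
  have hz : ∀ᶠ u : F × K in 𝓝 (ψ p, pr p), DifferentiableAt ℝ H u ∧
      ∀ w : K, fderiv ℝ H u (0, w) = 0 := by
    filter_upwards [eventually_differentiableAt hH, eventually_differentiableAt hΨ, hΨt.eventually (eventually_differentiableAt hf), hΨt.eventually (eventually_differentiableAt hψ),
      hΨt.eventually hker, hl.eventually_nhds] with u h1 h2 h3 h4 h5 h6
    refine ⟨h1, fun w => ?_⟩
    have e1 : fderiv ℝ H u = (fderiv ℝ f (Ψ u)).comp (fderiv ℝ Ψ u) := fderiv_comp u h3 h2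
    rw [e1, ContinuousLinearMap.comp_apply]
    refine h5 _ ?_
    have e2 : fderiv ℝ (fun u => ψ (Ψ u)) u = (fderiv ℝ ψ (Ψ u)).comp (fderiv ℝ Ψ u) :=
      fderiv_comp u h4 h2
    have e3 : fderiv ℝ (fun u => ψ (Ψ u)) u = ContinuousLinearMap.fst ℝ F K := by
      rw [EventuallyEq.fderiv_eq h6]
      exact fderiv_fst
    rw [← ContinuousLinearMap.comp_apply, ← e2, e3]
    rfl
  obtain ⟨ε, hε, hball⟩ := Metric.eventually_nhds_iff_ball.1 hz
  refine ⟨fun u => H (u, pr p), ?_, ?_⟩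
  · exact ContDiffAt.comp (g := H) (ψ p) hH (contDiffAt_id.prodMk contDiffAt_const)
  · have h1 : ∀ᶠ x in 𝓝 p, ψ x ∈ Metric.ball (ψ p) ε :=
      hψ.continuousAt.eventually (Metric.ball_mem_nhds _ hε)
    have h2 : ∀ᶠ x in 𝓝 p, pr x ∈ Metric.ball (pr p) ε :=
      hprc.eventually (Metric.ball_mem_nhds _ hε)
    filter_upwards [h1, h2, hinv] with x hx1 hx2 hx3
    have hd : ∀ v ∈ Metric.ball (pr p) ε, DifferentiableAt ℝ (fun v => H (ψ x, v)) v ∧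
        fderiv ℝ (fun v => H (ψ x, v)) v = 0 := by
      intro v hv
      have hm : (ψ x, v) ∈ Metric.ball (ψ p, pr p) ε := by
        rw [← ball_prod_same]
        exact ⟨hx1, hv⟩
      obtain ⟨h3, h4⟩ := hball _ hm
      have h5 : HasFDerivAt (fun v => H (ψ x, v)) _ v :=
        h3.hasFDerivAt.comp v ((hasFDerivAt_const (ψ x) v).prodMk (hasFDerivAt_id v))
      refine ⟨h5.differentiableAt, ?_⟩
      rw [h5.fderiv]
      exact ContinuousLinearMap.ext fun w => h4 w
    have h6 : H (ψ x, pr x) = H (ψ x, pr p) :=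
      Metric.isOpen_ball.is_const_of_fderiv_eq_zero (convex_ball (pr p) ε).isPreconnected
        (fun v hv => (hd v hv).1.differentiableWithinAt) (fun v hv => (hd v hv).2) hx2
        (Metric.mem_ball_self hε)
    rw [← h6]
    change f x = f (Ψ (ψ x, pr x))
    rw [hx3]

/-- Continuity gives one inclusion. For the other, a vector near the restriction of `p` is realized
by changing only the coordinates of `p` in `s`. This lets local statements pass between `M` and a
finite-dimensional space. -/
theorem map_restrict_nhds (s : Finset ι) (p : M) :
    map (fun q : M => s.restrict (π := fun _ => ℝ) q.1) (𝓝 p) = 𝓝 (s.restrict p.1) := by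
  classical
  refine le_antisymm ?_ fun W hW => ?_
  · have hc : Continuous (fun q : M => s.restrict (π := fun _ => ℝ) q.1) := by fun_prop
    exact hc.tendsto p
  · let σ : (s → ℝ) → (ι → ℝ) := fun v i => if h : i ∈ s then v ⟨i, h⟩ else p.1 i
    have hσ : Continuous σ := continuous_pi fun i => by
      by_cases h : i ∈ s
      · simp only [σ, h, dif_pos]; fun_prop
      · simp only [σ, h, dif_neg, not_false_iff]; fun_prop
    have hσp : σ (s.restrict p.1) = p.1 := funext fun i => by
      by_cases h : i ∈ s <;> simp [σ, h]
    have h1 : ∀ᶠ x in 𝓝 p.1, ∃ h : x ∈ M, s.restrict (⟨x, h⟩ : M).1 ∈ W := by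
      rw [← M.isOpen.isOpenEmbedding_subtypeVal.map_nhds_eq p, eventually_map]
      filter_upwards [hW] with q hq
      exact ⟨q.2, hq⟩
    have h2 := hσ.tendsto (s.restrict p.1)
    rw [hσp] at h2
    filter_upwards [h2.eventually h1] with v hv
    obtain ⟨h, hv⟩ := hv
    convert hv using 1
    funext i
    simp [σ]

theorem fderiv_eq_sum {s : Finset ι} {f : Fn M} {p : M} {G : (s → ℝ) → ℝ}
    (hG : DifferentiableAt ℝ G (s.restrict p.1)) (he : ∀ᶠ q : M in 𝓝 p, f.1 q = G (s.restrict q.1))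
    (z : s → ℝ) : fderiv ℝ G (s.restrict p.1) z = ∑ i : s, z i * ev p (pd i.1 f) := by
  classical
  conv_lhs => rw [pi_eq_sum_univ' z, map_sum]
  refine Finset.sum_congr rfl fun i _ => ?_
  rw [map_smul, smul_eq_mul]
  congr 1
  rw [ev_pd_comp (fun a : s => coord M a) f p G hG he i, Finset.sum_eq_single i]
  · rw [pd_coord, if_pos rfl, map_one, mul_one]
    congr 1
  · intro b _ hb
    rw [pd_coord, if_neg fun h => hb (Subtype.ext h.symm), map_zero, mul_zero]
  · simp

/-! ### Coordinates -/

section Coordinates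

variable {C : Type*} {c : C → Fn M}

theorem ev_apply_d {s : Finset ι} {f : Fn M} (hf : CylSmooth s f.1) (Z : VField M) (p : M) :
    ev p (Z (d f)) = ∑ i : s, ev p (Z (d (coord M i.1))) * ev p (pd i.1 f) := by
  classical
  have h3 : (d f).support ⊆ s := fun a ha => by
    by_contra hn
    rw [Finsupp.mem_support_iff, d_apply] at ha
    exact ha (Subtype.ext (hf.partialFun_eq_zero hn))
  rw [Finset.sum_coe_sort s fun i => ev p (Z (d (coord M i))) * ev p (pd i f)]
  conv_lhs => rw [form_eq_sum (d f), map_sum, map_sum]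
  rw [Finset.sum_subset h3]
  · refine Finset.sum_congr rfl fun i _ => ?_
    rw [map_smul, smul_eq_mul, map_mul, mul_comm, d_apply]
  · intro i _ hi
    rw [Finsupp.notMem_support_iff, d_apply] at hi
    simp [hi]

/-- Functions whose differentials form a basis of the module of forms, with the dual vector
fields. -/
structure IsCoframe (c : C → Fn M) (ξ : C → VField M) : Prop where
  isFrame : IsFrame c ξ
  kers_eq : kers ξ = ⊥

theorem exists_isCoframe (h1 : LinearIndependent (Fn M) fun a => d (c a))
    (h2 : ⊤ ≤ Submodule.span (Fn M) (Set.range fun a => d (c a))) :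
    ∃ ξ, IsCoframe c ξ := by
  let b := Module.Basis.mk h1 h2
  have hb : ∀ a, b a = d (c a) := fun a => Module.Basis.mk_apply h1 h2 a
  refine ⟨b.coord, ⟨fun a => ?_, fun a a' h => ?_, fun i => ?_⟩, ?_⟩
  · rw [← hb, b.coord_apply, b.repr_self, Finsupp.single_eq_same]
  · rw [← hb, b.coord_apply, b.repr_self, Finsupp.single_eq_of_ne h]
  · exact (b.repr (d (coord M i))).hasFiniteSupport
  · rw [eq_bot_iff]
    intro φ hφ
    rw [Submodule.mem_bot]
    exact b.forall_coord_eq_zero_iff.1 (mem_kers.1 hφ)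

variable {ξ : C → VField M}

theorem IsCoframe.eq_sum (h : IsCoframe c ξ) {φ : Form M} {s : Finset C}
    (hs : ∀ a, ξ a φ ≠ 0 → a ∈ s) : φ = ∑ a ∈ s, ξ a φ • d (c a) := by
  have := h.isFrame.sub_mem hs
  rwa [h.kers_eq, Submodule.mem_bot, sub_eq_zero] at this

theorem exists_cylSmooth_finset (s₀ : Finset ι) {T : Type*} [Fintype T] (c : T → Fn M) :
    ∃ s : Finset ι, s₀ ⊆ s ∧ ∀ a, CylSmooth s (c a).1 := by
  classical
  refine ⟨s₀ ∪ Finset.univ.biUnion fun a => (c a).2.choose, Finset.subset_union_left, fun a => ?_⟩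
  refine (c a).2.choose_spec.mono (Finset.subset_union_right.trans' ?_)
  exact Finset.subset_biUnion_of_mem (fun a => (c a).2.choose) (Finset.mem_univ a)

/-- The map given by finitely many coordinates is a submersion. -/
theorem IsCoframe.range_fderiv (h : IsCoframe c ξ) {T : Finset C} {s : Finset ι} {p : M}
    (hs : ∀ a : T, CylSmooth s (c a).1) {ψ : (s → ℝ) → (T → ℝ)}
    (hψ : ContDiffAt ℝ ∞ ψ (s.restrict p.1))
    (he : ∀ᶠ q : M in 𝓝 p, ∀ a : T, (c a).1 q = ψ (s.restrict q.1) a) :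
    (fderiv ℝ ψ (s.restrict p.1)).range = ⊤ := by
  classical
  have hd := hψ.differentiableAt (by simp)
  rw [eq_top_iff, ← (Pi.basisFun ℝ T).span_eq, Submodule.span_le]
  rintro _ ⟨b, rfl⟩
  -- The components of the dual field `ξ b` at `p` form a preimage of the basis vector `b`.
  refine ⟨fun i => ev p (ξ b (d (coord M i.1))), funext fun a => ?_⟩
  have h1 : HasFDerivAt (fun v => ψ v a)
      ((ContinuousLinearMap.proj a).comp (fderiv ℝ ψ (s.restrict p.1))) (s.restrict p.1) :=
    hasFDerivAt_pi'.1 hd.hasFDerivAt a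
  have h2 := fderiv_eq_sum (f := c a) h1.differentiableAt (he.mono fun q hq => hq a)
    (fun i => ev p (ξ b (d (coord M i.1))))
  rw [h1.fderiv, ← ev_apply_d (hs a)] at h2
  refine h2.trans ?_
  rw [Pi.basisFun_apply, Pi.single_apply]
  split_ifs with hab
  · rw [hab, h.isFrame.dual_same, map_one]
  · rw [h.isFrame.dual_ne _ _ fun hh => hab (Subtype.ext hh.symm), map_zero]

theorem exists_local_formula {T : Finset C} {s : Finset ι} (p : M)
    (hs : ∀ a : T, CylSmooth s (c a).1) : ∃ ψ : (s → ℝ) → (T → ℝ),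
      ContDiffAt ℝ ∞ ψ (s.restrict p.1) ∧
      ∀ᶠ q : M in 𝓝 p, ∀ a : T, (c a).1 q = ψ (s.restrict q.1) a := by
  choose ψ hψ he using fun a => hs a p
  exact ⟨fun v a => ψ a v, contDiffAt_pi.2 hψ, eventually_all.2 he⟩

/-- The map factors through an open coordinate projection and a submersion of finite-dimensional
spaces. Such openness is used for finite subfamilies only. -/
theorem IsCoframe.map_nhds (h : IsCoframe c ξ) (T : Finset C) (p : M) :
    map (fun q : M => fun a : T => (c a).1 q) (𝓝 p) = 𝓝 (fun a : T => (c a).1 p) := by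
  obtain ⟨s, -, hs⟩ := exists_cylSmooth_finset ∅ fun a : T => c a
  obtain ⟨ψ, hψ, he⟩ := exists_local_formula p hs
  have hp : (fun a : T => (c a).1 p) = ψ (s.restrict p.1) := funext he.self_of_nhds
  have h1 : (fun q : M => fun a : T => (c a).1 q) =ᶠ[𝓝 p]
      ψ ∘ fun q : M => s.restrict (π := fun _ => ℝ) q.1 := he.mono fun q hq => funext hq
  rw [map_congr h1, ← map_map, map_restrict_nhds, hp]
  have h2 : HasStrictFDerivAt ψ (fderiv ℝ ψ (s.restrict p.1)) (s.restrict p.1) :=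
    hψ.hasStrictFDerivAt (by simp)
  exact h2.map_nhds_eq_of_surj (h.range_fderiv hs hψ he)

/-- A function is locally a smooth function of those coordinates which appear in its
differential. -/
theorem IsCoframe.exists_formula (h : IsCoframe c ξ) {f : Fn M} {T : Finset C}
    (hT : ∀ a, ξ a (d f) ≠ 0 → a ∈ T) (p : M) : ∃ G : (T → ℝ) → ℝ,
      ContDiffAt ℝ ∞ G (fun a : T => (c a).1 p) ∧
      ∀ᶠ q in 𝓝 p, f.1 q = G (fun a : T => (c a).1 q) := by
  obtain ⟨s₀, hs₀⟩ := f.2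
  obtain ⟨s, hss, hs⟩ := exists_cylSmooth_finset s₀ fun a : T => c a
  obtain ⟨ψ, hψ, he⟩ := exists_local_formula p hs
  obtain ⟨F, hF, hFe⟩ := hs₀.mono hss p
  have hp : (fun a : T => (c a).1 p) = ψ (s.restrict p.1) := funext he.self_of_nhds
  have hpd : ∀ i, pd i f = ∑ a ∈ T, ξ a (d f) * pd i (c a) := fun i => by
    have := congrArg (fun φ : Form M => φ i) (h.eq_sum hT)
    simpa [Finsupp.finsetSum_apply] using this
  -- Factoring requires the kernel condition at all nearby points. It holds because $df=\sum_{a\in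
  -- T}\xi_a(df)\,dc^a$ is an identity of forms on `M`.
  have hker : ∀ᶠ v in 𝓝 (s.restrict p.1), ∀ z, fderiv ℝ ψ v z = 0 → fderiv ℝ F v z = 0 := by
    rw [← map_restrict_nhds, eventually_map]
    have e1 : ∀ᶠ q : M in 𝓝 p, DifferentiableAt ℝ ψ (s.restrict q.1) := by
      have := eventually_differentiableAt hψ
      rwa [← map_restrict_nhds, eventually_map] at this
    filter_upwards [he.eventually_nhds, hFe.eventually_nhds, e1, eventually_contDiffAt hF]
      with q h1 h2 h3 h4 z hz
    rw [fderiv_eq_sum h4 h2]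
    have h5 : ∀ a : T, ∑ i : s, z i * ev q (pd i.1 (c a)) = 0 := fun a => by
      have h6 : HasFDerivAt (fun v => ψ v a)
          ((ContinuousLinearMap.proj a).comp (fderiv ℝ ψ (s.restrict q.1))) (s.restrict q.1) :=
        hasFDerivAt_pi'.1 h3.hasFDerivAt a
      rw [← fderiv_eq_sum (f := c a) h6.differentiableAt (h1.mono fun q hq => hq a), h6.fderiv,
        ContinuousLinearMap.comp_apply, hz, map_zero]
    have h7 : ∀ i : s, z i * ev q (pd i.1 f)
        = ∑ a ∈ T, ev q (ξ a (d f)) * (z i * ev q (pd i.1 (c a))) := fun i => by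
      rw [hpd, map_sum, Finset.mul_sum]
      exact Finset.sum_congr rfl fun a _ => by rw [map_mul]; ring
    simp only [h7]
    rw [Finset.sum_comm]
    refine Finset.sum_eq_zero fun a ha => ?_
    rw [← Finset.mul_sum, h5 ⟨a, ha⟩, mul_zero]
  obtain ⟨G, hG, hGe⟩ := exists_factor_of_ker_le hψ hF (h.range_fderiv hs hψ he) hker
  refine ⟨G, by rwa [hp], ?_⟩
  rw [← map_restrict_nhds, eventually_map] at hGe
  filter_upwards [hFe, hGe, he] with q h1 h2 h3
  rw [h1, h2]
  congr 1
  exact (funext h3).symm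

/-- Only finitely many $\xi_a(df)$ are nonzero, so a function depends locally on finitely many
$c^a$. Pointwise independence follows by applying the dual fields, evaluated at the point, to a
linear relation. -/
theorem IsCoframe.isCoordinates (h : IsCoframe c ξ) : IsCoordinates c := by
  classical
  refine ⟨fun f => ⟨(h.isFrame.finite (d f)).toFinset, fun p => ?_⟩, fun p => ?_⟩
  · exact h.exists_formula (fun a ha => (h.isFrame.finite _).mem_toFinset.2 ha) p
  · rw [linearIndependent_iff']
    intro S r hr b hb
    obtain ⟨s, -, hs⟩ := exists_cylSmooth_finset ∅ fun a : S => c a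
    have h1 : ∑ a ∈ S, r a * ev p (ξ b (d (c a))) = r b := by
      rw [Finset.sum_eq_single_of_mem b hb]
      · rw [h.isFrame.dual_same, map_one, mul_one]
      · intro a _ hab
        rw [h.isFrame.dual_ne _ _ hab.symm, map_zero, mul_zero]
    rw [← h1]
    have h2 : ∀ a ∈ S, r a * ev p (ξ b (d (c a)))
        = ∑ i : s, ev p (ξ b (d (coord M i.1))) * (r a * ev p (pd i.1 (c a))) := fun a ha => by
      rw [ev_apply_d (hs ⟨a, ha⟩), Finset.mul_sum]
      exact Finset.sum_congr rfl fun i _ => by ring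
    rw [Finset.sum_congr rfl h2, Finset.sum_comm]
    refine Finset.sum_eq_zero fun i _ => ?_
    rw [← Finset.mul_sum]
    have := congrFun hr i.1
    simp only [Finset.sum_apply, Pi.smul_apply, smul_eq_mul, Pi.zero_apply] at this
    rw [show ∑ a ∈ S, r a * ev p (pd i.1 (c a)) = 0 from this, mul_zero]

/-- Around every point there is an open set whose image under finitely many coordinates is a box
on which finitely many given functions are expressed in terms of these coordinates. -/
theorem IsCoframe.exists_box (h : IsCoframe c ξ) (T₀ : Finset C) (S : Finset (Fn M)) (p : M) :
    ∃ (T : Finset C) (ε : ℝ) (U : Opens (ι → ℝ)) (hU : U ≤ M), T₀ ⊆ T ∧ 0 < ε ∧ p.1 ∈ U ∧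
      (∀ q : U, ∀ a ∈ T, |(c a).1 (Set.inclusion hU q) - (c a).1 p| < ε) ∧
      (∀ v : T → ℝ, (∀ a, |v a - (c a).1 p| < ε) →
        ∃ q : U, ∀ a : T, (c a).1 (Set.inclusion hU q) = v a) ∧
      ∀ f ∈ S, ∃ G : (T → ℝ) → ℝ, (∀ v : T → ℝ, (∀ a, |v a - (c a).1 p| < ε) →
        ContDiffAt ℝ ∞ G v) ∧ ∀ q : U, f.1 (Set.inclusion hU q)
          = G fun a => (c a).1 (Set.inclusion hU q) := by
  classical
  let T : Finset C := T₀ ∪ S.biUnion fun f => (h.isFrame.finite (d f)).toFinset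
  let cT : M → (T → ℝ) := fun q a => (c a).1 q
  have hcT : Continuous cT := continuous_pi fun a => (c a).continuous
  have hT : ∀ f ∈ S, ∀ a, ξ a (d f) ≠ 0 → a ∈ T := fun f hf a ha =>
    Finset.mem_union_right _ (Finset.mem_biUnion.2 ⟨f, hf, (h.isFrame.finite _).mem_toFinset.2 ha⟩)
  choose! G hG hGe using fun (f : Fn M) (hf : f ∈ S) => h.exists_formula (hT f hf) p
  have h1 : ∀ᶠ q in 𝓝 p, ∀ f ∈ S, f.1 q = G f (cT q) :=
    (Finset.eventually_all S).2 hGe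
  obtain ⟨W, hW, hWo, hpW⟩ := eventually_nhds_iff.1 h1
  have h2 : cT '' W ∈ 𝓝 (cT p) := by
    rw [← h.map_nhds T p]
    exact image_mem_map (hWo.mem_nhds hpW)
  obtain ⟨ε, hε, hball⟩ := Metric.mem_nhds_iff.1 h2
  have hb : ∀ v : T → ℝ, v ∈ Metric.ball (cT p) ε ↔ ∀ a, |v a - (c a).1 p| < ε := fun v => by
    rw [Metric.mem_ball, dist_pi_lt_iff hε]
    rfl
  obtain ⟨U, hU, hmem⟩ := exists_opens_of_isOpen
    (hWo.inter (Metric.isOpen_ball.preimage hcT : IsOpen (cT ⁻¹' Metric.ball (cT p) ε)))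
  have hUW : ∀ q : U, Set.inclusion hU q ∈ W ∩ cT ⁻¹' Metric.ball (cT p) ε := fun q =>
    (hmem (Set.inclusion hU q)).1 q.2
  refine ⟨T, ε, U, hU, Finset.subset_union_left, hε, ?_, fun q a ha => ?_, fun v hv => ?_,
    fun f hf => ⟨G f, fun v hv => ?_, fun q => hW _ (hUW q).1 f hf⟩⟩
  · exact (hmem p).2 ⟨hpW, Metric.mem_ball_self hε⟩
  · exact (hb _).1 (hUW q).2 ⟨a, ha⟩
  · obtain ⟨q, hq, hqv⟩ := hball ((hb v).2 hv)
    refine ⟨⟨q.1, (hmem q).2 ⟨hq, ?_⟩⟩, fun a => congrFun hqv a⟩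
    rw [Set.mem_preimage, hqv]
    exact (hb v).2 hv
  · obtain ⟨q, hq, rfl⟩ := hball ((hb v).2 hv)
    -- The formula at `p` is known to be smooth only near the centre. At any other point of the box
    -- it agrees with the local formula at a preimage, since the coordinate map is open there.
    obtain ⟨G', hG', hGe'⟩ := h.exists_formula (hT f hf) q
    refine hG'.congr_of_eventuallyEq ?_
    change ∀ᶠ v in 𝓝 (cT q), G f v = G' v
    rw [← h.map_nhds T q, eventually_map]
    filter_upwards [hGe', hWo.mem_nhds hq] with q' h3 h4
    rw [← h3]
    exact (hW q' h4 f hf).symm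

end Coordinates

/-- Chain rule for vector fields. -/
theorem ev_apply_comp {T : Type*} [Fintype T] [DecidableEq T] (c : T → Fn M) (f : Fn M) (p : M)
    (G : (T → ℝ) → ℝ) (hG : DifferentiableAt ℝ G (fun a => (c a).1 p))
    (he : ∀ᶠ q in 𝓝 p, f.1 q = G (fun a => (c a).1 q)) (Z : VField M) :
    ev p (Z (d f)) = ∑ a, fderiv ℝ G (fun a => (c a).1 p) (Pi.single a 1) * ev p (Z (d (c a))) := by
  obtain ⟨s₀, hs₀⟩ := f.2
  obtain ⟨s, hss, hs⟩ := exists_cylSmooth_finset s₀ c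
  rw [ev_apply_d (hs₀.mono hss)]
  simp only [fun a => ev_apply_d (hs a) Z p, ev_pd_comp c f p G hG he, Finset.mul_sum]
  rw [Finset.sum_comm]
  exact Finset.sum_congr rfl fun a _ => Finset.sum_congr rfl fun i _ => by ring

/-- The function depends only on the coordinates with index in `S`. -/
def DependsOn (S : Set ι) (f : Fn M) : Prop :=
  ∀ p q : M, (∀ i ∈ S, p.1 i = q.1 i) → f.1 p = f.1 q

open Classical in
theorem eventually_update_mem (p : M) (i : ι) :
    ∀ᶠ t in 𝓝 (p.1 i), Function.update p.1 i t ∈ M := by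
  have hcont : Continuous (fun t : ℝ => Function.update p.1 i t) :=
    continuous_const.update i continuous_id
  have := hcont.tendsto (p.1 i)
  rw [Function.update_eq_self] at this
  exact this.eventually (M.isOpen.mem_nhds p.2)

theorem DependsOn.pd_eq_zero {S : Set ι} {f : Fn M} (h : DependsOn S f) {i : ι} (hi : i ∉ S) :
    pd i f = 0 := by
  classical
  refine ext_ev fun p => ?_
  have h1 := hasDerivAt_line f i p
  refine (h1.unique ((hasDerivAt_const (p.1 i) (f.1 p)).congr_of_eventuallyEq ?_)).trans
    (map_zero (ev p)).symm
  filter_upwards [eventually_update_mem p i] with t ht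
  have h2 := Subtype.val_injective.extend_apply f.1 0 (⟨_, ht⟩ : M)
  refine h2.trans (h _ _ fun j hj => ?_)
  exact Function.update_of_ne (fun hji : j = i => hi (hji ▸ hj)) _ _

theorem DependsOn.pd {S : Set ι} {f : Fn M} (h : DependsOn S f) (i : ι) :
    DependsOn S (pd i f) := by
  classical
  intro p q hpq
  by_cases hi : i ∈ S
  · have h1 := hasDerivAt_line f i p
    have h2 := hasDerivAt_line f i q
    rw [← hpq i hi] at h2
    refine h1.unique (h2.congr_of_eventuallyEq ?_)
    have h3 := eventually_update_mem q i
    rw [← hpq i hi] at h3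
    filter_upwards [eventually_update_mem p i, h3] with t ht ht'
    have e1 := Subtype.val_injective.extend_apply f.1 0 (⟨_, ht⟩ : M)
    have e2 := Subtype.val_injective.extend_apply f.1 0 (⟨_, ht'⟩ : M)
    refine e1.trans (Eq.trans (h _ _ fun j hj => ?_) e2.symm)
    by_cases hji : j = i
    · subst hji; simp
    · simp [hji, hpq j hj]
  · rw [h.pd_eq_zero hi]
    rfl

/-- A morphism given by functions. -/
def morOf {U : Opens (ι → ℝ)} {N : Opens (κ → ℝ)} (k : κ → Fn U)
    (hk : ∀ q, (fun a => (k a).1 q) ∈ N) : Mor U N where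
  toFun q := ⟨fun a => (k a).1 q, hk q⟩
  comp_mem f := by
    obtain ⟨t, ht⟩ := f.2
    refine mem_smoothFun_of_local (fun a : t => k a) fun p => ?_
    obtain ⟨G, hG, he⟩ := ht ⟨_, hk p⟩
    have hc : Continuous fun q : U => (⟨fun a => (k a).1 q, hk q⟩ : N) :=
      Continuous.subtype_mk (continuous_pi fun a => (k a).continuous) _
    exact ⟨G, hG, (hc.tendsto p).eventually he⟩

/-! ### Boxes -/

section Box

variable {U : Opens (ι → ℝ)} {A B : Type*}

/-- Finitely many of the functions `c a` which map `U` onto a box. -/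
structure BoxChart (c : A ⊕ B → Fn U) where
  /-- The indices of the functions. -/
  T : Finset (A ⊕ B)
  /-- The centre of the box. -/
  c₀ : A ⊕ B → ℝ
  /-- The size of the box. -/
  ε : ℝ
  pos : 0 < ε
  mem : ∀ q, ∀ a ∈ T, |(c a).1 q - c₀ a| < ε
  surj : ∀ v : T → ℝ, (∀ a, |v a - c₀ a| < ε) → ∃ q, ∀ a : T, (c a).1 q = v a

variable {c : A ⊕ B → Fn U} (K : BoxChart c)

namespace BoxChart

/-- The indices of the first kind which are restricted by the box. -/
def fixed : Set A := {a | Sum.inl a ∈ K.T}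

/-- The space of the coordinates of the first kind. -/
def base : Opens (A → ℝ) where
  carrier := {y | ∀ a, Sum.inl a ∈ K.T → |y a - K.c₀ (Sum.inl a)| < K.ε}
  is_open' := by
    have : {y : A → ℝ | ∀ a, Sum.inl a ∈ K.T → |y a - K.c₀ (Sum.inl a)| < K.ε}
        = ⋂ a ∈ K.fixed, {y | |y a - K.c₀ (Sum.inl a)| < K.ε} := by
      ext y; simp [fixed]
    rw [this]
    refine Set.Finite.isOpen_biInter ?_ fun _ _ => ?_
    · exact Set.Finite.preimage Sum.inl_injective.injOn K.T.finite_toSet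
    · exact isOpen_lt (by fun_prop) continuous_const

/-- The projection to the coordinates of the first kind. -/
def proj : Mor U K.base := morOf (fun a => c (Sum.inl a)) fun q _ ha => K.mem q _ ha

theorem proj_pull_coord (a : A) : K.proj.pull (coord K.base a) = c (Sum.inl a) := rfl

theorem proj_apply (q : U) (a : A) : (K.proj.toFun q).1 a = (c (Sum.inl a)).1 q := rfl

/-- The points of `U` where the coordinates of the second kind are those of the centre. -/
def slice : Set U := {q | ∀ b, Sum.inr b ∈ K.T → (c (Sum.inr b)).1 q = K.c₀ (Sum.inr b)}

/-- The value of the box coordinates at the point of the slice above a point of the base. -/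
def sliceVal (y : A → ℝ) (t : K.T) : ℝ := Sum.elim y (fun b => K.c₀ (Sum.inr b)) t.1

theorem sliceVal_mem (y : K.base) (t : K.T) : |K.sliceVal y.1 t - K.c₀ t| < K.ε := by
  obtain ⟨a | b, ht⟩ := t
  · exact y.2 a ht
  · simpa [sliceVal] using K.pos

theorem exists_mem_slice (y : K.base) : ∃ q ∈ K.slice, ∀ a ∈ K.fixed, (c (Sum.inl a)).1 q = y.1 a := by
  obtain ⟨q, hq⟩ := K.surj (K.sliceVal y.1) (K.sliceVal_mem y)
  exact ⟨q, fun b hb => hq ⟨_, hb⟩, fun a ha => hq ⟨_, ha⟩⟩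

variable {K}

/-- A function of the box coordinates, restricted to the slice, as a function on the base. -/
def lift {G : (K.T → ℝ) → ℝ}
    (hG : ∀ v : K.T → ℝ, (∀ a, |v a - K.c₀ a| < K.ε) → ContDiffAt ℝ ∞ G v) : Fn K.base :=
  ⟨fun y => G (K.sliceVal y.1), by
    classical
    let t : Finset A := K.T.preimage Sum.inl Sum.inl_injective.injOn
    have ht : ∀ a, Sum.inl a ∈ K.T → a ∈ t := fun a ha => Finset.mem_preimage.2 ha
    refine ⟨t, fun y => ?_⟩
    let σ : (t → ℝ) → (K.T → ℝ) := fun v x => Sum.elim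
      (fun a => if h : a ∈ t then v ⟨a, h⟩ else 0) (fun b => K.c₀ (Sum.inr b)) x.1
    have hσ : ContDiff ℝ ∞ σ := by
      rw [contDiff_pi]
      rintro ⟨a | b, hx⟩
      · simp only [σ, Sum.elim_inl, ht a hx, dif_pos]
        exact contDiff_apply ℝ ℝ _
      · exact contDiff_const
    have hσy : ∀ z : K.base, σ (t.restrict z.1) = K.sliceVal z.1 := fun z => by
      funext ⟨x, hx⟩
      rcases x with a | b
      · simp [σ, sliceVal, ht a hx]
      · simp [σ, sliceVal]
    refine ⟨fun v => G (σ v), ?_, Eventually.of_forall fun z => ?_⟩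
    · refine ContDiffAt.comp (g := G) _ ?_ hσ.contDiffAt
      rw [hσy]
      exact hG _ (K.sliceVal_mem y)
    · exact congrArg G (hσy z).symm⟩

variable {ξ : A ⊕ B → VField U}

/-- A function on a box does not depend on those variables for which the corresponding partial
derivatives vanish. -/
theorem eq_of_eq (h : IsCoframe c ξ) {f : Fn U} {G : (K.T → ℝ) → ℝ}
    (hG : ∀ v : K.T → ℝ, (∀ a, |v a - K.c₀ a| < K.ε) → ContDiffAt ℝ ∞ G v)
    (hf : ∀ q, f.1 q = G fun a => (c a).1 q) {v v' : K.T → ℝ}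
    (hv : ∀ a, |v a - K.c₀ a| < K.ε) (hv' : ∀ a, |v' a - K.c₀ a| < K.ε)
    (hvv : ∀ a : K.T, v a = v' a ∨ ξ a (d f) = 0) : G v = G v' := by
  classical
  -- Every point of the box comes from a point of `U`, where the partial derivative of `G` equals
  -- the value of `ξ a (d f)`.
  have hd : ∀ w : K.T → ℝ, (∀ a, |w a - K.c₀ a| < K.ε) → ∀ a : K.T, ξ a (d f) = 0 →
      fderiv ℝ G w (Pi.single a 1) = 0 := fun w hw a ha => by
    obtain ⟨q, hq⟩ := K.surj w hw
    have hq' : (fun a : K.T => (c a).1 q) = w := funext hq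
    have := ev_apply_comp (fun a : K.T => c a) f q G
      (by rw [hq']; exact (hG w hw).differentiableAt (by simp)) (Eventually.of_forall hf) (ξ a)
    rw [ha, map_zero, Finset.sum_eq_single a, h.isFrame.dual_same, map_one, mul_one, hq'] at this
    · exact this.symm
    · intro b _ hb
      rw [h.isFrame.dual_ne _ _ fun hh => hb (Subtype.ext hh.symm), map_zero, mul_zero]
    · simp
  -- The box is convex, so `G` can be followed along the segment from `v` to `v'`, where its
  -- derivative vanishes term by term.
  have hconv : ∀ t ∈ Set.Icc (0 : ℝ) 1, ∀ a, |(v + t • (v' - v)) a - K.c₀ a| < K.ε := by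
    intro t ht a
    have h1 : v a ∈ Metric.ball (K.c₀ a) K.ε := hv a
    have h2 : v' a ∈ Metric.ball (K.c₀ a) K.ε := hv' a
    have := (convex_ball (K.c₀ a) K.ε).add_smul_sub_mem h1 h2 ht
    simpa [Real.dist_eq] using this
  have hg : ∀ t ∈ Set.Icc (0 : ℝ) 1, HasDerivAt (fun t : ℝ => G (v + t • (v' - v))) 0 t := by
    intro t ht
    have h1 := ((hG _ (hconv t ht)).differentiableAt (by simp)).hasFDerivAt
    have h2 : HasDerivAt (fun t : ℝ => v + t • (v' - v)) (v' - v) t := by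
      simpa using ((hasDerivAt_id t).smul_const (v' - v)).const_add v
    have h3 := h1.comp_hasDerivAt t h2
    suffices h4 : fderiv ℝ G (v + t • (v' - v)) (v' - v) = 0 by
      rw [h4] at h3
      exact h3
    have hL := hd _ (hconv t ht)
    generalize fderiv ℝ G (v + t • (v' - v)) = L at hL
    rw [pi_eq_sum_univ' (v' - v), map_sum]
    refine Finset.sum_eq_zero fun a _ => ?_
    rw [map_smul]
    rcases hvv a with e | e
    · simp [e]
    · rw [hL a e, smul_zero]
  have := constant_of_has_deriv_right_zero (f := fun t : ℝ => G (v + t • (v' - v)))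
    (a := 0) (b := 1) (fun t ht => (hg t ht).continuousAt.continuousWithinAt)
    (fun t ht => (hg t (Set.Ico_subset_Icc_self ht)).hasDerivWithinAt) 1 (by simp)
  simpa using this.symm

/-- A function on `U` which is expressed by the box coordinates can be lifted to the base. -/
theorem exists_lift (h : IsCoframe c ξ) {f : Fn U}
    (hf : ∃ G : (K.T → ℝ) → ℝ, (∀ v : K.T → ℝ, (∀ a, |v a - K.c₀ a| < K.ε) → ContDiffAt ℝ ∞ G v) ∧
      ∀ q, f.1 q = G fun a => (c a).1 q) :
    ∃ g : Fn K.base, DependsOn K.fixed g ∧ (∀ q ∈ K.slice, ev q (K.proj.pull g) = ev q f) ∧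
      ((∀ b, ξ (Sum.inr b) (d f) = 0) → K.proj.pull g = f) ∧
      ∀ S : Set A, (∀ a ∉ S, ξ (Sum.inl a) (d f) = 0) → DependsOn S g := by
  obtain ⟨G, hG, hfG⟩ := hf
  -- The lift freezes the box coordinates of the second kind at the centre. It therefore agrees with
  -- `f` on the slice always, and on all of `U` when `f` does not involve the second kind.
  refine ⟨lift hG, fun y z hyz => ?_, fun q hq => ?_, fun h0 => ext_ev fun q => ?_,
    fun S hS y z hyz => ?_⟩
  · refine congrArg G (funext fun t => ?_)
    obtain ⟨a | b, ht⟩ := t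
    exacts [hyz a ht, rfl]
  · refine Eq.trans (congrArg G (funext fun t => ?_)) (hfG q).symm
    obtain ⟨a | b, ht⟩ := t
    exacts [rfl, (hq b ht).symm]
  · refine Eq.trans ?_ (hfG q).symm
    refine eq_of_eq h hG hfG (K.sliceVal_mem (K.proj.toFun q)) (fun a => K.mem q a a.2) ?_
    rintro ⟨a | b, ht⟩
    exacts [Or.inl rfl, Or.inr (h0 b)]
  · refine eq_of_eq h hG hfG (K.sliceVal_mem y) (K.sliceVal_mem z) ?_
    rintro ⟨a | b, ht⟩
    · by_cases ha : a ∈ S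
      exacts [Or.inl (hyz a ha), Or.inr (hS a ha)]
    · exact Or.inl rfl

variable (K)

/-- The functions on the base which are polynomials in the coordinates with coefficients
depending on the restricted coordinates only. -/
def polys : Subring (Fn K.base) :=
  Subring.closure ({f | DependsOn K.fixed f} ∪ Set.range (coord K.base))

variable {K}

theorem dependsOn_mem_polys {f : Fn K.base} (hf : DependsOn K.fixed f) : f ∈ K.polys :=
  Subring.subset_closure (Or.inl hf)

theorem coord_mem_polys (a : A) : coord K.base a ∈ K.polys :=
  Subring.subset_closure (Or.inr ⟨a, rfl⟩)

theorem pd_mem_polys {f : Fn K.base} (hf : f ∈ K.polys) (a : A) : pd a f ∈ K.polys := by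
  classical
  induction hf using Subring.closure_induction with
  | mem f hf =>
    rcases hf with hf | ⟨b, rfl⟩
    · exact dependsOn_mem_polys (DependsOn.pd hf a)
    · rw [pd_coord]
      split_ifs
      exacts [K.polys.one_mem, K.polys.zero_mem]
  | zero => rw [← d_apply, d_zero]; exact K.polys.zero_mem
  | one => rw [← d_apply, d_one]; exact K.polys.zero_mem
  | add f g _ _ h1 h2 => rw [pd_add]; exact K.polys.add_mem h1 h2
  | neg f _ h1 => rw [← d_apply, d_neg]; exact K.polys.neg_mem h1
  | mul f g hf hg h1 h2 =>
    rw [pd_mul]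
    exact K.polys.add_mem (K.polys.mul_mem hf h2) (K.polys.mul_mem hg h1)

theorem apply_d_mem_polys {Z : VField K.base} (hZ : ∀ a, Z (d (coord K.base a)) ∈ K.polys)
    {f : Fn K.base} (hf : f ∈ K.polys) : Z (d f) ∈ K.polys := by
  rw [form_eq_sum (d f), map_sum]
  refine K.polys.sum_mem fun a _ => ?_
  rw [map_smul, smul_eq_mul]
  exact K.polys.mul_mem (pd_mem_polys hf a) (hZ a)

/-- The restriction to a line in a fibre is a polynomial. -/
theorem exists_polynomial {f : Fn K.base} (hf : f ∈ K.polys) (y : K.base) (v : A → ℝ)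
    (hv : ∀ a ∈ K.fixed, v a = 0) :
    ∃ P : Polynomial ℝ, ∀ (t : ℝ) (z : K.base), z.1 = y.1 + t • v → f.1 z = P.eval t := by
  induction hf using Subring.closure_induction with
  | mem f hf =>
    rcases hf with hf | ⟨b, rfl⟩
    · refine ⟨Polynomial.C (f.1 y), fun t z hz => ?_⟩
      rw [Polynomial.eval_C]
      refine hf _ _ fun a ha => ?_
      rw [hz]
      simp [hv a ha]
    · refine ⟨Polynomial.C (y.1 b) + Polynomial.X * Polynomial.C (v b), fun t z hz => ?_⟩
      change z.1 b = _
      rw [hz]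
      simp [mul_comm t]
  | zero => exact ⟨0, fun t z _ => by rw [Polynomial.eval_zero]; rfl⟩
  | one => exact ⟨1, fun t z _ => by rw [Polynomial.eval_one]; rfl⟩
  | add f g _ _ h1 h2 =>
    obtain ⟨P, hP⟩ := h1
    obtain ⟨Q, hQ⟩ := h2
    exact ⟨P + Q, fun t z hz => by rw [Polynomial.eval_add, ← hP t z hz, ← hQ t z hz]; rfl⟩
  | neg f _ h1 =>
    obtain ⟨P, hP⟩ := h1
    exact ⟨-P, fun t z hz => by rw [Polynomial.eval_neg, ← hP t z hz]; rfl⟩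
  | mul f g _ _ h1 h2 =>
    obtain ⟨P, hP⟩ := h1
    obtain ⟨Q, hQ⟩ := h2
    exact ⟨P * Q, fun t z hz => by rw [Polynomial.eval_mul, ← hP t z hz, ← hQ t z hz]; rfl⟩

theorem line_mem_base (y : K.base) {v : A → ℝ} (hv : ∀ a ∈ K.fixed, v a = 0) (t : ℝ) :
    y.1 + t • v ∈ K.base := fun a ha => by
  have : v a = 0 := hv a ha
  simpa [this] using y.2 a ha

/-- In a fibre of the box coordinates, a polynomial function depends only on the coordinates on
which it depends locally. -/
theorem eq_of_eqOn_cyl {f : Fn K.base} (hf : f ∈ K.polys) {s : Finset A} (hs : CylSmooth s f.1)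
    {y z : K.base} (h1 : ∀ a ∈ K.fixed, y.1 a = z.1 a) (h2 : ∀ a ∈ s, y.1 a = z.1 a) :
    f.1 y = f.1 z := by
  have hv : ∀ a ∈ K.fixed, (z.1 - y.1) a = 0 := fun a ha => sub_eq_zero.2 (h1 a ha).symm
  obtain ⟨P, hP⟩ := exists_polynomial hf y (z.1 - y.1) hv
  let line : ℝ → K.base := fun t => ⟨y.1 + t • (z.1 - y.1), line_mem_base y hv t⟩
  have hline : Continuous line := Continuous.subtype_mk (by fun_prop) _
  have hl0 : line 0 = y := Subtype.ext (by simp [line])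
  -- The description by the coordinates in `s` is only local and gives constancy near `t = 0`; a
  -- polynomial constant on an infinite set is constant, so the value is the same at `t = 1`.
  have hconst : ∀ᶠ t in 𝓝 (0 : ℝ), P.eval t = f.1 y := by
    obtain ⟨G, -, hG⟩ := hs y
    have := hline.tendsto 0
    rw [hl0] at this
    filter_upwards [this.eventually hG] with t ht
    rw [← hP t (line t) rfl, ht, hG.self_of_nhds]
    refine congrArg G (funext fun a => ?_)
    simp [line, h2 a a.2]
  have hPc : P = Polynomial.C (f.1 y) := by
    refine Polynomial.eq_of_infinite_eval_eq _ _ ?_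
    refine (infinite_of_mem_nhds (0 : ℝ) hconst).mono fun t ht => ?_
    simpa using ht
  rw [hP 1 z (by simp), hPc, Polynomial.eval_C]

/-- A polynomial function which vanishes on the image of the slice is zero. -/
theorem eq_zero_of_slice (h : IsCoframe c ξ) {f : Fn K.base} (hf : f ∈ K.polys)
    (h0 : ∀ q ∈ K.slice, ev q (K.proj.pull f) = 0) : f = 0 := by
  classical
  refine Fn.ext fun y => ?_
  change f.1 y = 0
  obtain ⟨q, hq, hqy⟩ := K.exists_mem_slice y
  -- The line from the image of a slice point to `y` stays in one fibre over the box, where `f` is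
  -- polynomial. The image of `U` need not contain any initial segment of the line, but it contains
  -- points with the right values in the finitely many coordinates that matter.
  let v : A → ℝ := y.1 - (K.proj.toFun q).1
  have hv : ∀ a ∈ K.fixed, v a = 0 := fun a ha => sub_eq_zero.2 (hqy a ha).symm
  obtain ⟨P, hP⟩ := exists_polynomial hf (K.proj.toFun q) v hv
  obtain ⟨s, hs⟩ := f.2
  let T' : Finset (A ⊕ B) := K.T ∪ s.map ⟨Sum.inl, Sum.inl_injective⟩
  -- Zero in the directions of the second kind keeps the nearby points in the slice.
  let v' : T' → ℝ := fun a => Sum.elim v 0 a.1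
  have hw : Continuous fun t : ℝ => (fun a : T' => (c a).1 q + t * v' a) := by fun_prop
  have hnear : ∀ᶠ t in 𝓝 (0 : ℝ), ∃ q' : U, ∀ a : T', (c a).1 q' = (c a).1 q + t * v' a := by
    have h1 := h.map_nhds T' q
    have h2 : Set.range (fun (q' : U) (a : T') => (c a).1 q') ∈ 𝓝 (fun a : T' => (c a).1 q) := by
      rw [← h1]
      exact range_mem_map
    have h3 := hw.tendsto 0
    simp only [zero_mul, add_zero] at h3
    filter_upwards [h3.eventually h2] with t ⟨q', hq'⟩
    exact ⟨q', fun a => congrFun hq' a⟩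
  have hP0 : ∀ᶠ t in 𝓝 (0 : ℝ), P.eval t = 0 := by
    filter_upwards [hnear] with t ⟨q', hq'⟩
    have hsl : q' ∈ K.slice := fun b hb => by
      have := hq' ⟨Sum.inr b, Finset.mem_union_left _ hb⟩
      rw [this, ← hq b hb]
      simp [v']
    rw [← hP t ⟨_, line_mem_base _ hv t⟩ rfl, ← h0 q' hsl]
    refine eq_of_eqOn_cyl hf hs (fun a ha => ?_) (fun a ha => ?_)
    · have := hq' ⟨Sum.inl a, Finset.mem_union_left _ ha⟩
      rw [proj_apply, this]
      simp [v', proj_apply]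
    · have := hq' ⟨Sum.inl a, Finset.mem_union_right _ (Finset.mem_map_of_mem _ ha)⟩
      rw [proj_apply, this]
      simp [v', proj_apply]
  have hPz : P = 0 := by
    refine Polynomial.eq_of_infinite_eval_eq _ _ ?_
    refine (infinite_of_mem_nhds (0 : ℝ) hP0).mono fun t ht => ?_
    simpa using ht
  rw [hP 1 y (by simp [v]), hPz, Polynomial.eval_zero]

/-- This replaces surjectivity of the projection: the image of the slice meets every fibre over the
box, and the functions are polynomial on the fibres. -/
theorem pull_injOn (h : IsCoframe c ξ) {f g : Fn K.base} (hf : f ∈ K.polys) (hg : g ∈ K.polys)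
    (hfg : K.proj.pull f = K.proj.pull g) : f = g := by
  rw [← sub_eq_zero]
  refine eq_zero_of_slice h (K.polys.sub_mem hf hg) fun q _ => ?_
  rw [map_sub, hfg, sub_self, map_zero]

end BoxChart

end Box

/-! ### Systems of derivatives as diffieties -/

theorem lieD_sum_smul {α : Type*} [Fintype α] (a : α → Fn M) (X : α → VField M) {φ : Form M}
    (h : ∀ j, X j φ = 0) : lieD (∑ j, a j • X j) φ = ∑ j, a j • lieD (X j) φ := by
  have h0 : (∑ j, a j • X j) φ = 0 := by
    rw [LinearMap.sum_apply]
    exact Finset.sum_eq_zero fun j _ => by rw [LinearMap.smul_apply, h, smul_zero]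
  simp only [lieD, h, h0, d_zero, add_zero]
  refine contractD_eq_sum Finset.univ a X _ φ fun i _ => ⟨?_, ?_⟩ <;>
  · rw [LinearMap.sum_apply]
    rfl

section JetSystem

variable {K n : ℕ} {D : Set (Mon K n)} {N : Opens ({μ : Mon K n // μ ∉ D} → ℝ)}
  {J : Type*} [Fintype J]

/-- Commuting vector fields which transform the coordinates, indexed by the monomials outside `D`,
like multiplication by variables, together with dual fields to finitely many coordinates. -/
structure IsJetSystem (F : Mon K n → Fn N) (X : Fin n → VField N)
    (b : J → {μ : Mon K n // μ ∉ D}) (Y : J → VField N) : Prop where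
  shift_mem : ∀ j, ∀ μ ∈ D, Mon.shift j μ ∈ D
  coord_eq : ∀ a : {μ : Mon K n // μ ∉ D}, F a = coord N a
  pd_eq_zero : ∀ (μ : Mon K n) (a : {μ : Mon K n // μ ∉ D}), Mon.deg μ < Mon.deg a.1 →
    pd a (F μ) = 0
  apply_coord : ∀ j a, X j (d (coord N a)) = F (Mon.shift j a)
  bracket_eq_zero : ∀ i j, bracket (X i) (X j) = 0
  dual_same : ∀ i, Y i (d (coord N (b i))) = 1
  dual_ne : ∀ i j, i ≠ j → Y i (d (coord N (b j))) = 0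
  eq_sum : ∃ (f : J → Fin n) (B : J → J → Fn N), ∀ i, Y i = ∑ j, B i j • X (f j)
  kers_eq : kers Y = kers X

variable {F : Mon K n → Fn N} {X : Fin n → VField N} {b : J → {μ : Mon K n // μ ∉ D}}
  {Y : J → VField N}

/-- The form `dk_a - ∑ Y_i(dk_a) dk_{b_i}`. -/
def contactForm (b : J → {μ : Mon K n // μ ∉ D}) (Y : J → VField N)
    (a : {μ : Mon K n // μ ∉ D}) : Form N :=
  d (coord N a) - ∑ i, Y i (d (coord N a)) • d (coord N (b i))

/-- The module generated by the contact forms up to some degree. -/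
def contactSpan (b : J → {μ : Mon K n // μ ∉ D}) (Y : J → VField N) (l : ℕ) :
    Submodule (Fn N) (Form N) :=
  Submodule.span (Fn N) (contactForm b Y '' {a | Mon.deg a.1 ≤ l})

theorem eq_sum_contactForm {φ : Form N} (hφ : φ ∈ kers Y) :
    φ = ∑ a ∈ φ.support, φ a • contactForm b Y a := by
  have h0 : ∀ i, ∑ a ∈ φ.support, φ a * Y i (d (coord N a)) = 0 := fun i => by
    have := mem_kers.1 hφ i
    conv_lhs at this => rw [form_eq_sum φ, map_sum]
    simpa only [map_smul, smul_eq_mul] using this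
  have h1 : ∑ a ∈ φ.support, φ a • ∑ i, Y i (d (coord N a)) • d (coord N (b i)) = 0 := by
    simp only [Finset.smul_sum, smul_smul]
    rw [Finset.sum_comm]
    simp only [← Finset.sum_smul, h0, zero_smul, Finset.sum_const_zero]
  conv_lhs => rw [form_eq_sum φ]
  simp only [contactForm, smul_sub, Finset.sum_sub_distrib]
  rw [h1, sub_zero]

/-! ### The filtration by contact forms -/

namespace IsJetSystem

variable (h : IsJetSystem F X b Y)
include h

theorem isFrame : IsFrame (fun i => coord N (b i)) Y where
  dual_same := h.dual_same
  dual_ne := h.dual_ne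
  finite_coord _ := Set.toFinite _

theorem contactForm_mem (a : {μ : Mon K n // μ ∉ D}) : contactForm b Y a ∈ kers X := by
  rw [← h.kers_eq]
  exact h.isFrame.sub_mem fun j _ => Finset.mem_univ j

theorem contactSpan_le (l : ℕ) : contactSpan b Y l ≤ kers X := by
  refine Submodule.span_le.2 ?_
  rintro _ ⟨a, -, rfl⟩
  exact h.contactForm_mem a

/-- An element of the kernel has the same coefficients with respect to the contact forms as with
respect to the $dk_a$. So its contact degree can be read off from its coefficients. -/
theorem mem_contactSpan {φ : Form N} (hφ : φ ∈ kers X) {l : ℕ}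
    (hl : ∀ a : {μ : Mon K n // μ ∉ D}, l < Mon.deg a.1 → φ a = 0) : φ ∈ contactSpan b Y l := by
  rw [eq_sum_contactForm (b := b) (h.kers_eq ▸ hφ : φ ∈ kers Y)]
  refine Submodule.sum_mem _ fun a ha => Submodule.smul_mem _ _ (Submodule.subset_span ⟨a, ?_, rfl⟩)
  by_contra hn
  exact Finsupp.mem_support_iff.1 ha (hl a (not_le.1 hn))

theorem finDim_contactSpan (l : ℕ) : FinDim (Fn N) (contactSpan b Y l) := by
  classical
  let S : Set {μ : Mon K n // μ ∉ D} := {a | Mon.deg a.1 ≤ l ∧ a ∉ Set.range b}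
  have hS : {a : {μ : Mon K n // μ ∉ D} | Mon.deg a.1 ≤ l}.Finite :=
    Set.Finite.preimage Subtype.val_injective.injOn (Mon.finite_deg_le l)
  have hSf : Finite S := (hS.subset fun a ha => ha.1).to_subtype
  have hspan : contactSpan b Y l = Submodule.span (Fn N)
      (Set.range fun a : S => contactForm b Y a) := by
    -- The contact forms at the indices `b i` vanish. The others are independent, as each has
    -- leading term $dk_a$ corrected only by the $dk_{b_i}$.
    refine le_antisymm (Submodule.span_le.2 ?_) (Submodule.span_le.2 ?_)
    · rintro _ ⟨a, ha, rfl⟩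
      by_cases hab : a ∈ Set.range b
      · obtain ⟨i, rfl⟩ := hab
        have : contactForm b Y (b i) = 0 := by
          rw [contactForm, Finset.sum_eq_single i, h.dual_same, one_smul, sub_self]
          · intro j _ hj
            rw [h.dual_ne _ _ hj, zero_smul]
          · simp
        rw [this]
        exact Submodule.zero_mem _
      · exact Submodule.subset_span ⟨⟨a, ha, hab⟩, rfl⟩
    · rintro _ ⟨a, rfl⟩
      exact Submodule.subset_span ⟨a, a.2.1, rfl⟩
  have hli : LinearIndependent (Fn N) (fun a : S => contactForm b Y a) := by
    rw [linearIndependent_iff']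
    intro s g hg a ha
    have hcoef : ∀ a' : S, contactForm b Y a' a = if a' = a then 1 else 0 := fun a' => by
      rw [contactForm, Finsupp.sub_apply, Finsupp.finsetSum_apply, Finset.sum_eq_zero, sub_zero,
        d_coord, Finsupp.single_apply]
      · simp only [Subtype.ext_iff]
      · intro i _
        rw [Finsupp.smul_apply, d_coord (b i), Finsupp.single_apply, if_neg, smul_zero]
        exact fun hi => a.2.2 ⟨i, hi⟩
    have := congrArg (fun φ : Form N => φ a) hg
    simp only [Finsupp.finsetSum_apply, Finsupp.smul_apply, hcoef, smul_eq_mul, mul_ite, mul_one,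
      mul_zero, Finset.sum_ite_eq', ha, if_true] at this
    exact this
  rw [hspan]
  exact ⟨Module.Finite.span_of_finite _ (Set.finite_range _),
    Module.Free.of_basis (Module.Basis.span hli)⟩

theorem lieD_contactForm (j : Fin n) (a : {μ : Mon K n // μ ∉ D}) :
    lieD (X j) (contactForm b Y a) = d (F (Mon.shift j a)) -
      ∑ i, (X j (d (Y i (d (coord N a)))) • d (coord N (b i))
        + Y i (d (coord N a)) • d (F (Mon.shift j (b i)))) := by
  rw [contactForm, lieD_sub, lieD_d, h.apply_coord, lieD_sum]
  simp only [lieD_smul, lieD_d, h.apply_coord]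

theorem lieD_contactForm_mem (j : Fin n) (a : {μ : Mon K n // μ ∉ D}) :
    lieD (X j) (contactForm b Y a) ∈ kers X :=
  lieD_mem_kers h.bracket_eq_zero j (h.contactForm_mem a)

/-- The correction terms involve only the $b_i$ and their shifts, of degree at most $l_0$. Above
that degree $\mathcal L_{X_j}$ of the contact form at $a$ has the same coefficients as $dF$ at the
shifted index; hence the bound $\deg b_i+1\le l_0$. -/
theorem remainder_apply_eq_zero {l₀ : ℕ} (hl₀ : ∀ i, Mon.deg (b i).1 + 1 ≤ l₀) (j : Fin n)
    (a a' : {μ : Mon K n // μ ∉ D}) (ha' : l₀ < Mon.deg a'.1) :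
    (∑ i, (X j (d (Y i (d (coord N a)))) • d (coord N (b i))
        + Y i (d (coord N a)) • d (F (Mon.shift j (b i)))) : Form N) a' = 0 := by
  rw [Finsupp.finsetSum_apply]
  refine Finset.sum_eq_zero fun i _ => ?_
  have h1 := hl₀ i
  rw [Finsupp.add_apply, Finsupp.smul_apply, Finsupp.smul_apply, d_apply, d_apply,
    h.pd_eq_zero _ a' (by rw [Mon.deg_shift]; omega), ← h.coord_eq (b i), h.pd_eq_zero _ a' (by omega)]
  simp

theorem lieD_mem_contactSpan {l₀ l : ℕ} (hl₀ : ∀ i, Mon.deg (b i).1 + 1 ≤ l₀) (hl : l₀ ≤ l)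
    (j : Fin n) {φ : Form N} (hφ : φ ∈ contactSpan b Y l) :
    lieD (X j) φ ∈ contactSpan b Y (l + 1) := by
  refine lieD_mem_span ?_ ?_ hφ
  · exact Submodule.subset_span.trans (Submodule.span_mono (Set.image_mono fun a ha =>
      Nat.le_succ_of_le ha))
  · rintro _ ⟨a, ha, rfl⟩
    refine h.mem_contactSpan (h.lieD_contactForm_mem j a) fun a' ha' => ?_
    have ha : Mon.deg a.1 ≤ l := ha
    rw [h.lieD_contactForm, Finsupp.sub_apply, h.remainder_apply_eq_zero hl₀ _ _ _ (by omega),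
      d_apply, h.pd_eq_zero _ _ (by rw [Mon.deg_shift]; omega), sub_zero]

/-- Write `a` as the shift of some `ν`; it lies outside `D` because `D` is closed under shifts. The
leading term $dk_a$ then cancels against the Lie derivative of the contact form at `ν`, leaving
coefficients only in degrees at most `l`. -/
theorem contactForm_mem_sup {l₀ l : ℕ} (hl₀ : ∀ i, Mon.deg (b i).1 + 1 ≤ l₀) (hl : l₀ ≤ l)
    (a : {μ : Mon K n // μ ∉ D}) (ha : Mon.deg a.1 = l + 1) :
    ∃ j, ∃ φ ∈ contactSpan b Y l, contactForm b Y a - lieD (X j) φ ∈ contactSpan b Y l := by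
  obtain ⟨j, ν, hν⟩ := Mon.exists_eq_shift (μ := a.1) (by omega)
  have hνD : ν ∉ D := fun hD => a.2 (hν ▸ h.shift_mem j ν hD)
  have hdeg : Mon.deg ν = l := by
    have := Mon.deg_shift j ν
    rw [← hν] at this
    omega
  refine ⟨j, contactForm b Y ⟨ν, hνD⟩, Submodule.subset_span ⟨_, hdeg.le, rfl⟩,
    h.mem_contactSpan ?_ fun a' ha' => ?_⟩
  · exact Submodule.sub_mem _ (h.contactForm_mem a) (h.lieD_contactForm_mem j _)
  · rw [h.lieD_contactForm, Finsupp.sub_apply, Finsupp.sub_apply,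
      h.remainder_apply_eq_zero hl₀ _ _ _ (by omega), ← hν, h.coord_eq, contactForm,
      Finsupp.sub_apply, Finsupp.finsetSum_apply, Finset.sum_eq_zero]
    · simp
    · intro i _
      have := hl₀ i
      rw [Finsupp.smul_apply, d_apply, ← h.coord_eq (b i), h.pd_eq_zero _ _ (by omega), smul_zero]

theorem lieD_mem {P : Submodule (Fn N) (Form N)} {Z : VField N} (hZ : Z ∈ orth (kers X))
    {φ : Form N} (hφ : φ ∈ kers X) (hP : ∀ j, lieD (X j) φ ∈ P) : lieD Z φ ∈ P := by
  obtain ⟨f, B, hB⟩ := h.eq_sum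
  rw [← h.kers_eq] at hZ
  refine h.isFrame.lieD_mem hZ (h.kers_eq ▸ hφ) fun i => ?_
  rw [hB, lieD_sum_smul _ (fun j => X (f j)) fun j => mem_kers.1 hφ (f j)]
  exact P.sum_mem fun j _ => P.smul_mem _ (hP (f j))

/-- Starting in degree $l_0$ puts all correction terms into the lowest module, so the filtration is
generated by Lie derivatives from its first step. -/
theorem isGoodFiltration {l₀ : ℕ} (hl₀ : ∀ i, Mon.deg (b i).1 + 1 ≤ l₀) :
    IsGoodFiltration (kers X) (fun l => contactSpan b Y (l + l₀)) := by
  have hmono : Monotone fun l => contactSpan b Y (l + l₀) := fun l l' hl =>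
    Submodule.span_mono (Set.image_mono fun a (ha : Mon.deg a.1 ≤ l + l₀) => by
      change Mon.deg a.1 ≤ l' + l₀
      omega)
  have hle : ∀ l, lieMod (orth (kers X)) (contactSpan b Y (l + l₀)) ≤
      contactSpan b Y (l + 1 + l₀) := fun l => by
    refine Submodule.span_le.2 ?_
    rintro _ ⟨Z, hZ, φ, hφ, rfl⟩
    refine h.lieD_mem hZ (h.contactSpan_le _ hφ) fun j => ?_
    have := h.lieD_mem_contactSpan hl₀ (l := l + l₀) (by omega) j hφ
    rwa [add_right_comm] at this
  refine ⟨hmono, fun φ => ⟨fun hφ => ?_, fun ⟨l, hl⟩ => h.contactSpan_le _ hl⟩,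
    fun l => h.finDim_contactSpan _, hle, 0, fun l _ => ?_⟩
  · refine ⟨φ.support.sup fun a => Mon.deg a.1, h.mem_contactSpan hφ fun a ha => ?_⟩
    by_contra hn
    have := Finset.le_sup (f := fun a : {μ : Mon K n // μ ∉ D} => Mon.deg a.1)
      (Finsupp.mem_support_iff.2 hn)
    omega
  · refine le_antisymm (sup_le (hmono (Nat.le_succ l)) (hle l)) (Submodule.span_le.2 ?_)
    rintro _ ⟨a, ha, rfl⟩
    have ha : Mon.deg a.1 ≤ l + 1 + l₀ := ha
    rcases Nat.lt_or_ge (l + l₀) (Mon.deg a.1) with hlt | hge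
    · obtain ⟨j, φ, hφ, hd⟩ := h.contactForm_mem_sup hl₀ (l := l + l₀) (by omega) a (by omega)
      rw [← sub_add_cancel (contactForm b Y a) (lieD (X j) φ)]
      exact Submodule.add_mem_sup hd (Submodule.subset_span ⟨_, mem_orth_kers X j, φ, hφ, rfl⟩)
    · exact Submodule.mem_sup_left (Submodule.subset_span ⟨a, hge, rfl⟩)

theorem isDiffiety : IsDiffiety (kers X) := by
  refine ⟨h.kers_eq ▸ h.isFrame.finDim_quotient, _,
    h.isGoodFiltration (l₀ := Finset.univ.sup (fun i => Mon.deg (b i).1) + 1) fun i => ?_⟩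
  have := Finset.le_sup (f := fun i => Mon.deg (b i).1) (Finset.mem_univ i)
  omega

/-- A stable submodule which contains the contact forms of low degree contains all of them. -/
theorem kers_le {l₀ : ℕ} (hl₀ : ∀ i, Mon.deg (b i).1 + 1 ≤ l₀) {P : Submodule (Fn N) (Form N)}
    (hP : ∀ j, ∀ φ ∈ P, lieD (X j) φ ∈ P) (h0 : contactSpan b Y l₀ ≤ P) : kers X ≤ P := by
  have key : ∀ l, contactSpan b Y (l + l₀) ≤ P := fun l => by
    induction l with
    | zero => rwa [zero_add]
    | succ l ih =>
      refine Submodule.span_le.2 ?_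
      rintro _ ⟨a, ha, rfl⟩
      have ha : Mon.deg a.1 ≤ l + 1 + l₀ := ha
      rcases Nat.lt_or_ge (l + l₀) (Mon.deg a.1) with hlt | hge
      · obtain ⟨j, φ, hφ, hd⟩ := h.contactForm_mem_sup hl₀ (l := l + l₀) (by omega) a (by omega)
        rw [← sub_add_cancel (contactForm b Y a) (lieD (X j) φ)]
        exact P.add_mem (ih hd) (hP j φ (ih hφ))
      · exact ih (Submodule.subset_span ⟨a, hge, rfl⟩)
  intro φ hφ
  obtain ⟨l, hl⟩ := ((h.isGoodFiltration hl₀).exhaust φ).1 hφ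
  exact key l hl

end IsJetSystem

end JetSystem

/-! ### Adapted coordinates -/

/-- A spanning family contains a basis, which can be indexed by `J` itself. -/
theorem exists_det_ne_zero {J A : Type*} [Fintype J] [DecidableEq J] (v : A → J → ℝ)
    (hv : ⊤ ≤ Submodule.span ℝ (Set.range v)) :
    ∃ b : J → A, (Matrix.of fun j i => v (b i) j).det ≠ 0 := by
  obtain ⟨C, hC, hspan, hli⟩ := exists_linearIndependent ℝ (Set.range v)
  have hb := Module.Basis.mk hli (by rw [Subtype.range_coe, hspan]; exact hv)
  have e : J ≃ C := (Pi.basisFun ℝ J).indexEquiv hb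
  choose f hf using fun c : C => hC c.2
  refine ⟨fun i => f (e i), ?_⟩
  have h1 : LinearIndependent ℝ (fun i : J => v (f (e i))) := by
    simp only [hf]
    exact hli.comp e e.injective
  have h2 := (Matrix.linearIndependent_rows_iff_isUnit
    (A := Matrix.of fun i j => v (f (e i)) j)).1 h1
  rw [Matrix.isUnit_iff_isUnit_det, isUnit_iff_ne_zero, ← Matrix.det_transpose] at h2
  exact h2

theorem IsCoframe.res {C : Type*} {c : C → Fn M} {ξ : C → VField M} (h : IsCoframe c ξ)
    {U : Opens (ι → ℝ)} (hU : U ≤ M) :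
    IsCoframe (fun a => res hU (c a)) (fun a => resV hU (ξ a)) := by
  refine ⟨h.isFrame.res hU, ?_⟩
  rw [h.isFrame.kers_res, h.kers_eq, eq_bot_iff]
  refine Submodule.span_le.2 ?_
  rintro _ ⟨φ, hφ, rfl⟩
  rw [(Submodule.mem_bot _).1 hφ, Mor.pullForm_zero]
  exact Submodule.zero_mem _

section Adapted

variable {J : Type*} {L K n : ℕ} {D : Set (Mon K n)} {B : Set J}

/-- The derivatives of the functions `h r` with index outside `D` together with some of the
functions `x j`. -/
def jetCoord (D : Set (Mon K n)) (B : Set J) (x : J → Fn M) (X : J → VField M) (v : Fin n → J)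
    (h : Fin K → Fn M) : {μ : Mon K n // μ ∉ D} ⊕ B → Fn M :=
  Sum.elim (fun μ => monFn (fun i => X (v i)) h μ.1) fun j => x j.1

/-- Coordinates adapted to the iterated derivatives of the functions `h r`. -/
structure Adapted (x : J → Fn M) (X : J → VField M) (γ : Fin L → Form M) (v : Fin n → J)
    (h : Fin K → Fn M) (a : Fin L → Fin K → Fn M) (ξ : {μ : Mon K n // μ ∉ D} ⊕ B → VField M) :
    Prop where
  frame : IsFrame x X
  comm : IsCommuting X
  kers_eq : kers X = iterSpan X γ
  inj : Function.Injective v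
  apply_eq_zero : ∀ j ∉ Set.range v, ∀ r, X j (d (h r)) = 0
  coframe : IsCoframe (jetCoord D B x X v h) ξ
  mem_range : ∀ j ∉ B, j ∈ Set.range v
  shift_mem : ∀ j, ∀ μ ∈ D, Mon.shift j μ ∈ D
  apply_inl : ∀ μ ∈ D, ∀ a : {μ : Mon K n // μ ∉ D}, ¬ a.1 < μ →
    ξ (Sum.inl a) (d (monFn (fun i => X (v i)) h μ)) = 0
  apply_inr : ∀ μ b, ξ (Sum.inr b) (d (monFn (fun i => X (v i)) h μ)) = 0
  eq_sum : ∀ l, γ l = ∑ r, a l r • d (h r)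
  coeff_inr : ∀ l r b, ξ (Sum.inr b) (d (a l r)) = 0

variable {x : J → Fn M} {X : J → VField M} {γ : Fin L → Form M} {v : Fin n → J}
  {h : Fin K → Fn M} {a : Fin L → Fin K → Fn M} {ξ : {μ : Mon K n // μ ∉ D} ⊕ B → VField M}

theorem IsCommuting.comp (hX : IsCommuting X) {J' : Type*} (f : J' → J) :
    IsCommuting fun i => X (f i) := fun i j g => hX (f i) (f j) g

theorem apply_d_monFn_eq_zero (hX : IsCommuting X) {j : J} (hj : ∀ r, X j (d (h r)) = 0)
    (μ : Mon K n) : X j (d (monFn (fun i => X (v i)) h μ)) = 0 := by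
  unfold monFn
  induction (Finsupp.toMultiset μ.2).toList with
  | nil => exact hj _
  | cons i w ih =>
    change X j (d (X (v i) (d (iterFn (fun i => X (v i)) w (h μ.1))))) = 0
    rw [hX, ih, d_zero, map_zero]

/-- The module generated by the differentials of all derivatives is stable. -/
theorem lieD_mem_span_monFn (hX : IsCommuting X)
    (hv : ∀ j ∉ Set.range v, ∀ r, X j (d (h r)) = 0) (j : J) {φ : Form M}
    (hφ : φ ∈ Submodule.span (Fn M) (Set.range fun μ => d (monFn (fun i => X (v i)) h μ))) :
    lieD (X j) φ ∈
      Submodule.span (Fn M) (Set.range fun μ => d (monFn (fun i => X (v i)) h μ)) := by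
  refine lieD_mem_span Submodule.subset_span ?_ hφ
  rintro _ ⟨μ, rfl⟩
  rw [lieD_d]
  by_cases hj : j ∈ Set.range v
  · obtain ⟨i, rfl⟩ := hj
    rw [apply_d_monFn (X := fun i => X (v i)) (hX.comp v)]
    exact Submodule.subset_span ⟨_, rfl⟩
  · rw [apply_d_monFn_eq_zero hX (hv j hj), d_zero]
    exact Submodule.zero_mem _

theorem iterSpan_le_span_monFn (hX : IsCommuting X)
    (hv : ∀ j ∉ Set.range v, ∀ r, X j (d (h r)) = 0) (hγ : ∀ l, γ l = ∑ r, a l r • d (h r)) :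
    iterSpan X γ ≤
      Submodule.span (Fn M) (Set.range fun μ => d (monFn (fun i => X (v i)) h μ)) := by
  refine iterSpan_le (fun j φ hφ => lieD_mem_span_monFn hX hv j hφ) fun l => ?_
  rw [hγ]
  refine Submodule.sum_mem _ fun r _ => Submodule.smul_mem _ _ (Submodule.subset_span ⟨Mon.mk r 0, ?_⟩)
  simp only [monFn_zero]

/-! ### Contact forms and new independent variables in adapted coordinates -/

namespace Adapted

theorem res (H : Adapted x X γ v h a ξ) {U : Opens (ι → ℝ)} (hU : U ≤ M) :
    Adapted (fun j => res hU (x j)) (fun j => resV hU (X j)) (fun l => resForm hU (γ l)) v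
      (fun r => Diffiety.res hU (h r)) (fun l r => Diffiety.res hU (a l r))
      (fun c => resV hU (ξ c)) where
  frame := H.frame.res hU
  comm := H.comm.res hU
  kers_eq := by rw [H.frame.kers_res, H.kers_eq, iterSpan_res]
  inj := H.inj
  apply_eq_zero j hj r := by rw [resV_d, H.apply_eq_zero j hj, map_zero]
  coframe := by
    convert H.coframe.res hU using 1
    funext c
    rcases c with c | c
    exacts [res_monFn (X := fun i => X (v i)) hU c.1, rfl]
  mem_range := H.mem_range
  shift_mem := H.shift_mem
  apply_inl μ hμ c hc := by
    rw [res_monFn (X := fun i => X (v i)), resV_d, H.apply_inl μ hμ c hc, map_zero]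
  apply_inr μ c := by
    rw [res_monFn (X := fun i => X (v i)), resV_d, H.apply_inr μ c, map_zero]
  eq_sum l := by
    rw [H.eq_sum, resForm, Mor.pullForm_sum]
    simp only [Mor.pullForm_smul, Mor.pullForm_d]
  coeff_inr l r c := by rw [resV_d, H.coeff_inr, map_zero]

variable (H : Adapted x X γ v h a ξ)
include H

theorem apply_inr_eq_zero (b : B) {φ : Form M} (hφ : φ ∈ kers X) : ξ (Sum.inr b) φ = 0 := by
  have h1 := iterSpan_le_span_monFn H.comm H.apply_eq_zero H.eq_sum (H.kers_eq ▸ hφ)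
  have h2 : Submodule.span (Fn M) (Set.range fun μ => d (monFn (fun i => X (v i)) h μ))
      ≤ LinearMap.ker (ξ (Sum.inr b)) := Submodule.span_le.2 (by
    rintro _ ⟨μ, rfl⟩
    exact H.apply_inr μ b)
  exact h2 h1

/-- Combinations of the differentials of the derivatives which are annihilated by sufficiently many
vector fields are annihilated by all of them. -/
theorem mem_kers_of {φ : Form M}
    (hφ : φ ∈ Submodule.span (Fn M) (Set.range fun μ => d (monFn (fun i => X (v i)) h μ)))
    (h0 : ∀ i, v i ∉ B → X (v i) φ = 0) : φ ∈ kers X := by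
  classical
  have h1 : ∀ j ∉ B, X j φ = 0 := fun j hj => by
    obtain ⟨i, rfl⟩ := H.mem_range j hj
    exact h0 i hj
  have h2 : Submodule.span (Fn M) (Set.range fun μ => d (monFn (fun i => X (v i)) h μ))
      ≤ ⨅ b, LinearMap.ker (ξ (Sum.inr b)) := Submodule.span_le.2 (by
    rintro _ ⟨μ, rfl⟩
    simp only [SetLike.mem_coe, Submodule.mem_iInf]
    exact fun b => H.apply_inr μ b)
  have h3 := h2 hφ
  simp only [Submodule.mem_iInf, LinearMap.mem_ker] at h3
  -- The contact part of `φ` lies in `kers X`. The dual field of a complementary `x j` kills it and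
  -- kills `φ`; what is left of the expansion is exactly $X_j\varphi$, which is therefore zero.
  have h4 := H.frame.sub_mem (φ := φ) (s := (H.frame.finite φ).toFinset) fun j hj =>
    (H.frame.finite φ).mem_toFinset.2 hj
  refine mem_kers.2 fun j => ?_
  by_cases hj : j ∈ B
  · have h5 := H.apply_inr_eq_zero ⟨j, hj⟩ h4
    rw [map_sub, h3, zero_sub, neg_eq_zero, map_sum] at h5
    by_contra hn
    rw [Finset.sum_eq_single_of_mem j ((H.frame.finite φ).mem_toFinset.2 hn)] at h5
    · rw [map_smul] at h5
      have h6 : ξ (Sum.inr ⟨j, hj⟩) (d (x j)) = 1 := H.coframe.isFrame.dual_same _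
      rw [h6, smul_eq_mul, mul_one] at h5
      exact hn h5
    · intro k hk hkj
      have hkB : k ∈ B := by
        by_contra hkB
        exact (H.frame.finite φ).mem_toFinset.1 hk (h1 k hkB)
      have h6 : ξ (Sum.inr ⟨j, hj⟩) (d (x k)) = 0 :=
        H.coframe.isFrame.dual_ne (Sum.inr ⟨j, hj⟩) (Sum.inr ⟨k, hkB⟩) fun he =>
          hkj (Subtype.ext_iff.1 (Sum.inr_injective he)).symm
      rw [map_smul, h6, smul_zero]
  · exact h1 j hj

open Classical in
theorem exists_det_ne_zero (p : M) : ∃ b : {i // v i ∉ B} → {μ : Mon K n // μ ∉ D},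
    ev p (Matrix.of fun (j i : {i // v i ∉ B}) =>
      X (v j) (d (monFn (fun i => X (v i)) h (b i).1))).det ≠ 0 := by
  obtain ⟨b, hb⟩ := Diffiety.exists_det_ne_zero
    (fun (c : {μ : Mon K n // μ ∉ D}) (j : {i // v i ∉ B}) =>
      ev p (X (v j) (d (monFn (fun i => X (v i)) h c.1)))) (by
    rw [← (Pi.basisFun ℝ {i // v i ∉ B}).span_eq, Submodule.span_le]
    rintro _ ⟨i, rfl⟩
    -- The discarded $x_{v_i}$ are expanded in the adapted coordinates. The fields $X_{v_j}$ with
    -- $v_j\notin B$ kill the $dx$ of the retained ones, so the values on the derivatives alone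
    -- already span. Some derivatives can thus replace the discarded $x$'s as independent variables.
    have h1 := H.coframe.eq_sum (φ := d (x (v i)))
      (s := (H.coframe.isFrame.finite _).toFinset) fun j hj =>
        (H.coframe.isFrame.finite _).mem_toFinset.2 hj
    have h2 : Pi.basisFun ℝ {i // v i ∉ B} i = ∑ c ∈ (H.coframe.isFrame.finite (d (x (v i)))).toFinset,
        ev p (ξ c (d (x (v i)))) • (fun j : {i // v i ∉ B} =>
          ev p (X (v j) (d (jetCoord D B x X v h c)))) := by
      funext j
      have h3 := congrArg (fun φ => ev p (X (v j) φ)) h1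
      simp only [map_sum, map_smul, smul_eq_mul, map_mul] at h3
      rw [Finset.sum_apply]
      simp only [Pi.smul_apply, smul_eq_mul]
      rw [← h3, Pi.basisFun_apply, Pi.single_apply]
      split_ifs with hij
      · rw [hij, H.frame.dual_same, map_one]
      · rw [H.frame.dual_ne _ _ fun he => hij (Subtype.ext (H.inj he)), map_zero]
    rw [h2]
    refine Submodule.sum_mem _ fun c _ => Submodule.smul_mem _ _ ?_
    rcases c with c | c
    · exact Submodule.subset_span ⟨c, rfl⟩
    · convert Submodule.zero_mem _ with j
      have : X (v j) (d (x c.1)) = 0 := H.frame.dual_ne _ _ fun he => j.2 (he ▸ c.2)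
      exact (congrArg (ev p) this).trans (map_zero _))
  refine ⟨b, ?_⟩
  rw [RingHom.map_det]
  exact hb

open Classical in
theorem exists_coeff (b : {i // v i ∉ B} → {μ : Mon K n // μ ∉ D})
    (hb : IsUnit (Matrix.of fun (j i : {i // v i ∉ B}) =>
      X (v j) (d (monFn (fun i => X (v i)) h (b i).1))).det) (μ : Mon K n) :
    ∃ e : {i // v i ∉ B} → Fn M, d (monFn (fun i => X (v i)) h μ)
      - ∑ i, e i • d (monFn (fun i => X (v i)) h (b i).1) ∈ kers X := by
  obtain ⟨Y, h1, h2⟩ : ∃ Y : {i // v i ∉ B} → VField M,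
      (∀ i i', Y i (d (monFn (fun i => X (v i)) h (b i').1)) = if i = i' then 1 else 0) ∧
      kers Y = kers fun j : {i // v i ∉ B} => X (v j) := by
    obtain ⟨Bm, -, h1, h2⟩ := exists_dual
      (fun i : {i // v i ∉ B} => monFn (fun i => X (v i)) h (b i).1) (fun j => X (v j)) hb
    exact ⟨_, h1, h2⟩
  refine ⟨fun i => Y i (d (monFn (fun i => X (v i)) h μ)), H.mem_kers_of ?_ ?_⟩
  · exact Submodule.sub_mem _ (Submodule.subset_span ⟨_, rfl⟩) (Submodule.sum_mem _ fun i _ =>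
      Submodule.smul_mem _ _ (Submodule.subset_span ⟨_, rfl⟩))
  · intro i hi
    refine mem_kers.1 (h2.le ?_) (⟨i, hi⟩ : {i // v i ∉ B})
    rw [mem_kers]
    intro i'
    rw [map_sub, map_sum, Finset.sum_eq_single i']
    · rw [map_smul, h1, if_pos rfl, smul_eq_mul, mul_one, sub_self]
    · intro j _ hj
      rw [map_smul, h1, if_neg hj.symm, smul_zero]
    · simp

end Adapted

/-- The coefficients are uniquely determined. -/
theorem coeff_unique {J' : Type*} [Fintype J'] [DecidableEq J'] {Z : J' → VField M} {k : J' → Fn M}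
    (hb : IsUnit (Matrix.of fun j i => Z j (d (k i))).det) {e e' : J' → Fn M} {φ : Form M}
    (h1 : ∀ j, Z j (φ - ∑ i, e i • d (k i)) = 0)
    (h2 : ∀ j, Z j (φ - ∑ i, e' i • d (k i)) = 0) : e = e' := by
  have h3 : (Matrix.of fun j i => Z j (d (k i))).mulVec e
      = (Matrix.of fun j i => Z j (d (k i))).mulVec e' := by
    funext j
    have h4 := (h1 j).trans (h2 j).symm
    rw [map_sub, map_sub, sub_right_inj, map_sum, map_sum] at h4
    simpa [Matrix.mulVec, dotProduct, mul_comm] using h4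
  exact Matrix.mulVec_injective_of_isUnit ((Matrix.isUnit_iff_isUnit_det _).2 hb) h3

/-- Genericity makes the independent derivatives a basis of their span `P` and selects the $x_j$
independent modulo `P`. Together they span all forms because `kers X` lies in `P`. -/
theorem adapted_of_isGeneric (hx : IsFrame x X) (hX : IsCommuting X)
    (hR : kers X = iterSpan X γ) (hvi : Function.Injective v)
    (hv : ∀ j ∉ Set.range v, ∀ r, X j (d (h r)) = 0) (hγ : ∀ l, γ l = ∑ r, a l r • d (h r))
    (ha : ∀ l r, d (a l r) ∈ Submodule.span (Fn M) (Set.range fun r => d (h r)))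
    (hg₁ : IsGeneric (fun μ => d (monFn (fun i => X (v i)) h μ)) ⊥)
    (hg₂ : IsGeneric (fun i => d (x (v i)))
      (Submodule.span (Fn M) (Set.range fun μ => d (monFn (fun i => X (v i)) h μ)))) :
    ∃ (D : Set (Mon K n)) (B : Set J) (ξ : {μ : Mon K n // μ ∉ D} ⊕ B → VField M),
      Adapted x X γ v h a ξ := by
  classical
  set H : Mon K n → Fn M := fun μ => monFn (fun i => X (v i)) h μ with hH
  set P := Submodule.span (Fn M) (Set.range fun μ => d (H μ)) with hP
  let D := depSet (fun μ => d (H μ)) ⊥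
  let D' := depSet (fun i => d (x (v i))) P
  -- Only those $x_{v_i}$ whose differentials depend on `P` and the preceding ones are dropped.
  -- Indices outside the range of `v` are all kept, since their fields kill `P`.
  let B : Set J := {j | ∀ i, v i = j → i ∉ D'}
  have hPA : P = Submodule.span (Fn M) (Set.range fun μ : {μ : Mon K n // μ ∉ D} => d (H μ.1)) := by
    refine le_antisymm (Submodule.span_le.2 ?_) (Submodule.span_le.2 ?_)
    · rintro _ ⟨μ, rfl⟩
      have := mem_sup_span_of_notMem_depSet (fun μ => d (H μ)) ⊥ μ
      rw [bot_sup_eq] at this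
      refine Submodule.span_mono ?_ this
      rintro _ ⟨ν, hν, rfl⟩
      exact ⟨⟨ν, hν.1⟩, rfl⟩
    · rintro _ ⟨μ, rfl⟩
      exact Submodule.subset_span ⟨μ.1, rfl⟩
  have hXP : ∀ j ∉ Set.range v, ∀ φ ∈ P, X j φ = 0 := fun j hj φ hφ => by
    refine (Submodule.span_le.2 ?_ : P ≤ LinearMap.ker (X j)) hφ
    rintro _ ⟨μ, rfl⟩
    exact apply_d_monFn_eq_zero hX (hv j hj) μ
  have hB : ∀ j ∉ B, ∃ i ∈ D', v i = j := fun j hj => by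
    simp only [B, Set.mem_ofPred_eq, not_forall, not_not] at hj
    obtain ⟨i, h1, h2⟩ := hj
    exact ⟨i, h2, h1⟩
  -- the functions `x j` are independent modulo `P`
  have hdisj : ∀ (s : Finset B) (g : B → Fn M), ∑ j ∈ s, g j • d (x j.1) ∈ P →
      ∀ j ∈ s, g j = 0 := by
    intro s g hs
    have hXj : ∀ j ∈ s, X j.1 (∑ j ∈ s, g j • d (x j.1)) = g j := fun j hj => by
      rw [map_sum, Finset.sum_eq_single_of_mem j hj, map_smul, hx.dual_same, smul_eq_mul, mul_one]
      intro k _ hk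
      rw [map_smul, hx.dual_ne _ _ fun he => hk (Subtype.ext he.symm), smul_zero]
    have h1 : ∀ j ∈ s, j.1 ∉ Set.range v → g j = 0 := fun j hj hjv => by
      rw [← hXj j hj, hXP j hjv _ hs]
    let g' : Fin n → Fn M := fun i => if hi : v i ∈ B then (if ⟨v i, hi⟩ ∈ s then g ⟨v i, hi⟩ else 0) else 0
    let t : Finset (Fin n) := Finset.univ.filter fun i => i ∉ D' ∧ ∃ hi : v i ∈ B, ⟨v i, hi⟩ ∈ s
    have h2 : ∑ i ∈ t, g' i • d (x (v i)) = ∑ j ∈ s, g j • d (x j.1) := by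
      refine Finset.sum_bij_ne_zero
        (fun i hi _ => ⟨v i, (Finset.mem_filter.1 hi).2.2.1⟩) ?_ ?_ ?_ ?_
      · exact fun i hi _ => (Finset.mem_filter.1 hi).2.2.2
      · exact fun i _ _ i' _ _ he => hvi (Subtype.ext_iff.1 he)
      · intro j hj hne
        have hjv : j.1 ∈ Set.range v := by
          by_contra hn
          exact hne (by rw [h1 j hj hn, zero_smul])
        obtain ⟨i, hi⟩ := hjv
        obtain ⟨j, hjB⟩ := j
        change v i = j at hi
        subst hi
        refine ⟨i, Finset.mem_filter.2 ⟨Finset.mem_univ _, hjB i rfl, hjB, hj⟩, ?_, rfl⟩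
        simpa only [g', dif_pos hjB, if_pos hj] using hne
      · intro i hi _
        obtain ⟨hiB, his⟩ := (Finset.mem_filter.1 hi).2.2
        simp only [g', dif_pos hiB, if_pos his]
    have h3 := hg₂.eq_zero (s := t) (c := g') (fun i hi => (Finset.mem_filter.1 hi).2.1)
      (by rw [h2]; exact hs)
    intro j hj
    by_cases hjv : j.1 ∈ Set.range v
    · obtain ⟨i, hi⟩ := hjv
      obtain ⟨j, hjB⟩ := j
      change v i = j at hi
      subst hi
      have := h3 i (Finset.mem_filter.2 ⟨Finset.mem_univ _, hjB i rfl, hjB, hj⟩)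
      simpa only [g', dif_pos hjB, if_pos hj] using this
    · exact h1 j hj hjv
  have hli : LinearIndependent (Fn M) fun c => d (jetCoord D B x X v h c) := by
    have hc : (fun c => d (jetCoord D B x X v h c))
        = Sum.elim (fun μ : {μ : Mon K n // μ ∉ D} => d (H μ.1)) fun j : B => d (x j.1) := by
      funext c
      rcases c with c | c <;> rfl
    rw [hc]
    refine LinearIndependent.sum_type ?_ ?_ ?_
    · rw [linearIndependent_iff']
      intro s g hs μ hμ
      let g' : Mon K n → Fn M := fun μ => if hμ : μ ∉ D then g ⟨μ, hμ⟩ else 0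
      have h1 : ∑ μ ∈ s.map (Function.Embedding.subtype _), g' μ • d (H μ) = 0 := by
        rw [Finset.sum_map, ← hs]
        refine Finset.sum_congr rfl fun μ _ => ?_
        have := μ.2
        simp [g', this]
      have h2 := hg₁.eq_zero (s := s.map (Function.Embedding.subtype _)) (c := g') (by
        intro ν hν
        obtain ⟨ν, -, rfl⟩ := Finset.mem_map.1 hν
        exact ν.2) (by rw [Submodule.mem_bot]; exact h1) μ.1 (Finset.mem_map_of_mem _ hμ)
      have := μ.2
      simpa [g', this] using h2
    · rw [linearIndependent_iff']
      intro s g hs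
      exact hdisj s g (hs ▸ P.zero_mem)
    · rw [← hPA, Submodule.disjoint_def]
      intro φ hφ hφ'
      obtain ⟨c, rfl⟩ := Finsupp.mem_span_range_iff_exists_finsupp.1 hφ'
      refine Finset.sum_eq_zero fun j hj => ?_
      simp only [hdisj c.support c hφ j hj, zero_smul]
  have hRP : kers X ≤ P := hR ▸ iterSpan_le_span_monFn hX hv hγ
  set Q := Submodule.span (Fn M) (Set.range fun c => d (jetCoord D B x X v h c)) with hQ
  have hPQ : P ≤ Q := by
    rw [hPA]
    refine Submodule.span_mono ?_
    rintro _ ⟨μ, rfl⟩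
    exact ⟨Sum.inl μ, rfl⟩
  have hxQ : ∀ j, d (x j) ∈ Q := fun j => by
    by_cases hj : j ∈ B
    · exact Submodule.subset_span ⟨Sum.inr ⟨j, hj⟩, rfl⟩
    · obtain ⟨i, hi, rfl⟩ := hB j hj
      refine (sup_le hPQ (Submodule.span_le.2 ?_) :
        P ⊔ Submodule.span (Fn M) ((fun i => d (x (v i))) '' {i' | i' ∉ D' ∧ i' < i}) ≤ Q)
        (mem_sup_span_of_mem_depSet (fun i => d (x (v i))) P hi)
      rintro _ ⟨i', hi', rfl⟩
      exact Submodule.subset_span ⟨Sum.inr ⟨v i', fun k hk => hvi hk ▸ hi'.1⟩, rfl⟩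
  have hspan : ⊤ ≤ Q := fun φ _ => by
    have h1 := hx.sub_mem (φ := φ) (s := (hx.finite φ).toFinset) fun j hj =>
      (hx.finite φ).mem_toFinset.2 hj
    rw [← sub_add_cancel φ (∑ j ∈ (hx.finite φ).toFinset, X j φ • d (x j))]
    exact Q.add_mem (hPQ (hRP h1)) (Q.sum_mem fun j _ => Q.smul_mem _ (hxQ j))
  obtain ⟨ξ, hξ⟩ := exists_isCoframe hli hspan
  have hξP : ∀ b, ∀ φ ∈ P, ξ (Sum.inr b) φ = 0 := fun b φ hφ => by
    rw [hPA] at hφ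
    refine (Submodule.span_le.2 ?_ : _ ≤ LinearMap.ker (ξ (Sum.inr b))) hφ
    rintro _ ⟨μ, rfl⟩
    exact hξ.isFrame.dual_ne (Sum.inr b) (Sum.inl μ) (by simp)
  refine ⟨D, B, ξ, hx, hX, hR, hvi, hv, hξ, fun j hj => ?_, ?_, ?_, ?_, hγ, ?_⟩
  · obtain ⟨i, -, hi⟩ := hB j hj
    exact ⟨i, hi⟩
  · exact shift_mem_depSet (X := fun i => X (v i)) (hX.comp v) (by simp)
  · intro μ hμ c hc
    have h1 := mem_sup_span_of_mem_depSet _ _ hμ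
    rw [bot_sup_eq] at h1
    refine (Submodule.span_le.2 ?_ : _ ≤ LinearMap.ker (ξ (Sum.inl c))) h1
    rintro _ ⟨ν, hν, rfl⟩
    exact hξ.isFrame.dual_ne (Sum.inl c) (Sum.inl ⟨ν, hν.1⟩) fun he => by
      rw [Sum.inl_injective he] at hc
      exact hc hν.2
  · exact fun μ b => hξP b _ (Submodule.subset_span ⟨μ, rfl⟩)
  · refine fun l r b => hξP b _ ((Submodule.span_le.2 ?_ : _ ≤ P) (ha l r))
    rintro _ ⟨r, rfl⟩
    refine Submodule.subset_span ⟨Mon.mk r 0, ?_⟩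
    simp only [hH, monFn_zero]

/-- Adapted coordinates exist on a nonempty open subset. -/
theorem exists_adapted (hx : IsFrame x X) (hX : IsCommuting X)
    (hR : kers X = iterSpan X γ) (hvi : Function.Injective v)
    (hv : ∀ j ∉ Set.range v, ∀ r, X j (d (h r)) = 0) (hγ : ∀ l, γ l = ∑ r, a l r • d (h r))
    (ha : ∀ l r, d (a l r) ∈ Submodule.span (Fn M) (Set.range fun r => d (h r)))
    (hM : (M : Set (ι → ℝ)).Nonempty) :
    ∃ (U : Opens (ι → ℝ)) (hU : U ≤ M), (U : Set (ι → ℝ)).Nonempty ∧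
    ∃ (D : Set (Mon K n)) (B : Set J) (ξ : {μ : Mon K n // μ ∉ D} ⊕ B → VField U),
      Adapted (fun j => res hU (x j)) (fun j => resV hU (X j)) (fun l => resForm hU (γ l)) v
        (fun r => res hU (h r)) (fun l r => res hU (a l r)) ξ := by
  obtain ⟨U, hU, hUne, hg₁⟩ := exists_isGeneric_monFn (X := fun i => X (v i)) (hX.comp v) h
    (Q := ⊥) (by simp) hM
  -- The second selection concerns finitely many functions, so equality serves as the well
  -- quasi-order and upward closure is automatic.
  obtain ⟨W, hW, hWne, hg₂⟩ := exists_isGeneric (r := (· = ·)) (Finite.wellQuasiOrdered _)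
    (fun i => d (res hU (x (v i)))) (Submodule.span (Fn U) (Set.range fun μ =>
      d (monFn (fun i => resV hU (X (v i))) (fun r => res hU (h r)) μ)))
    (by rintro _ _ _ _ h rfl; exact h) hUne
  have hbot : ∀ {V V' : Opens (ι → ℝ)} (hV : V ≤ V'), (incl hV).extend ⊥ = ⊥ := fun hV => by
    rw [eq_bot_iff]
    refine Submodule.span_le.2 ?_
    rintro _ ⟨φ, hφ, rfl⟩
    rw [(Submodule.mem_bot _).1 hφ, Mor.pullForm_zero]
    exact Submodule.zero_mem _
  have hmon : ∀ μ, d (monFn (fun i => resV (hW.trans hU) (X (v i)))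
      (fun r => res (hW.trans hU) (h r)) μ) = resForm hW (d (monFn (fun i => resV hU (X (v i)))
      (fun r => res hU (h r)) μ)) := fun μ => by
    rw [res_monFn (X := fun i => X (v i)), res_monFn (X := fun i => X (v i)), resForm_d]
    rfl
  refine ⟨W, hW.trans hU, hWne, adapted_of_isGeneric (hx.res _) (hX.res _) ?_ hvi ?_ ?_ ?_ ?_ ?_⟩
  · rw [hx.kers_res, hR, iterSpan_res]
  · exact fun j hj r => by rw [resV_d, hv j hj, map_zero]
  · intro l
    rw [hγ, resForm, Mor.pullForm_sum]
    simp only [Mor.pullForm_smul, Mor.pullForm_d]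
  · intro l r
    have := Mor.pullForm_mem_extend (incl (hW.trans hU)) (ha l r)
    rw [Mor.extend_span, ← Set.range_comp, Mor.pullForm_d] at this
    convert this using 4
    exact (Mor.pullForm_d _ _).symm
  -- Genericity survives shrinking: a monomial dependent on `V` is dependent on the first open set
  -- by genericity there, hence on `W` by restriction.
  · intro V hV hVne
    rw [hbot] at hg₁ ⊢
    intro μ hμ
    have h1 := hg₁ V (hV.trans hW) hVne
    rw [hbot] at h1
    simp only [hmon, resForm_resForm] at hμ
    have h2 := depSet_subset_res hW _ _ (h1 hμ)
    rw [hbot] at h2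
    simpa only [hmon] using h2
  · have h1 : (fun i => d (res (hW.trans hU) (x (v i))))
        = fun i => resForm hW (d (res hU (x (v i)))) := funext fun i => by
      rw [resForm_d]; rfl
    rw [h1]
    convert hg₂ using 1
    rw [Mor.extend_span, ← Set.range_comp]
    congr 2
    exact funext hmon

end Adapted

/-! ### The projection to the base of a box -/

namespace BoxChart

variable {A B : Type*} {c : A ⊕ B → Fn M} (C : BoxChart c)

/-- The function is expressed by a smooth formula in the box coordinates. -/
def HasFormula (f : Fn M) : Prop :=
  ∃ G : (C.T → ℝ) → ℝ, (∀ v : C.T → ℝ, (∀ a, |v a - C.c₀ a| < C.ε) → ContDiffAt ℝ ∞ G v) ∧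
    ∀ q, f.1 q = G fun a => (c a).1 q

/-- The coefficients of the form are polynomial functions. -/
def IsPolyForm (φ : Form C.base) : Prop := ∀ a, φ a ∈ C.polys

variable {C}

theorem IsPolyForm.add {φ ψ : Form C.base} (hφ : C.IsPolyForm φ) (hψ : C.IsPolyForm ψ) :
    C.IsPolyForm (φ + ψ) := fun a => C.polys.add_mem (hφ a) (hψ a)

theorem IsPolyForm.sub {φ ψ : Form C.base} (hφ : C.IsPolyForm φ) (hψ : C.IsPolyForm ψ) :
    C.IsPolyForm (φ - ψ) := fun a => C.polys.sub_mem (hφ a) (hψ a)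

theorem IsPolyForm.smul {φ : Form C.base} (hφ : C.IsPolyForm φ) {f : Fn C.base}
    (hf : f ∈ C.polys) : C.IsPolyForm (f • φ) := fun a => C.polys.mul_mem hf (hφ a)

theorem IsPolyForm.sum {α : Type*} {s : Finset α} {φ : α → Form C.base}
    (hφ : ∀ i ∈ s, C.IsPolyForm (φ i)) : C.IsPolyForm (∑ i ∈ s, φ i) := fun a => by
  rw [Finsupp.finsetSum_apply]
  exact C.polys.sum_mem fun i hi => hφ i hi a

theorem isPolyForm_d {f : Fn C.base} (hf : f ∈ C.polys) : C.IsPolyForm (d f) :=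
  fun a => pd_mem_polys hf a

theorem IsPolyForm.apply_mem {φ : Form C.base} (hφ : C.IsPolyForm φ) {Z : VField C.base}
    (hZ : ∀ a, Z (d (coord C.base a)) ∈ C.polys) : Z φ ∈ C.polys := by
  rw [form_eq_sum φ, map_sum]
  refine C.polys.sum_mem fun a _ => ?_
  rw [map_smul]
  exact C.polys.mul_mem (hφ a) (hZ a)

theorem IsPolyForm.lieD {φ : Form C.base} (hφ : C.IsPolyForm φ) {Z : VField C.base}
    (hZ : ∀ a, Z (d (coord C.base a)) ∈ C.polys) : C.IsPolyForm (lieD Z φ) := by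
  rw [form_eq_sum φ, lieD_sum]
  refine IsPolyForm.sum fun a _ => ?_
  rw [lieD_smul, lieD_d]
  exact ((isPolyForm_d (coord_mem_polys a)).smul (apply_d_mem_polys hZ (hφ a))).add
    ((isPolyForm_d (hZ a)).smul (hφ a))

theorem IsPolyForm.iterForm {J : Type*} {φ : Form C.base} (hφ : C.IsPolyForm φ)
    {Z : J → VField C.base} (hZ : ∀ j a, Z j (d (coord C.base a)) ∈ C.polys) (w : List J) :
    C.IsPolyForm (iterForm Z w φ) := by
  induction w with
  | nil => exact hφ
  | cons j w ih => exact ih.lieD (hZ j)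

theorem apply_pullForm {ξ : A ⊕ B → VField M} (h : IsCoframe c ξ) (a : A) (φ : Form C.base) :
    ξ (Sum.inl a) (C.proj.pullForm φ) = C.proj.pull (φ a) := by
  classical
  have : Related C.proj (ξ (Sum.inl a)) (vfield (Pi.single a 1)) := related_of_coord fun b => by
    rw [vfield_coord, proj_pull_coord]
    by_cases hb : a = b
    · rw [hb, h.isFrame.dual_same, Pi.single_eq_same, map_one]
    · rw [h.isFrame.dual_ne _ _ fun he => hb (Sum.inl_injective he),
        Pi.single_eq_of_ne (Ne.symm hb), map_zero]
  rw [this]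
  congr 1
  conv_lhs => rw [form_eq_sum φ, map_sum]
  simp only [map_smul, vfield_coord, Pi.single_apply, smul_eq_mul, mul_ite, mul_one, mul_zero]
  rw [Finset.sum_ite_eq']
  split_ifs with ha
  · rfl
  · exact (Finsupp.notMem_support_iff.1 ha).symm

/-- Combinations on `M` with coefficients expressed by the box coordinates can be lifted. -/
theorem mem_span_of_slice {ξ : A ⊕ B → VField M} (h : IsCoframe c ξ) {I : Type*} {φ : Form C.base}
    (hφ : C.IsPolyForm φ) {θ : I → Form C.base} (hθ : ∀ t, C.IsPolyForm (θ t)) (g : I →₀ Fn M)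
    (hg : ∀ t, C.HasFormula (g t))
    (heq : C.proj.pullForm φ = g.sum fun t f => f • C.proj.pullForm (θ t)) :
    φ ∈ Submodule.span (Fn C.base) (Set.range θ) := by
  choose g' hg₁ hg₂ _ _ using fun t => exists_lift h (hg t)
  -- The coefficients may involve coordinates of the second kind and need not descend. Their lifts
  -- agree with them on the slice, and vanishing on the slice suffices for polynomial coefficients.
  have hzero : φ - ∑ t ∈ g.support, g' t • θ t = 0 := by
    have hp : C.IsPolyForm (φ - ∑ t ∈ g.support, g' t • θ t) :=
      hφ.sub (IsPolyForm.sum fun t _ => (hθ t).smul (dependsOn_mem_polys (hg₁ t)))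
    refine Finsupp.ext fun c' => eq_zero_of_slice h (hp c') fun q hq => ?_
    rw [← apply_pullForm h, Mor.pullForm_sub, heq, Mor.pullForm_sum, Finsupp.sum,
      ← Finset.sum_sub_distrib, map_sum, map_sum]
    refine Finset.sum_eq_zero fun t _ => ?_
    rw [Mor.pullForm_smul, ← sub_smul, map_smul, smul_eq_mul, map_mul, map_sub, hg₂ t q hq,
      sub_self, zero_mul]
  rw [sub_eq_zero.1 hzero]
  exact Submodule.sum_mem _ fun t _ => Submodule.smul_mem _ _ (Submodule.subset_span ⟨_, rfl⟩)

/-- The formula supplies a lift depending on the box coordinates alone. It has the same pullback as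
`g`, and both are polynomial functions, so they coincide. -/
theorem dependsOn_of_hasFormula {ξ : A ⊕ B → VField M} (h : IsCoframe c ξ) {g : Fn C.base}
    (hg : g ∈ C.polys) (hf : C.HasFormula (C.proj.pull g))
    (h0 : ∀ b, ξ (Sum.inr b) (d (C.proj.pull g)) = 0) : DependsOn C.fixed g := by
  obtain ⟨g', h1, -, h2, -⟩ := exists_lift h hf
  rw [pull_injOn h hg (dependsOn_mem_polys h1) (h2 h0).symm]
  exact h1

end BoxChart

/-! ### Descent of derivatives, fields and forms to the base -/

section Lift

open BoxChart

variable {J : Type*} {L K n : ℕ} {D : Set (Mon K n)} {B : Set J}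
  {x : J → Fn M} {X : J → VField M} {γ : Fin L → Form M} {v : Fin n → J}
  {h : Fin K → Fn M} {a : Fin L → Fin K → Fn M} {ξ : {μ : Mon K n // μ ∉ D} ⊕ B → VField M}

/-- Functions on the base of a box which correspond to the derivatives of the functions `h r`. -/
structure JetLift (C : BoxChart (jetCoord D B x X v h)) (F : Mon K n → Fn C.base) : Prop where
  mem_polys : ∀ μ, F μ ∈ C.polys
  pull_eq : ∀ μ, C.proj.pull (F μ) = monFn (fun i => X (v i)) h μ
  coord_eq : ∀ c : {μ : Mon K n // μ ∉ D}, F c = coord C.base c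
  pd_eq_zero : ∀ (μ : Mon K n) (c : {μ : Mon K n // μ ∉ D}), μ < c.1 → pd c (F μ) = 0

/-- Well-founded induction over the monomials: coordinates for independent ones, box formulae for
the finitely many generators of `D`, and the chain rule for the remaining shifts. The induction
carries along that a dependent derivative uses only strictly smaller coordinates. -/
theorem exists_jetLift (H : Adapted x X γ v h a ξ) (C : BoxChart (jetCoord D B x X v h))
    {G : Finset (Mon K n)} (hG : ∀ μ ∈ D, μ ∈ G ∨ ∃ j, ∃ ν ∈ D, μ = Mon.shift j ν)
    (hC : ∀ μ ∈ G, C.HasFormula (monFn (fun i => X (v i)) h μ)) : ∃ F, JetLift C F := by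
  classical
  have key : ∀ μ, ∃ f : Fn C.base, f ∈ C.polys ∧
      C.proj.pull f = monFn (fun i => X (v i)) h μ ∧
      (∀ hμ : μ ∉ D, f = coord C.base ⟨μ, hμ⟩) ∧
      (∀ c : {μ : Mon K n // μ ∉ D}, μ < c.1 → pd c f = 0) ∧
      (μ ∈ D → ∀ c : {μ : Mon K n // μ ∉ D}, ¬ c.1 < μ → pd c f = 0) := by
    intro μ
    induction μ using WellFoundedLT.induction with
    | ind μ ih =>
      by_cases hμ : μ ∈ D
      · suffices hs : ∃ f : Fn C.base, f ∈ C.polys ∧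
            C.proj.pull f = monFn (fun i => X (v i)) h μ ∧
            ∀ c : {μ : Mon K n // μ ∉ D}, ¬ c.1 < μ → pd c f = 0 by
          obtain ⟨f, h1, h2, h3⟩ := hs
          exact ⟨f, h1, h2, fun hn => absurd hμ hn, fun c hc => h3 c (not_lt_of_gt hc), fun _ => h3⟩
        rcases hG μ hμ with hμG | ⟨j, ν, hν, rfl⟩
        · obtain ⟨g, h1, -, h2, h3⟩ := exists_lift H.coframe (hC μ hμG)
          refine ⟨g, dependsOn_mem_polys h1, h2 fun b => H.apply_inr μ b, fun c hc => ?_⟩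
          exact (h3 {c | c.1 < μ} fun c hc => H.apply_inl μ hμ c hc).pd_eq_zero hc
        · obtain ⟨f, hf1, hf2, -, -, hf3⟩ := ih ν (Mon.lt_shift j ν)
          choose! f' h1 h2 _ h4 _ using ih
          have hlt : ∀ c ∈ (d f).support, Mon.shift j c.1 < Mon.shift j ν := fun c hc => by
            by_contra hn
            exact Finsupp.mem_support_iff.1 hc
              (hf3 hν c fun hcν => hn (Mon.shift_lt_shift j hcν))
          -- This is $X_jf$ by the chain rule. Only coordinates $c<\nu$ occur in $f$, so every
          -- shifted index lies below `shift j ν` and its function is already constructed.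
          refine ⟨∑ c ∈ (d f).support, pd c f * f' (Mon.shift j c.1),
            C.polys.sum_mem fun c hc => C.polys.mul_mem (pd_mem_polys hf1 c) (h1 _ (hlt c hc)),
            ?_, fun c hc => ?_⟩
          · have e1 : X (v j) (d (C.proj.pull f)) = monFn (fun i => X (v i)) h (Mon.shift j ν) := by
              rw [hf2]
              exact apply_d_monFn (X := fun i => X (v i)) (H.comm.comp v) j ν
            rw [← e1, ← Mor.pullForm_d, form_eq_sum (d f), Mor.pullForm_sum, ← form_eq_sum, map_sum,
              map_sum]
            refine Finset.sum_congr rfl fun c hc => ?_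
            rw [map_mul, h2 _ (hlt c hc), Mor.pullForm_smul, map_smul, Mor.pullForm_coord,
              smul_eq_mul, d_apply]
            congr 1
            exact (apply_d_monFn (X := fun i => X (v i)) (H.comm.comp v) j c.1).symm
          · rw [← d_apply, d_sum, Finsupp.finsetSum_apply]
            have hνc : ν < c.1 := (Mon.lt_shift j ν).trans_le (not_lt.1 hc)
            refine Finset.sum_eq_zero fun c' hc' => ?_
            rw [d_mul, Finsupp.add_apply, Finsupp.smul_apply, Finsupp.smul_apply, d_apply, d_apply,
              h4 _ (hlt c' hc') c ((hlt c' hc').trans_le (not_lt.1 hc)), pd_comm,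
              hf3 hν c (not_lt_of_gt hνc), ← d_apply (0 : Fn C.base), d_zero]
            simp
      · refine ⟨coord C.base ⟨μ, hμ⟩, coord_mem_polys _, rfl, fun _ => rfl, fun c hc => ?_,
          fun h => absurd h hμ⟩
        rw [pd_coord, if_neg]
        rintro rfl
        exact lt_irrefl _ hc
  choose F h1 h2 h3 h4 _ using key
  exact ⟨F, h1, h2, fun c => h3 c.1 c.2, h4⟩

variable {C : BoxChart (jetCoord D B x X v h)} {F : Mon K n → Fn C.base}

/-- The vector fields on the base. -/
def jetField (F : Mon K n → Fn C.base) (j : Fin n) : VField C.base :=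
  vfield fun c => F (Mon.shift j c.1)

theorem jetField_coord (F : Mon K n → Fn C.base) (j : Fin n) (c : {μ : Mon K n // μ ∉ D}) :
    jetField F j (d (coord C.base c)) = F (Mon.shift j c.1) := vfield_coord _ _

namespace JetLift

variable (hF : JetLift C F) (H : Adapted x X γ v h a ξ)
include hF

theorem jetField_coord_mem (j : Fin n) (c : {μ : Mon K n // μ ∉ D}) :
    jetField F j (d (coord C.base c)) ∈ C.polys := by
  rw [jetField_coord]
  exact hF.mem_polys _

include H

theorem related (j : Fin n) : Related C.proj (X (v j)) (jetField F j) :=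
  related_of_coord fun c => by
    rw [jetField_coord, hF.pull_eq, proj_pull_coord]
    exact apply_d_monFn (X := fun i => X (v i)) (H.comm.comp v) j c.1

/-- The vector field on the base corresponding to `X j`. -/
theorem related_extend (j : J) :
    Related C.proj (X j) (Function.extend v (jetField F) 0 j) := by
  by_cases hj : j ∈ Set.range v
  · obtain ⟨i, rfl⟩ := hj
    rw [H.inj.extend_apply]
    exact hF.related H i
  · rw [Function.extend_apply' _ _ _ hj]
    refine related_of_coord fun c => ?_
    rw [proj_pull_coord]
    refine Eq.trans ?_ (map_zero C.proj.pull).symm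
    exact apply_d_monFn_eq_zero H.comm (H.apply_eq_zero j hj) c.1

theorem extend_coord_mem (j : J) (c : {μ : Mon K n // μ ∉ D}) :
    (Function.extend v (jetField F) 0 j : VField C.base) (d (coord C.base c)) ∈ C.polys := by
  by_cases hj : j ∈ Set.range v
  · obtain ⟨i, rfl⟩ := hj
    rw [H.inj.extend_apply]
    exact hF.jetField_coord_mem i c
  · rw [Function.extend_apply' _ _ _ hj]
    exact C.polys.zero_mem

theorem bracket_eq_zero (i j : Fin n) : bracket (jetField F i) (jetField F j) = 0 := by
  refine IsCommuting.of_coord (X := jetField F) (fun i j c => ?_) i j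
  -- Both second derivatives are polynomial functions, so their equality may be checked after
  -- pulling back, where the $X_j$ commute.
  have hm : ∀ i j, jetField F i (d (jetField F j (d (coord C.base c)))) ∈ C.polys := fun i j =>
    apply_d_mem_polys (hF.jetField_coord_mem i) (hF.jetField_coord_mem j c)
  refine pull_injOn H.coframe (hm i j) (hm j i) ?_
  have hp : ∀ i j, C.proj.pull (jetField F i (d (jetField F j (d (coord C.base c)))))
      = X (v i) (d (X (v j) (d (C.proj.pull (coord C.base c))))) := fun i j => by
    rw [(hF.related H j).apply_d, (hF.related H i).apply_d]
  rw [hp, hp, H.comm]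

theorem mem_kers {φ : Form C.base} (hφ : C.IsPolyForm φ) (h0 : C.proj.pullForm φ ∈ kers X) :
    φ ∈ kers (jetField F) := by
  rw [Diffiety.mem_kers]
  intro j
  refine pull_injOn H.coframe (hφ.apply_mem (hF.jetField_coord_mem j)) C.polys.zero_mem ?_
  rw [← hF.related H j, map_zero]
  exact Diffiety.mem_kers.1 h0 (v j)

theorem pullForm_mem_kers {φ : Form C.base} (hφ : φ ∈ kers (jetField F)) :
    C.proj.pullForm φ ∈ kers X := by
  rw [Diffiety.mem_kers]
  intro j
  rw [hF.related_extend H j]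
  by_cases hj : j ∈ Set.range v
  · obtain ⟨i, rfl⟩ := hj
    rw [H.inj.extend_apply, Diffiety.mem_kers.1 hφ, map_zero]
  · rw [Function.extend_apply' _ _ _ hj]
    exact map_zero _

open Classical in
/-- The dual fields on the base. -/
theorem exists_isJetSystem {b : {i // v i ∉ B} → {μ : Mon K n // μ ∉ D}}
    (hb : IsUnit (Matrix.of fun (j i : {i // v i ∉ B}) =>
      X (v j) (d (monFn (fun i => X (v i)) h (b i).1))).det)
    (hC : ∀ j i : {i // v i ∉ B},
      C.HasFormula (monFn (fun i => X (v i)) h (Mon.shift j.1 (b i).1))) :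
    ∃ Y, IsJetSystem F (jetField F) b Y ∧ ∀ i c, Y i (d (coord C.base c)) ∈ C.polys := by
  set Am : Matrix {i // v i ∉ B} {i // v i ∉ B} (Fn C.base) :=
    Matrix.of fun j i => jetField F j (d (coord C.base (b i))) with hAm
  have hdep : ∀ j i, DependsOn C.fixed (Am j i) := fun j i => by
    have e : Am j i = F (Mon.shift j.1 (b i).1) := jetField_coord F j.1 (b i)
    rw [e]
    refine dependsOn_of_hasFormula H.coframe (hF.mem_polys _) ?_ fun b => ?_
    · rw [hF.pull_eq]; exact hC j i
    · rw [hF.pull_eq]; exact H.apply_inr _ b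
  have hev : ∀ y z : C.base, (∀ c ∈ C.fixed, y.1 c = z.1 c) → Am.map (ev y) = Am.map (ev z) :=
    fun y z hyz => by
      ext j i
      exact hdep j i y z hyz
  have hpull : Am.map C.proj.pull = Matrix.of fun (j i : {i // v i ∉ B}) =>
      X (v j) (d (monFn (fun i => X (v i)) h (b i).1)) := by
    ext j i
    exact (by rw [Matrix.map_apply]; exact ((hF.related H j).apply_d (coord C.base (b i))).symm)
  -- The matrix depends on the box coordinates only, and every point of the base has the same box
  -- coordinates as the image of a point of `U`, where the determinant is invertible.
  have hu : IsUnit Am.det := isUnit_of_ne_zero fun y => by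
    obtain ⟨q, -, hq⟩ := C.exists_mem_slice y
    change ev y Am.det ≠ 0
    have h1 : ev y Am.det = ev q (Am.map C.proj.pull).det := by
      rw [RingHom.map_det]
      change (Am.map (ev y)).det = _
      rw [hev y (C.proj.toFun q) fun c hc => (hq c hc).symm]
      have := RingHom.map_det C.proj.pull Am
      change _ = (Am.map C.proj.pull).det at this
      rw [← this, ev_pull, RingHom.map_det]
      rfl
    rw [h1, hpull]
    exact (hb.map (ev q)).ne_zero
  obtain ⟨Bm, hBm, hdual, hkers⟩ := exists_dual (fun i : {i // v i ∉ B} => coord C.base (b i))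
    (fun j => jetField F j.1) hu
  -- Inversion does not preserve polynomials in the unrestricted coordinates. Dependence on the box
  -- coordinates alone is what keeps the dual fields polynomial.
  have hBdep : ∀ i j, DependsOn C.fixed (Bm i j) := fun i j y z hyz => by
    have hinv : ∀ y : C.base, Bm.map (ev y) = (Am.map (ev y))⁻¹ := fun y => by
      refine (Matrix.inv_eq_left_inv ?_).symm
      rw [← Matrix.map_mul, hBm]
      change ((Am⁻¹ * Am).map (ev y)) = 1
      rw [Matrix.nonsing_inv_mul _ hu]
      exact Matrix.map_one _ (map_zero _) (map_one _)
    have := (hinv y).trans ((congrArg _ (hev y z hyz)).trans (hinv z).symm)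
    exact congrFun (congrFun this i) j
  obtain ⟨Y, hY⟩ : ∃ Y : {i // v i ∉ B} → VField C.base, Y = fun i => ∑ j, Bm i j • jetField F j.1 :=
    ⟨_, rfl⟩
  rw [← hY] at hkers
  have hYi : ∀ i, Y i = ∑ j, Bm i j • jetField F j.1 := fun i => congrFun hY i
  have hdual' : ∀ i i', Y i (d (coord C.base (b i'))) = if i = i' then 1 else 0 := fun i i' => by
    rw [hYi]; exact hdual i i'
  have hYp : ∀ i c, Y i (d (coord C.base c)) ∈ C.polys := fun i c => by
    rw [hYi, LinearMap.sum_apply]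
    exact C.polys.sum_mem fun j _ => C.polys.mul_mem (dependsOn_mem_polys (hBdep i j))
      (hF.jetField_coord_mem j.1 c)
  have hYf : IsFrame (fun i => coord C.base (b i)) Y :=
    ⟨fun i => by rw [hdual', if_pos rfl], fun i j hij => by rw [hdual', if_neg hij],
      fun _ => Set.toFinite _⟩
  -- By construction only the fields entering `Y` kill the contact form. That the remaining ones do
  -- too is seen on `M`, by `mem_kers_of`, and returns to the base by polynomiality.
  have hE : ∀ c, contactForm b Y c ∈ kers (jetField F) := fun c => by
    have h1 : contactForm b Y c ∈ kers Y := hYf.sub_mem fun j _ => Finset.mem_univ j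
    refine hF.mem_kers H ?_ (H.mem_kers_of ?_ fun i hi => ?_)
    · exact (isPolyForm_d (coord_mem_polys c)).sub (IsPolyForm.sum fun i _ =>
        (isPolyForm_d (coord_mem_polys _)).smul (hYp i c))
    · rw [contactForm, Mor.pullForm_sub, Mor.pullForm_sum, Mor.pullForm_coord]
      refine Submodule.sub_mem _ (Submodule.subset_span ⟨c.1, rfl⟩) (Submodule.sum_mem _ fun i _ => ?_)
      rw [Mor.pullForm_smul, Mor.pullForm_coord]
      exact Submodule.smul_mem _ _ (Submodule.subset_span ⟨(b i).1, rfl⟩)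
    · have h2 : jetField F i (contactForm b Y c) = 0 :=
        Diffiety.mem_kers.1 (hkers.le h1) (⟨i, hi⟩ : {i // v i ∉ B})
      rw [hF.related H i, h2, map_zero]
  refine ⟨Y, ⟨H.shift_mem, hF.coord_eq, fun μ c hc => hF.pd_eq_zero μ c ?_, jetField_coord F,
    hF.bracket_eq_zero H, fun i => by rw [hdual', if_pos rfl],
    fun i j hij => by rw [hdual', if_neg hij], ⟨Subtype.val, Bm, hYi⟩,
    le_antisymm (fun φ hφ => ?_) ?_⟩, hYp⟩
  · by_contra hn
    exact absurd (Mon.deg_le_of_le (not_lt.1 hn)) (not_le.2 hc)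
  · rw [eq_sum_contactForm (b := b) hφ]
    exact Submodule.sum_mem _ fun c _ => Submodule.smul_mem _ _ (hE c)
  · rw [hkers]
    exact fun φ hφ => Diffiety.mem_kers.2 fun j => Diffiety.mem_kers.1 hφ j.1

/-- The iterated Lie derivatives on the base. -/
theorem exists_iterForm (ha : ∀ l r, C.HasFormula (a l r)) :
    ∃ θ : Fin L → List J → Form C.base,
      (∀ l w, C.proj.pullForm (θ l w) = iterForm X w (γ l)) ∧ (∀ l w, C.IsPolyForm (θ l w)) ∧
      ∀ l w j, lieD (jetField F j) (θ l w) = θ l (v j :: w) := by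
  choose a' ha₁ _ ha₂ _ using fun l r => exists_lift H.coframe (ha l r)
  -- Letters outside the range of `v` act on the base by the zero field, since the corresponding
  -- $X_j$ kill all derivatives of the $h^r$.
  refine ⟨fun l w => iterForm (Function.extend v (jetField F) 0) w
    (∑ r, a' l r • d (F (Mon.mk r 0))), fun l w => ?_, fun l w => ?_, fun l w j => ?_⟩
  · have hθ₀ : γ l = C.proj.pullForm (∑ r, a' l r • d (F (Mon.mk r 0))) := by
      rw [H.eq_sum, Mor.pullForm_sum]
      refine Finset.sum_congr rfl fun r _ => ?_
      rw [Mor.pullForm_smul, Mor.pullForm_d, ha₂ l r fun b => H.coeff_inr l r b, hF.pull_eq,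
        monFn_zero]
    rw [hθ₀]
    exact (Related.iterForm (hF.related_extend H) w _).symm
  · exact IsPolyForm.iterForm (IsPolyForm.sum fun r _ => (isPolyForm_d (hF.mem_polys _)).smul
      (dependsOn_mem_polys (ha₁ l r))) (hF.extend_coord_mem H) w
  · change _ = lieD (Function.extend v (jetField F) 0 (v j)) _
    rw [H.inj.extend_apply]
    rfl

open Classical in
/-- The contact forms of low degree on the base. -/
theorem contactForm_mem_span {b : {i // v i ∉ B} → {μ : Mon K n // μ ∉ D}}
    {Y : {i // v i ∉ B} → VField C.base}
    (hb : IsUnit (Matrix.of fun (j i : {i // v i ∉ B}) =>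
      X (v j) (d (monFn (fun i => X (v i)) h (b i).1))).det)
    (hY : IsJetSystem F (jetField F) b Y) (hYp : ∀ i c, Y i (d (coord C.base c)) ∈ C.polys)
    {θ : Fin L × List J → Form C.base}
    (hθ : ∀ t, C.proj.pullForm (θ t) = iterForm X t.2 (γ t.1)) (hθp : ∀ t, C.IsPolyForm (θ t))
    (c : {μ : Mon K n // μ ∉ D}) (e : {i // v i ∉ B} → Fn M) (g : Fin L × List J →₀ Fn M)
    (hg : ∀ t, C.HasFormula (g t))
    (heq : d (monFn (fun i => X (v i)) h c.1) - ∑ i, e i • d (monFn (fun i => X (v i)) h (b i).1)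
      = g.sum fun t f => f • iterForm X t.2 (γ t.1)) :
    contactForm b Y c ∈ Submodule.span (Fn C.base) (Set.range θ) := by
  have hmem : g.sum (fun t f => f • iterForm X t.2 (γ t.1)) ∈ kers X :=
    Submodule.sum_mem _ fun t _ => Submodule.smul_mem _ _
      (by rw [H.kers_eq]; exact iterForm_mem_iterSpan γ t.1 t.2)
  have hpull : C.proj.pullForm (contactForm b Y c) = d (monFn (fun i => X (v i)) h c.1)
      - ∑ i, C.proj.pull (Y i (d (coord C.base c))) • d (monFn (fun i => X (v i)) h (b i).1) := by
    rw [contactForm, Mor.pullForm_sub, Mor.pullForm_sum, Mor.pullForm_coord]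
    simp only [Mor.pullForm_smul, Mor.pullForm_coord]
    rfl
  -- The coefficients on `M` are determined by annihilation under the $X_{v_j}$, so they must be the
  -- pullbacks of those in the contact form on the base.
  have he : e = fun i => C.proj.pull (Y i (d (coord C.base c))) := by
    refine coeff_unique (Z := fun j : {i // v i ∉ B} => X (v j))
      (k := fun i => monFn (fun i => X (v i)) h (b i).1) hb
      (φ := d (monFn (fun i => X (v i)) h c.1)) (fun j => ?_) fun j => ?_
    · rw [heq]; exact Diffiety.mem_kers.1 hmem (v j)
    · rw [← hpull]
      exact Diffiety.mem_kers.1 (hF.pullForm_mem_kers H (hY.contactForm_mem c)) (v j)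
  rw [he, ← hpull] at heq
  have hp : C.IsPolyForm (contactForm b Y c) :=
    (isPolyForm_d (coord_mem_polys c)).sub (IsPolyForm.sum fun i _ =>
      (isPolyForm_d (coord_mem_polys _)).smul (hYp i c))
  refine mem_span_of_slice H.coframe hp hθp g hg ?_
  simp only [hθ]
  exact heq

open Classical in
/-- The diffiety on the base. -/
theorem exists_diffiety {b : {i // v i ∉ B} → {μ : Mon K n // μ ∉ D}}
    (hb : IsUnit (Matrix.of fun (j i : {i // v i ∉ B}) =>
      X (v j) (d (monFn (fun i => X (v i)) h (b i).1))).det)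
    (hC : ∀ j i : {i // v i ∉ B},
      C.HasFormula (monFn (fun i => X (v i)) h (Mon.shift j.1 (b i).1)))
    (ha : ∀ l r, C.HasFormula (a l r)) {l₀ : ℕ} (hl₀ : ∀ i, Mon.deg (b i).1 + 1 ≤ l₀)
    (hE : ∀ c : {μ : Mon K n // μ ∉ D}, Mon.deg c.1 ≤ l₀ →
      ∃ (e : {i // v i ∉ B} → Fn M) (g : Fin L × List J →₀ Fn M), (∀ t, C.HasFormula (g t)) ∧
        d (monFn (fun i => X (v i)) h c.1) - ∑ i, e i • d (monFn (fun i => X (v i)) h (b i).1)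
          = g.sum fun t f => f • iterForm X t.2 (γ t.1)) :
    ∃ Θ : Submodule (Fn C.base) (Form C.base), IsDiffiety Θ ∧ kers X = C.proj.extend Θ ∧
      ∃ θ : Fin L → List J → Form C.base,
        (∀ l w, C.proj.pullForm (θ l w) = iterForm X w (γ l)) ∧
        Θ = Submodule.span (Fn C.base) {φ | ∃ l w, φ = θ l w} := by
  obtain ⟨Y, hY, hYp⟩ := hF.exists_isJetSystem H hb hC
  obtain ⟨θ, hθ, hθp, hstep⟩ := hF.exists_iterForm H ha
  have hθk : ∀ l w, θ l w ∈ kers (jetField F) := fun l w => hF.mem_kers H (hθp l w) (by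
    rw [hθ, H.kers_eq]; exact iterForm_mem_iterSpan γ l w)
  refine ⟨kers (jetField F), hY.isDiffiety, le_antisymm ?_ (Submodule.span_le.2 ?_), θ, hθ,
    le_antisymm (hY.kers_le hl₀ (fun j φ hφ => ?_) (Submodule.span_le.2 ?_))
      (Submodule.span_le.2 ?_)⟩
  · rw [H.kers_eq, iterSpan, Submodule.span_le]
    rintro _ ⟨l, w, rfl⟩
    rw [← hθ]
    exact Mor.pullForm_mem_extend _ (hθk l w)
  · rintro _ ⟨φ, hφ, rfl⟩
    exact hF.pullForm_mem_kers H hφ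
  · refine lieD_mem_span Submodule.subset_span ?_ hφ
    rintro _ ⟨l, w, rfl⟩
    exact Submodule.subset_span ⟨l, v j :: w, hstep l w j⟩
  · rintro _ ⟨c, hc, rfl⟩
    obtain ⟨e, g, hg, heq⟩ := hE c hc
    refine Submodule.span_mono ?_ (hF.contactForm_mem_span H hb hY hYp
      (θ := fun t => θ t.1 t.2) (fun t => hθ t.1 t.2) (fun t => hθp t.1 t.2) c e g hg heq)
    rintro _ ⟨t, rfl⟩
    exact ⟨t.1, t.2, rfl⟩
  · rintro _ ⟨l, w, rfl⟩
    exact hθk l w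

end JetLift

end Lift

/-! ### The local structure of flat submodules generated by a finite family -/

theorem IsCoframe.exists_boxChart {A B : Type*} {c : A ⊕ B → Fn M} {ξ : A ⊕ B → VField M}
    (h : IsCoframe c ξ) (S : Finset (Fn M)) (p : M) :
    ∃ (U : Opens (ι → ℝ)) (hU : U ≤ M), p.1 ∈ U ∧ ∀ c' : A ⊕ B → Fn U,
      (∀ a, c' a = Diffiety.res hU (c a)) → ∃ C : BoxChart c', ∀ f ∈ S, C.HasFormula (Diffiety.res hU f) := by
  obtain ⟨T, ε, U, hU, -, hε, hp, hmem, hsurj, hS⟩ := h.exists_box ∅ S p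
  refine ⟨U, hU, hp, fun c' hc' => ?_⟩
  obtain rfl : c' = fun a => Diffiety.res hU (c a) := funext hc'
  exact ⟨⟨T, fun a => (c a).1 p, ε, hε, hmem, hsurj⟩, hS⟩

theorem iterForm_resForm {J : Type*} {U : Opens (ι → ℝ)} (h : U ≤ M) (X : J → VField M) (w : List J)
    (φ : Form M) : iterForm (fun j => resV h (X j)) w (resForm h φ) = resForm h (iterForm X w φ) :=
  Related.iterForm (fun j => related_resV h (X j)) w φ

/-! ### The projection onto the base of a box -/

section Core

variable {J : Type*} {L K n : ℕ} {D : Set (Mon K n)} {B : Set J}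
  {x : J → Fn M} {X : J → VField M} {γ : Fin L → Form M} {v : Fin n → J}
  {h : Fin K → Fn M} {a : Fin L → Fin K → Fn M} {ξ : {μ : Mon K n // μ ∉ D} ⊕ B → VField M}

open Classical in
theorem Adapted.exists_boxChart (H : Adapted x X γ v h a ξ) (p : M)
    (b : {i // v i ∉ B} → {μ : Mon K n // μ ∉ D})
    (hb : IsUnit (Matrix.of fun (j i : {i // v i ∉ B}) =>
      X (v j) (d (monFn (fun i => X (v i)) h (b i).1))).det) :
    ∃ (U : Opens (ι → ℝ)) (hU : U ≤ M), p.1 ∈ U ∧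
    ∃ C : BoxChart (jetCoord D B (fun j => Diffiety.res hU (x j)) (fun j => resV hU (X j)) v
        (fun r => Diffiety.res hU (h r))),
      (∀ μ, ∃ f, C.proj.pull f = Diffiety.res hU (monFn (fun i => X (v i)) h μ)) ∧
      ∃ Θ : Submodule (Fn C.base) (Form C.base), IsDiffiety Θ ∧
        (incl hU).extend (kers X) = C.proj.extend Θ ∧
        ∃ θ : Fin L → List J → Form C.base,
          (∀ l w, C.proj.pullForm (θ l w) = resForm hU (iterForm X w (γ l))) ∧
          Θ = Submodule.span (Fn C.base) {φ | ∃ l w, φ = θ l w} := by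
  let l₀ := Finset.univ.sup (fun i => Mon.deg (b i).1) + 1
  have hl₀ : ∀ i, Mon.deg (b i).1 + 1 ≤ l₀ := fun i => Nat.succ_le_succ
    (Finset.le_sup (f := fun i => Mon.deg (b i).1) (Finset.mem_univ i))
  obtain ⟨G, -, hG⟩ := Mon.exists_generators H.shift_mem
  have hE : ∀ c : {μ : Mon K n // μ ∉ D},
      ∃ (e : {i // v i ∉ B} → Fn M) (g : Fin L × List J →₀ Fn M),
        d (monFn (fun i => X (v i)) h c.1) - ∑ i, e i • d (monFn (fun i => X (v i)) h (b i).1)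
          = g.sum fun t f => f • iterForm X t.2 (γ t.1) := fun c => by
    obtain ⟨e, he⟩ := H.exists_coeff b hb c.1
    have hset : {φ | ∃ l w, φ = iterForm X w (γ l)}
        = Set.range fun t : Fin L × List J => iterForm X t.2 (γ t.1) := by
      ext φ
      exact ⟨fun ⟨l, w, hφ⟩ => ⟨(l, w), hφ.symm⟩, fun ⟨t, ht⟩ => ⟨t.1, t.2, ht.symm⟩⟩
    rw [H.kers_eq, iterSpan, hset, Finsupp.mem_span_range_iff_exists_finsupp] at he
    obtain ⟨g, hg⟩ := he
    exact ⟨e, g, hg.symm⟩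
  choose e g hg using hE
  have hfin : {c : {μ : Mon K n // μ ∉ D} | Mon.deg c.1 ≤ l₀}.Finite :=
    Set.Finite.preimage Subtype.val_injective.injOn (Mon.finite_deg_le l₀)
  -- The finitely many functions that need box formulae: the generating dependent derivatives, the
  -- entries of the matrix, the coefficients of $\gamma$, and the coefficients expressing the
  -- contact forms of degree at most $l_0$ through the $\mathcal L_w\gamma^k$. Zero accounts for
  -- indices outside the supports.
  let S : Finset (Fn M) := insert 0 (G.image (monFn (fun i => X (v i)) h)
    ∪ (Finset.univ.image fun t : {i // v i ∉ B} × {i // v i ∉ B} =>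
        monFn (fun i => X (v i)) h (Mon.shift t.1.1 (b t.2).1))
    ∪ (Finset.univ.image fun t : Fin L × Fin K => a t.1 t.2)
    ∪ hfin.toFinset.biUnion fun c => (g c).support.image (g c))
  obtain ⟨U, hU, hp, hC⟩ := H.coframe.exists_boxChart S p
  refine ⟨U, hU, hp, ?_⟩
  have H' := H.res hU
  obtain ⟨C, hC⟩ := hC (jetCoord D B (fun j => Diffiety.res hU (x j)) (fun j => resV hU (X j)) v
        (fun r => Diffiety.res hU (h r))) (by
    rintro (c | c)
    exacts [res_monFn (X := fun i => X (v i)) hU c.1, rfl])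
  have hmon : ∀ μ, monFn (fun i => resV hU (X (v i))) (fun r => Diffiety.res hU (h r)) μ
      = Diffiety.res hU (monFn (fun i => X (v i)) h μ) :=
    res_monFn (X := fun i => X (v i)) hU
  have hb' : IsUnit (Matrix.of fun (j i : {i // v i ∉ B}) => resV hU (X (v j))
      (d (monFn (fun i => resV hU (X (v i))) (fun r => Diffiety.res hU (h r)) (b i).1))).det := by
    have := hb.map (Diffiety.res hU)
    rw [RingHom.map_det] at this
    convert this using 3
    ext j i
    simp only [Matrix.of_apply, hmon, resV_d]
    rfl
  refine ⟨C, ?_⟩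
  obtain ⟨F, hF⟩ := exists_jetLift H' C hG fun μ hμ => by
    rw [hmon]
    exact hC _ (Finset.mem_insert_of_mem (Finset.mem_union_left _ (Finset.mem_union_left _
      (Finset.mem_union_left _ (Finset.mem_image_of_mem _ hμ)))))
  refine ⟨fun μ => ⟨F μ, (hF.pull_eq μ).trans (hmon μ)⟩, ?_⟩
  have hiter := fun l w => iterForm_resForm hU X w (γ l)
  rw [← H.frame.kers_res]
  simp only [← hiter]
  refine hF.exists_diffiety H' hb' (fun j i => ?_) (fun l r => ?_) hl₀ fun c hc => ?_
  · rw [hmon]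
    refine hC _ (Finset.mem_insert_of_mem (Finset.mem_union_left _ (Finset.mem_union_left _
      (Finset.mem_union_right _ (Finset.mem_image.2 ⟨(j, i), Finset.mem_univ _, rfl⟩)))))
  · refine hC _ (Finset.mem_insert_of_mem (Finset.mem_union_left _
      (Finset.mem_union_right _ (Finset.mem_image.2 ⟨(l, r), Finset.mem_univ _, rfl⟩))))
  · refine ⟨fun i => Diffiety.res hU (e c i),
      (g c).mapRange (Diffiety.res hU) (map_zero _), fun t => ?_, ?_⟩
    · rw [Finsupp.mapRange_apply]
      refine hC _ ?_
      by_cases ht : g c t = 0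
      · rw [ht]; exact Finset.mem_insert_self _ _
      · exact Finset.mem_insert_of_mem (Finset.mem_union_right _ (Finset.mem_biUnion.2
          ⟨c, hfin.mem_toFinset.2 hc, Finset.mem_image.2 ⟨t, Finsupp.mem_support_iff.2 ht, rfl⟩⟩))
    · have h1 := congrArg (resForm hU) (hg c)
      refine Eq.trans ?_ (Finsupp.sum_mapRange_index fun t => by exact zero_smul _ _).symm
      simp only [hmon, hiter]
      simpa only [resForm, Mor.pullForm_sub, Mor.pullForm_sum, Mor.pullForm_smul, Mor.pullForm_d,
        Finsupp.sum] using h1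

/-- The functions of the second kind complete the pulled-back coordinates. Being countably many,
they are reindexed by a subset of $\mathbb N$ to provide the index type demanded of a projection. -/
theorem BoxChart.isProjection {A B : Type*} [Countable B] {c : A ⊕ B → Fn M}
    {ξ : A ⊕ B → VField M} (h : IsCoframe c ξ) (C : BoxChart c) : C.proj.IsProjection := by
  obtain ⟨f, hf⟩ := Countable.exists_injective_nat B
  let e : B ≃ Set.range f := Equiv.ofInjective f hf
  refine ⟨Set.range f, fun j => c (Sum.inr (e.symm j)), ?_⟩
  let E : A ⊕ Set.range f ≃ A ⊕ B := Equiv.sumCongr (Equiv.refl A) e.symm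
  have hE : IsCoframe (fun t => c (E t)) (fun t => ξ (E t)) := by
    refine ⟨⟨fun t => h.isFrame.dual_same _, fun s t hst => h.isFrame.dual_ne _ _
      fun he => hst (E.injective he), fun i => ?_⟩, ?_⟩
    · exact (h.isFrame.finite_coord i).preimage E.injective.injOn
    · rw [eq_bot_iff, ← h.kers_eq]
      intro φ hφ
      rw [mem_kers] at hφ ⊢
      intro t
      rw [← E.apply_symm_apply t]
      exact hφ _
  have := hE.isCoordinates
  convert this using 1
  funext t
  rcases t with t | t <;> rfl

theorem IsFrame.countable [Countable ι] [Nontrivial (Fn M)] (hx : IsFrame x X) : Countable J := by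
  have : (Set.univ : Set J) = ⋃ i, {j | X j (d (coord M i)) ≠ 0} := by
    refine (Set.eq_univ_of_forall fun j => ?_).symm
    by_contra hn
    simp only [Set.mem_iUnion, not_exists, Set.mem_ofPred_eq, not_not] at hn
    have h0 : X j = 0 := vfield_ext hn
    have h1 := hx.dual_same j
    rw [h0] at h1
    exact zero_ne_one h1
  rw [← Set.countable_univ_iff, this]
  exact Set.countable_iUnion fun i => (hx.finite_coord i).countable

/-- The common core of both statements: any commuting frame whose kernel is generated by the
iterated Lie derivatives of finitely many forms descends to a box. No diffiety containing the kernel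
is needed. -/
theorem exists_projection [Countable ι] (hM : (M : Set (ι → ℝ)).Nonempty) (hx : IsFrame x X)
    (hX : IsCommuting X) (hR : kers X = iterSpan X γ) {s : Finset ι}
    (hs : ∀ l, ExpressedIn s (γ l)) :
    ∃ (U : Opens (ι → ℝ)) (hU : U ≤ M), (U : Set (ι → ℝ)).Nonempty ∧
      ∃ (κ : Type) (_ : Countable κ) (N : Opens (κ → ℝ)) (m : Mor U N)
        (Θ : Submodule (Fn N) (Form N)),
        m.IsProjection ∧ IsDiffiety Θ ∧ (incl hU).extend (kers X) = m.extend Θ ∧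
        (∀ a : κ, ∃ r ∈ s, ∃ w : List J,
          m.pull (coord N a) = (incl hU).pull (iterFn X w (coord M r))) ∧
        (∀ r ∈ s, ∀ w : List J, ∃ f : Fn N,
          m.pull f = (incl hU).pull (iterFn X w (coord M r))) ∧
        ∃ θ : Fin L → List J → Form N,
          (∀ k w, m.pullForm (θ k w) = (incl hU).pullForm (iterForm X w (γ k))) ∧
          Θ = Submodule.span (Fn N) {φ | ∃ k w, φ = θ k w} := by
  classical
  have : Nonempty M := hM.to_subtype
  have : Countable J := hx.countable
  let e := s.equivFin
  let h : Fin s.card → Fn M := fun r => coord M (e.symm r).1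
  -- These finitely many fields are the variables of the monomials; all other fields kill each $h^r$
  -- with $r\in s$, hence by commutation all its derivatives.
  have hJ : (⋃ i ∈ s, {j | X j (d (coord M i)) ≠ 0}).Finite :=
    Set.Finite.biUnion s.finite_toSet fun i _ => hx.finite_coord i
  let v : Fin hJ.toFinset.card → J := fun i => (hJ.toFinset.equivFin.symm i).1
  have hvi : Function.Injective v := Subtype.val_injective.comp (Equiv.injective _)
  have hv : ∀ j ∉ Set.range v, ∀ r, X j (d (h r)) = 0 := fun j hj r => by
    by_contra hn
    refine hj ⟨hJ.toFinset.equivFin ⟨j, hJ.mem_toFinset.2 ?_⟩, ?_⟩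
    · exact Set.mem_biUnion (e.symm r).2 hn
    · simp only [v, Equiv.symm_apply_apply]
  have hsum : ∀ φ : Form M, (∀ i, i ∉ s → φ i = 0) →
      φ = ∑ r, φ (e.symm r).1 • d (h r) := fun φ hφ => by
    rw [Equiv.sum_comp e.symm fun i : s => φ i.1 • d (coord M i.1),
      Finset.sum_coe_sort s fun i => φ i • d (coord M i)]
    conv_lhs => rw [form_eq_sum φ]
    refine Finset.sum_subset (fun i hi => ?_) fun i _ hi => ?_
    · by_contra hn
      exact Finsupp.mem_support_iff.1 hi (hφ i hn)
    · rw [Finsupp.notMem_support_iff.1 hi, zero_smul]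
  obtain ⟨U₁, hU₁, ⟨p₁, hp₁⟩, D, B, ξ, H₁⟩ := exists_adapted (h := h)
    (a := fun l r => γ l (e.symm r).1) hx hX hR hvi hv (fun l => hsum _ (hs l).2) (fun l r => by
      rw [hsum (d (γ l (e.symm r).1)) fun i hi =>
        Subtype.ext (((hs l).1 (e.symm r).1).partialFun_eq_zero hi)]
      exact Submodule.sum_mem _ fun r _ => Submodule.smul_mem _ _ (Submodule.subset_span ⟨r, rfl⟩))
    hM
  obtain ⟨b, hb⟩ := H₁.exists_det_ne_zero ⟨p₁, hp₁⟩
  obtain ⟨U₂, hU₂, hp₂, hu⟩ := exists_isUnit_res hb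
  have H₂ := H₁.res hU₂
  obtain ⟨U, hU, hp, C, hC, Θ, hΘ, hext, θ, hθ, hspan⟩ := H₂.exists_boxChart ⟨p₁, hp₂⟩ b (by
    rw [RingHom.map_det] at hu
    convert hu using 3
    ext j i
    simp only [Matrix.of_apply, res_monFn (X := fun i => resV hU₁ (X (v i))), resV_d]
    rfl)
  have hmon : ∀ μ, res hU (monFn (fun i => resV hU₂ (resV hU₁ (X (v i))))
      (fun r => res hU₂ (res hU₁ (h r))) μ)
      = res (hU.trans (hU₂.trans hU₁)) (monFn (fun i => X (v i)) h μ) := fun μ => by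
    rw [res_monFn (X := fun i => resV hU₁ (X (v i))), res_monFn (X := fun i => X (v i))]
    rfl
  have hword : ∀ (w : List (Fin hJ.toFinset.card)) f,
      iterFn (fun i => X (v i)) w f = iterFn X (w.map v) f := fun w f => by
    induction w with
    | nil => rfl
    | cons i w ih => exact congrArg (fun g => X (v i) (d g)) ih
  refine ⟨U, hU.trans (hU₂.trans hU₁), ⟨_, hp⟩, {μ : Mon _ _ // μ ∉ D}, inferInstance, C.base,
    C.proj, Θ, C.isProjection (H₂.res hU).coframe, hΘ, ?_, fun c => ?_, fun r hr w => ?_, θ,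
    fun l w => ?_, hspan⟩
  · rw [← hext, (hx.res hU₁).kers_res, hx.kers_res, extend_extend, extend_extend]
  · refine ⟨(e.symm c.1.1).1, (e.symm c.1.1).2, (Finsupp.toMultiset c.1.2).toList.map v, ?_⟩
    rw [← hword]
    exact (res_monFn (X := fun i => resV hU₂ (resV hU₁ (X (v i)))) hU c.1).trans (hmon c.1)
  · have hr' : h (e ⟨r, hr⟩) = coord M r := by simp only [h, Equiv.symm_apply_apply]
    by_cases hw : ∀ j ∈ w, j ∈ Set.range v
    · obtain ⟨w, rfl⟩ : ∃ w' : List (Fin _), w'.map v = w := by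
        have : w ∈ Set.range (List.map v) := by rw [Set.range_list_map]; exact hw
        exact this
      obtain ⟨f, hf⟩ := hC (Mon.mk (e ⟨r, hr⟩) (Multiset.toFinsupp w))
      refine ⟨f, ?_⟩
      rw [← hword, ← hr', iterFn_eq_monFn (X := fun i => X (v i)) (hX.comp v), hf, hmon]
    · refine ⟨0, ?_⟩
      push Not at hw
      obtain ⟨j, hjw, hj⟩ := hw
      -- A letter outside the range of `v` can be moved next to $h^r$ by commutation, and there it
      -- gives zero.
      have h0 : iterFn X w (coord M r) = 0 := by
        rw [iterFn_perm hX ((List.perm_cons_erase hjw).trans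
          (List.perm_append_comm (l₁ := [j]) (l₂ := w.erase j)))]
        have h1 : ∀ w', iterFn X (w' ++ [j]) (coord M r) = 0 := fun w' => by
          induction w' with
          | nil => rw [← hr']; exact hv j hj _
          | cons i w' ih =>
            change X i (d (iterFn X (w' ++ [j]) (coord M r))) = 0
            rw [ih, d_zero, map_zero]
        exact h1 _
      rw [h0, map_zero, map_zero]
  · rw [hθ]
    rw [iterForm_resForm hU₂ (fun j => resV hU₁ (X j)), iterForm_resForm hU₁, resForm_resForm,
      resForm_resForm]

end Core

/-! ### Restriction to smaller open sets -/

theorem CylSmooth.res {U : Opens (ι → ℝ)} (hU : U ≤ M) {s : Finset ι} {f : Fn M}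
    (hf : CylSmooth s f.1) : CylSmooth s (res hU f).1 := fun p => by
  obtain ⟨G, hG, he⟩ := hf (Set.inclusion hU p)
  exact ⟨G, hG, ((continuous_inclusion hU).tendsto p).eventually he⟩

theorem ExpressedIn.res {U : Opens (ι → ℝ)} (hU : U ≤ M) {s : Finset ι} {φ : Form M}
    (hφ : ExpressedIn s φ) : ExpressedIn s (resForm hU φ) :=
  ⟨fun i => by rw [resForm_apply]; exact CylSmooth.res hU (hφ.1 i),
    fun i hi => by rw [resForm_apply, hφ.2 i hi, map_zero]⟩

theorem exists_expressedIn {L : Type*} [Finite L] (γ : L → Form M) :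
    ∃ s : Finset ι, ∀ l, ExpressedIn s (γ l) := by
  classical
  have := Fintype.ofFinite L
  have h1 : ∀ φ : Form M, ∃ s : Finset ι, ExpressedIn s φ := fun φ => by
    obtain ⟨s, hs, hc⟩ := exists_cylSmooth_finset φ.support fun i : φ.support => φ i
    refine ⟨s, fun i => ?_, fun i hi => Finsupp.notMem_support_iff.1 fun h => hi (hs h)⟩
    by_cases hi : i ∈ φ.support
    · exact hc ⟨i, hi⟩
    · rw [Finsupp.notMem_support_iff.1 hi]
      exact (CylSmooth.const 0).mono (Finset.empty_subset s)
  choose s hs using fun l => h1 (γ l)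
  refine ⟨Finset.univ.biUnion s, fun l => ?_⟩
  have hl : s l ⊆ Finset.univ.biUnion s := Finset.subset_biUnion_of_mem s (Finset.mem_univ l)
  exact ⟨fun i => ((hs l).1 i).mono hl, fun i hi => (hs l).2 i fun h => hi (hl h)⟩

theorem iterFn_res {J : Type*} {U : Opens (ι → ℝ)} (h : U ≤ M) (X : J → VField M) (w : List J)
    (f : Fn M) : iterFn (fun j => resV h (X j)) w (res h f) = res h (iterFn X w f) :=
  Related.iterFn (fun j => related_resV h (X j)) w f

/-- The local structure inside an open subset. -/
theorem exists_projection_of_le [Countable ι] {J : Type*} {L : ℕ} {x : J → Fn M}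
    {X : J → VField M} {γ : Fin L → Form M} (hx : IsFrame x X)
    (hX : IsCommuting X) (hR : kers X = iterSpan X γ) {s : Finset ι}
    (hs : ∀ l, ExpressedIn s (γ l)) {V : Opens (ι → ℝ)} (hV : V ≤ M)
    (hne : (V : Set (ι → ℝ)).Nonempty) :
    ∃ (U : Opens (ι → ℝ)) (hU : U ≤ M), U ≤ V ∧ (U : Set (ι → ℝ)).Nonempty ∧
      ∃ (κ : Type) (_ : Countable κ) (N : Opens (κ → ℝ)) (m : Mor U N)
        (Θ : Submodule (Fn N) (Form N)),
        m.IsProjection ∧ IsDiffiety Θ ∧ (incl hU).extend (kers X) = m.extend Θ ∧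
        (∀ a : κ, ∃ r ∈ s, ∃ w : List J,
          m.pull (coord N a) = (incl hU).pull (iterFn X w (coord M r))) ∧
        (∀ r ∈ s, ∀ w : List J, ∃ f : Fn N,
          m.pull f = (incl hU).pull (iterFn X w (coord M r))) ∧
        ∃ θ : Fin L → List J → Form N,
          (∀ k w, m.pullForm (θ k w) = (incl hU).pullForm (iterForm X w (γ k))) ∧
          Θ = Submodule.span (Fn N) {φ | ∃ k w, φ = θ k w} := by
  obtain ⟨U, hU, hUne, κ, hκ, N, m, Θ, h1, h2, h3, h4, h5, θ, h6, h7⟩ :=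
    exists_projection hne (hx.res hV) (hX.res hV) (γ := fun l => resForm hV (γ l))
      (by rw [hx.kers_res, hR, iterSpan_res]) fun l => (hs l).res hV
  have hfn : ∀ w r, (incl hU).pull (iterFn (fun j => resV hV (X j)) w (coord V r))
      = (incl (hU.trans hV)).pull (iterFn X w (coord M r)) := fun w r =>
    congrArg (res hU) (iterFn_res hV X w (coord M r))
  refine ⟨U, hU.trans hV, hU, hUne, κ, hκ, N, m, Θ, h1, h2, ?_, ?_, ?_, θ, ?_, h7⟩
  · rw [← h3, hx.kers_res, extend_extend]
  · simpa only [hfn] using h4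
  · simpa only [hfn] using h5
  · intro k w
    rw [h6, iterForm_resForm hV]
    exact resForm_resForm hU hV _

/-! ### Good filtrations generated by a submodule -/

theorem lieTower_le {H : Submodule (Fn M) (VField M)} {Γ P : Submodule (Fn M) (Form M)}
    (hΓ : Γ ≤ P) (hP : lieMod H P ≤ P) (l : ℕ) : lieTower H Γ l ≤ P := by
  refine iSup₂_le fun k hk => ?_
  clear hk
  induction k with
  | zero => exact hΓ
  | succ k ih =>
    rw [Function.iterate_succ_apply']
    refine le_trans (Submodule.span_mono ?_) hP
    rintro _ ⟨Z, hZ, φ, hφ, rfl⟩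
    exact ⟨Z, hZ, φ, ih hφ, rfl⟩

theorem IsFlat.lieD_mem {R : Submodule (Fn M) (Form M)} (hR : IsFlat R) {Z : VField M}
    (hZ : Z ∈ orth R) {φ : Form M} (hφ : φ ∈ R) : lieD Z φ ∈ R :=
  hR (Submodule.subset_span ⟨Z, hZ, φ, hφ, rfl⟩)

/-- Flatness keeps the iterated Lie derivatives inside `R`. Conversely their span is stable under
all of $\mathcal H(R)$, since on the kernel Lie derivatives reduce to the frame fields; so it
contains the whole tower over `Γ`. -/
theorem IsFrame.kers_eq_iterSpan {J : Type*} {L : ℕ} {x : J → Fn M} {X : J → VField M}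
    {γ : Fin L → Form M} (hx : IsFrame x X) {R Γ : Submodule (Fn M) (Form M)} (hk : kers X = R)
    (hflat : IsFlat R) (hg : IsGoodFiltration R (lieTower (orth R) Γ))
    (hγ : Submodule.span (Fn M) (Set.range γ) = Γ) : kers X = iterSpan X γ := by
  have hΓ : Γ ≤ R := fun φ hφ => (hg.exhaust φ).2 ⟨0, by
    have : Γ ≤ lieTower (orth R) Γ 0 := le_iSup₂_of_le 0 (by simp) le_rfl
    exact this hφ⟩
  have hle : iterSpan X γ ≤ kers X := iterSpan_le (fun j φ hφ => by
    subst hk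
    exact hflat.lieD_mem (mem_orth_kers X j) hφ) fun l => by
      rw [hk]
      exact hΓ (hγ ▸ Submodule.subset_span ⟨l, rfl⟩)
  refine le_antisymm (fun φ hφ => ?_) hle
  rw [hk, hg.exhaust] at hφ
  obtain ⟨l, hl⟩ := hφ
  refine lieTower_le ?_ (Submodule.span_le.2 ?_) l hl
  · rw [← hγ, Submodule.span_le]
    rintro _ ⟨l, rfl⟩
    exact iterForm_mem_iterSpan γ l []
  · rintro _ ⟨Z, hZ, φ, hφ, rfl⟩
    exact hx.lieD_mem (hk ▸ hZ) (hle hφ) fun j => lieD_mem_iterSpan j hφ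

/-! ### Cutoff -/

/-- A cutoff function with support in a given open set. -/
theorem exists_cutoff {U : Opens (ι → ℝ)} (hU : U ≤ M) (q : U) :
    ∃ χ : Fn M, χ.1 (Set.inclusion hU q) = 1 ∧ ∀ p : M, p.1 ∉ U → ∀ᶠ p' in 𝓝 p, χ.1 p' = 0 := by
  classical
  obtain ⟨T, u, hu, hTU⟩ := isOpen_pi_iff.1 U.isOpen q.1 q.2
  have hc : Continuous (fun p : M => T.restrict (π := fun _ => ℝ) p.1) := by fun_prop
  let O : Set (T → ℝ) := {v | ∀ i : T, v i ∈ u i}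
  have hO : O ∈ 𝓝 (T.restrict (π := fun _ => ℝ) q.1) := by
    have : O = ⋂ i : T, {v | v i ∈ u i} := by ext; simp [O]
    rw [this]
    refine (isOpen_iInter_of_finite fun i => ?_).mem_nhds ?_
    · exact (hu i.1 i.2).1.preimage (continuous_apply i)
    · exact Set.mem_iInter.2 fun i => (hu i.1 i.2).2
  obtain ⟨ε, hε, hball⟩ := Metric.mem_nhds_iff.1 hO
  let f : ContDiffBump (T.restrict (π := fun _ => ℝ) q.1) := ⟨ε / 3, ε / 2, by positivity, by linarith⟩
  refine ⟨⟨fun p => f (T.restrict p.1), T, fun p => ⟨f, f.contDiff.contDiffAt,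
    Eventually.of_forall fun _ => rfl⟩⟩, ?_, fun p hp => ?_⟩
  · exact f.one_of_mem_closedBall (Metric.mem_closedBall_self f.rIn_pos.le)
  · have h1 : ε ≤ dist (T.restrict (π := fun _ => ℝ) p.1) (T.restrict (π := fun _ => ℝ) q.1) := by
      by_contra hn
      refine hp (hTU fun i hi => ?_)
      exact hball (Metric.mem_ball.2 (not_le.1 hn)) ⟨i, hi⟩
    have h2 : ∀ᶠ p' : M in 𝓝 p, ε / 2 < dist (T.restrict (π := fun _ => ℝ) p'.1)
        (T.restrict (π := fun _ => ℝ) q.1) :=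
      (hc.dist continuous_const).tendsto p |>.eventually (lt_mem_nhds (by linarith))
    filter_upwards [h2] with p' hp'
    exact f.zero_of_le_dist hp'.le

/-- The extension by zero is smooth because `χ` vanishes in a neighbourhood of every point outside
`U`. -/
theorem exists_extend_mul {U : Opens (ι → ℝ)} (hU : U ≤ M) {χ : Fn M}
    (hχ : ∀ p : M, p.1 ∉ U → ∀ᶠ p' in 𝓝 p, χ.1 p' = 0) (f : Fn U) :
    ∃ F : Fn M, res hU F = res hU χ * f ∧ ∀ p : M, p.1 ∉ U → F.1 p = 0 := by
  classical
  obtain ⟨s, hs⟩ := χ.2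
  obtain ⟨t, ht⟩ := f.2
  let g : M → ℝ := fun p => if h : p.1 ∈ U then χ.1 p * f.1 ⟨p.1, h⟩ else 0
  have hg : CylSmooth (s ∪ t) g := fun p => by
    by_cases hp : p.1 ∈ U
    · obtain ⟨G, hG, he⟩ := ((CylSmooth.res hU (f := χ) hs).mono
        (Finset.subset_union_left (s₂ := t))).comp₂ (ht.mono (Finset.subset_union_right (s₁ := s)))
        (fun a b => a * b) (contDiff_fst.mul contDiff_snd) ⟨p.1, hp⟩
      refine ⟨G, hG, ?_⟩
      have hemb : IsOpenEmbedding (Set.inclusion hU : U → M) :=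
        .of_comp _ M.isOpen.isOpenEmbedding_subtypeVal U.isOpen.isOpenEmbedding_subtypeVal
      have hnhds := hemb.map_nhds_eq ⟨p.1, hp⟩
      have hpe : Set.inclusion hU ⟨p.1, hp⟩ = p := rfl
      rw [hpe] at hnhds
      rw [← hnhds, eventually_map]
      filter_upwards [he] with q hq
      have hqU : (Set.inclusion hU q).1 ∈ U := q.2
      simp only [g, dif_pos hqU]
      exact hq
    · refine ⟨fun _ => 0, contDiffAt_const, ?_⟩
      filter_upwards [hχ p hp] with p' hp'
      simp only [g, hp', zero_mul]
      split_ifs <;> rfl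
  refine ⟨⟨g, s ∪ t, hg⟩, Fn.ext fun q => ?_, fun p hp => dif_neg hp⟩
  exact dif_pos (q.2 : (Set.inclusion hU q).1 ∈ U)

/-- Flatness is preserved on smaller open sets for vector fields with given common kernel. -/
theorem IsFlat.lieD_mem_extend {R : Submodule (Fn M) (Form M)} (hR : IsFlat R)
    {U : Opens (ι → ℝ)} (hU : U ≤ M) {J : Type*} {X : J → VField U}
    (hk : kers X = (incl hU).extend R) (j : J) {φ : Form U} (hφ : φ ∈ kers X) :
    lieD (X j) φ ∈ kers X := by
  rw [hk] at hφ
  refine lieD_mem_span (hk ▸ Submodule.subset_span) ?_ hφ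
  rintro _ ⟨φ, hφ, rfl⟩
  have hφk : ∀ φ ∈ R, ∀ i, X i ((incl hU).pullForm φ) = 0 := fun φ hφ =>
    mem_kers.1 (hk ▸ Mor.pullForm_mem_extend (incl hU) hφ)
  rw [mem_kers]
  intro i
  refine ext_ev fun q => ?_
  obtain ⟨χ, hχq, hχ⟩ := exists_cutoff hU q
  choose F hF hF0 using fun k => exists_extend_mul hU hχ (X j (d (coord U k)))
  -- `X j` need not be the restriction of a field on `M`, but its product with a cutoff is, and the
  -- extended field still annihilates `R`. On `R` the Lie derivative along $\chi X_j$ is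
  -- $\chi\mathcal L_{X_j}$, and $\chi=1$ at `q`, so flatness on `M` gives the claim at `q`.
  have hres : resV hU (vfield F) = res hU χ • X j := vfield_ext fun k => by
    rw [resV, vfield_coord, vfield_coord, hF]
    rfl
  have hZ : vfield F ∈ orth R := (Submodule.mem_dualAnnihilator _).2 fun ψ hψ => ext_ev fun p => by
    rw [map_zero]
    by_cases hp : p.1 ∈ U
    · have h1 : res hU (vfield F ψ) = 0 := by
        rw [← related_resV hU (vfield F), hres, LinearMap.smul_apply, hφk ψ hψ, smul_zero]
      have h2 := congrArg (ev (⟨p.1, hp⟩ : U)) h1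
      rw [map_zero] at h2
      exact h2
    · rw [form_eq_sum ψ, map_sum, map_sum]
      refine Finset.sum_eq_zero fun k _ => ?_
      rw [map_smul, vfield_coord, smul_eq_mul, map_mul]
      have : ev p (F k) = 0 := hF0 k p hp
      rw [this, mul_zero]
  have h1 := hφk _ (hR.lieD_mem hZ hφ) i
  rw [← (related_resV hU (vfield F)).lieD, hres] at h1
  have h2 := lieD_sum_smul (fun _ : Unit => res hU χ) (fun _ => X j) (φ := (incl hU).pullForm φ)
    fun _ => hφk φ hφ j
  simp only [Finset.univ_unique, Finset.sum_singleton] at h2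
  rw [h2, map_smul, smul_eq_mul] at h1
  have h3 := congrArg (ev q) h1
  have h4 : ev q (res hU χ) = 1 := hχq
  rwa [map_mul, h4, one_mul] at h3

/-! ### Frames of diffieties -/

theorem resV_mem_orth {U : Opens (ι → ℝ)} (hU : U ≤ M) {Ω : Submodule (Fn M) (Form M)}
    {Z : VField M} (hZ : Z ∈ orth Ω) : resV hU Z ∈ orth ((incl hU).extend Ω) := by
  refine (Submodule.mem_dualAnnihilator _).2 fun φ hφ => ?_
  refine (Submodule.span_le.2 ?_ : (incl hU).extend Ω ≤ LinearMap.ker (resV hU Z)) hφ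
  rintro _ ⟨ψ, hψ, rfl⟩
  rw [SetLike.mem_coe, LinearMap.mem_ker, related_resV,
    (Submodule.mem_dualAnnihilator Z).1 hZ ψ hψ, map_zero]

theorem orth_anti {Ω R : Submodule (Fn M) (Form M)} (h : R ≤ Ω) : orth Ω ≤ orth R :=
  Submodule.dualAnnihilator_anti h

/-- The same correction as for frames, with dual forms that are not assumed to be differentials of
functions. -/
theorem kers_resV_of_dual {J : Type*} [Fintype J] [DecidableEq J] {E : J → VField M}
    {η : J → Form M} (hη : ∀ j k, E j (η k) = if j = k then 1 else 0) {U : Opens (ι → ℝ)}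
    (hU : U ≤ M) : kers (fun j => resV hU (E j)) = (incl hU).extend (kers E) := by
  refine le_antisymm (fun φ hφ => ?_) (Submodule.span_le.2 ?_)
  · have hr : ∀ i, d (coord M i) - ∑ j, E j (d (coord M i)) • η j ∈ kers E := fun i => by
      rw [mem_kers]
      intro j
      simp [hη]
    have h1 : ∀ j, resV hU (E j) φ
        = ∑ i ∈ φ.support, φ i * res hU (E j (d (coord M i))) := fun j => by
      conv_lhs => rw [form_eq_sum φ, map_sum]
      exact Finset.sum_congr rfl fun i _ => by
        rw [map_smul, smul_eq_mul, ← res_coord hU, resV_d]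
    have h0 : φ = ∑ i ∈ φ.support, φ i • resForm hU
        (d (coord M i) - ∑ j, E j (d (coord M i)) • η j)
        + ∑ j, resV hU (E j) φ • resForm hU (η j) := by
      simp only [h1, resForm, Mor.pullForm_sub, Mor.pullForm_sum, Mor.pullForm_smul, smul_sub,
        Finset.sum_sub_distrib, Finset.sum_smul, Finset.smul_sum]
      rw [Finset.sum_comm (s := (Finset.univ : Finset J))]
      simp only [mul_smul, sub_add_cancel]
      conv_lhs => rw [form_eq_sum φ]
      exact Finset.sum_congr rfl fun i _ => by rw [Mor.pullForm_coord]; rfl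
    rw [h0]
    refine Submodule.add_mem _ (Submodule.sum_mem _ fun i hi => Submodule.smul_mem _ _ ?_)
      (Submodule.sum_mem _ fun j _ => ?_)
    · exact Mor.pullForm_mem_extend _ (hr i)
    · rw [mem_kers.1 hφ j, zero_smul]; exact Submodule.zero_mem _
  · rintro _ ⟨φ, hφ, rfl⟩
    exact mem_kers.2 fun j => by rw [related_resV, mem_kers.1 hφ j, map_zero]

/-- Locally there are coordinates whose differentials are a basis of the forms modulo a submodule
of finite codimension. -/
theorem exists_frame {Ω : Submodule (Fn M) (Form M)} (hΩ : FinDim (Fn M) (Form M ⧸ Ω))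
    {V : Opens (ι → ℝ)} (hV : V ≤ M) (hne : (V : Set (ι → ℝ)).Nonempty) :
    ∃ (U : Opens (ι → ℝ)) (_ : U ≤ V) (hU : U ≤ M), (U : Set (ι → ℝ)).Nonempty ∧
      ∃ (n : ℕ) (b : Fin n → ι) (Y : Fin n → VField U), IsFrame (fun j => coord U (b j)) Y ∧
        kers Y = (incl hU).extend Ω ∧
        ∃ (E : Fin n → VField M) (B : Fin n → Fin n → Fn U), (∀ j, E j ∈ orth Ω) ∧
          ∀ i, Y i = ∑ j, B i j • resV hU (E j) := by
  classical
  obtain ⟨_, _⟩ := hΩ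
  obtain ⟨n, ⟨bas⟩⟩ : ∃ n, Nonempty (Module.Basis (Fin n) (Fn M) (Form M ⧸ Ω)) :=
    ⟨_, ⟨(Module.Free.chooseBasis (Fn M) (Form M ⧸ Ω)).reindex (Fintype.equivFin _)⟩⟩
  let E : Fin n → VField M := fun j => (bas.coord j).comp Ω.mkQ
  have hE : kers E = Ω := by
    ext φ
    rw [mem_kers, ← Submodule.Quotient.mk_eq_zero, ← Submodule.mkQ_apply,
      ← bas.forall_coord_eq_zero_iff]
    rfl
  choose η hη using fun j => Ω.mkQ_surjective (bas j)
  have hEη : ∀ j k, E j (η k) = if j = k then 1 else 0 := fun j k => by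
    change bas.coord j (Ω.mkQ (η k)) = _
    rw [hη, bas.coord_apply, bas.repr_self, Finsupp.single_apply]
    simp only [eq_comm]
  obtain ⟨q, hq⟩ := hne
  -- A basis of the quotient need not consist of differentials. At the point `q` the classes of the
  -- $dh^i$ span, so some of them form a basis there and hence nearby.
  obtain ⟨b, hb⟩ := exists_det_ne_zero
    (fun (i : ι) (j : Fin n) => ev (⟨q, hV hq⟩ : M) (E j (d (coord M i)))) (by
    rw [← (Pi.basisFun ℝ (Fin n)).span_eq, Submodule.span_le]
    rintro _ ⟨k, rfl⟩
    have h2 : Pi.basisFun ℝ (Fin n) k = ∑ i ∈ (η k).support, ev (⟨q, hV hq⟩ : M) (η k i) •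
        (fun j : Fin n => ev (⟨q, hV hq⟩ : M) (E j (d (coord M i)))) := by
      funext j
      have h3 := congrArg (fun φ => ev (⟨q, hV hq⟩ : M) (E j φ)) (form_eq_sum (η k))
      simp only [map_sum, map_smul, smul_eq_mul, map_mul, hEη] at h3
      rw [Finset.sum_apply]
      simp only [Pi.smul_apply, smul_eq_mul]
      rw [← h3, Pi.basisFun_apply, Pi.single_apply]
      split_ifs
      exacts [(map_one _).symm, (map_zero _).symm]
    rw [h2]
    exact Submodule.sum_mem _ fun i _ => Submodule.smul_mem _ _ (Submodule.subset_span ⟨i, rfl⟩))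
  obtain ⟨U₀, hU₀, hqU, hu⟩ := exists_isUnit_res
    (f := (Matrix.of fun j i => E j (d (coord M (b i)))).det) (p := ⟨q, hV hq⟩) (by
      rw [RingHom.map_det]
      exact hb)
  have hU : U₀ ⊓ V ≤ M := inf_le_left.trans hU₀
  obtain ⟨B, -, h1, h2⟩ := exists_dual (fun i => coord (U₀ ⊓ V) (b i))
    (fun j => resV hU (E j)) (by
      have := hu.map (res (inf_le_left : U₀ ⊓ V ≤ U₀))
      rw [RingHom.map_det, RingHom.map_det] at this
      convert this using 2
      ext j i
      simp only [Matrix.of_apply]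
      rw [← res_coord hU, resV_d]
      rfl)
  refine ⟨U₀ ⊓ V, inf_le_right, hU, ⟨q, hqU, hq⟩, n, b, _, ⟨fun j => ?_, fun i j hij => ?_,
    fun _ => Set.toFinite _⟩, h2.trans ?_, E, fun i j => B i j, fun j => ?_, fun i => rfl⟩
  · rw [h1, if_pos rfl]
  · rw [h1, if_neg hij]
  · rw [kers_resV_of_dual hEη hU, hE]
  · exact orth_anti hE.ge (mem_orth_kers E j)

theorem IsGoodFiltration.isFlat {Ω : Submodule (Fn M) (Form M)}
    {W : ℕ → Submodule (Fn M) (Form M)} (h : IsGoodFiltration Ω W) : IsFlat Ω := by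
  refine Submodule.span_le.2 ?_
  rintro _ ⟨Z, hZ, φ, hφ, rfl⟩
  obtain ⟨l, hl⟩ := (h.exhaust φ).1 hφ
  exact (h.exhaust _).2 ⟨l + 1, h.lie_le l (Submodule.subset_span ⟨Z, hZ, φ, hl, rfl⟩)⟩

/-- The differentials of finitely many coordinates generate all forms by means of Lie
derivatives. -/
theorem IsGoodFiltration.exists_finset {Ω : Submodule (Fn M) (Form M)}
    {W : ℕ → Submodule (Fn M) (Form M)} (h : IsGoodFiltration Ω W) {U : Opens (ι → ℝ)}
    (hU : U ≤ M) {n : ℕ} {b : Fin n → ι} {Y : Fin n → VField U}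
    (hY : IsFrame (fun j => coord U (b j)) Y) (hk : kers Y = (incl hU).extend Ω) :
    ∃ S : Finset ι, ∀ P : Submodule (Fn U) (Form U), (∀ j, ∀ φ ∈ P, lieD (Y j) φ ∈ P) →
      (∀ i ∈ S, d (coord U i) ∈ P) → P = ⊤ := by
  classical
  obtain ⟨l₀, hl₀⟩ := h.lie_eq
  have hfin : Module.Finite (Fn M) (W l₀) := (h.finDim l₀).1
  obtain ⟨T, hT⟩ := Module.Finite.iff_fg.1 hfin
  -- The finite set contains the independent variables and all coordinates occurring in generators
  -- of $\Omega_{l_0}$. From $l_0$ on the filtration grows by Lie derivatives only, so a stable `P`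
  -- absorbs all of $\Omega$.
  refine ⟨Finset.univ.image b ∪ T.biUnion fun φ => φ.support, fun P hP hS => ?_⟩
  let Q : Submodule (Fn M) (Form M) := P.comap (incl hU).pullFormHom
  have hQ : ∀ φ, φ ∈ Q ↔ resForm hU φ ∈ P := fun φ => Iff.rfl
  have h0 : W l₀ ≤ Q := by
    rw [← hT, Submodule.span_le]
    intro φ hφ
    rw [SetLike.mem_coe, form_eq_sum φ]
    refine Q.sum_mem fun i hi => Q.smul_mem _ ?_
    rw [hQ, resForm_coord]
    exact hS i (Finset.mem_union_right _ (Finset.mem_biUnion.2 ⟨φ, hφ, hi⟩))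
  have h1 : ∀ l, W (l₀ + l) ≤ Q := fun l => by
    induction l with
    | zero => exact h0
    | succ l ih =>
      rw [← add_assoc, ← hl₀ (l₀ + l) (Nat.le_add_right _ _)]
      refine sup_le ih (Submodule.span_le.2 ?_)
      rintro _ ⟨Z, hZ, φ, hφ, rfl⟩
      rw [SetLike.mem_coe, hQ, resForm, ← (related_resV hU Z).lieD]
      refine hY.lieD_mem (hk ▸ resV_mem_orth hU hZ) ?_ fun j => hP j _ (ih hφ)
      rw [hk]
      exact Mor.pullForm_mem_extend _ ((h.exhaust φ).2 ⟨_, hφ⟩)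
  have h2 : Ω ≤ Q := fun φ hφ => by
    obtain ⟨l, hl⟩ := (h.exhaust φ).1 hφ
    exact h1 l (h.mono (Nat.le_add_left l l₀) hl)
  have h3 : kers Y ≤ P := by
    rw [hk]
    refine Submodule.span_le.2 ?_
    rintro _ ⟨φ, hφ, rfl⟩
    exact h2 hφ
  rw [eq_top_iff]
  intro φ _
  rw [← sub_add_cancel φ (∑ j, Y j φ • d (coord U (b j)))]
  refine P.add_mem (h3 (hY.sub_mem fun j _ => Finset.mem_univ j)) (P.sum_mem fun j _ =>
    P.smul_mem _ (hS _ (Finset.mem_union_left _ (Finset.mem_image_of_mem b (Finset.mem_univ j)))))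

/-! ### Frames of submodules -/

section Generic

variable {K n : ℕ} {Y : Fin n → VField M} {h : Fin K → Fn M} {Q : Submodule (Fn M) (Form M)}

/-- The derivatives which are independent modulo `Q` are part of a frame. -/
theorem exists_frame_of_isGeneric (hg : IsGeneric (fun μ => d (monFn Y h μ)) Q)
    (htop : Submodule.span (Fn M) (Set.range fun μ => d (monFn Y h μ)) = ⊤) :
    ∃ X : {μ : Mon K n // μ ∉ depSet (fun μ => d (monFn Y h μ)) Q} → VField M,
      IsFrame (fun μ => monFn Y h μ.1) X ∧ kers X = Q := by
  classical
  set D := depSet (fun μ => d (monFn Y h μ)) Q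
  have hspan : Submodule.span (Fn M)
      (Set.range fun μ : {μ : Mon K n // μ ∉ D} => Q.mkQ (d (monFn Y h μ.1))) = ⊤ := by
    rw [eq_top_iff]
    rintro ψ -
    obtain ⟨φ, rfl⟩ := Q.mkQ_surjective ψ
    have h1 : φ ∈ Q ⊔ Submodule.span (Fn M)
        (Set.range fun μ : {μ : Mon K n // μ ∉ D} => d (monFn Y h μ.1)) := by
      refine (htop ▸ Submodule.span_le.2 ?_ : (⊤ : Submodule (Fn M) (Form M)) ≤ _) trivial
      rintro _ ⟨μ, rfl⟩
      refine sup_le_sup_left (Submodule.span_mono ?_) Q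
        (mem_sup_span_of_notMem_depSet (fun μ => d (monFn Y h μ)) Q μ)
      rintro _ ⟨ν, hν, rfl⟩
      exact ⟨⟨ν, hν.1⟩, rfl⟩
    obtain ⟨q, hq, ψ, hψ, rfl⟩ := Submodule.mem_sup.1 h1
    rw [map_add, show Q.mkQ q = 0 from (Submodule.Quotient.mk_eq_zero Q).2 hq, zero_add]
    have := Submodule.mem_map_of_mem (f := Q.mkQ) hψ
    rwa [Submodule.map_span, ← Set.range_comp] at this
  have hli : LinearIndependent (Fn M)
      (fun μ : {μ : Mon K n // μ ∉ D} => Q.mkQ (d (monFn Y h μ.1))) := by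
    rw [linearIndependent_iff']
    intro s g hs μ hμ
    let g' : Mon K n → Fn M := fun μ => if hμ : μ ∉ D then g ⟨μ, hμ⟩ else 0
    have h1 : ∑ ν ∈ s.map (Function.Embedding.subtype _), g' ν • d (monFn Y h ν) ∈ Q := by
      rw [← Submodule.Quotient.mk_eq_zero, ← Submodule.mkQ_apply, Finset.sum_map, ← hs, map_sum]
      refine Finset.sum_congr rfl fun ν _ => ?_
      have := ν.2
      simp [g', this]
    have h2 := hg.eq_zero (s := s.map (Function.Embedding.subtype _)) (by
      intro ν hν
      obtain ⟨ν, -, rfl⟩ := Finset.mem_map.1 hν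
      exact ν.2) h1 μ.1 (Finset.mem_map_of_mem _ hμ)
    have := μ.2
    simpa [g', this] using h2
  let bas := Module.Basis.mk hli hspan.ge
  have hbas : ∀ μ, bas μ = Q.mkQ (d (monFn Y h μ.1)) := fun μ => Module.Basis.mk_apply _ _ μ
  refine ⟨fun μ => (bas.coord μ).comp Q.mkQ, isFrame_of_span hspan (fun μ => ?_) (fun μ => ?_)
    fun μ ν hμν => ?_⟩
  · refine (Submodule.mem_dualAnnihilator _).2 fun φ hφ => ?_
    rw [LinearMap.comp_apply, show Q.mkQ φ = 0 from (Submodule.Quotient.mk_eq_zero Q).2 hφ, map_zero]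
  · rw [LinearMap.comp_apply, ← hbas, bas.coord_apply, bas.repr_self, Finsupp.single_eq_same]
  · rw [LinearMap.comp_apply, ← hbas, bas.coord_apply, bas.repr_self, Finsupp.single_eq_of_ne hμν]

/-- The common kernel of the frame is generated by finitely many forms. -/
theorem exists_kers_eq_iterSpan (hY : IsCommuting Y)
    (htop : Submodule.span (Fn M) (Set.range fun μ => d (monFn Y h μ)) = ⊤)
    {D : Set (Mon K n)} (hD : D = depSet (fun μ => d (monFn Y h μ)) Q)
    {X : {μ : Mon K n // μ ∉ D} → VField M} (hX : IsFrame (fun μ => monFn Y h μ.1) X) (hk : kers X = Q)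
    (hYQ : ∀ j, Y j ∈ orth Q) (hYs : ∀ j, ∀ φ ∈ Q, lieD (Y j) φ ∈ Q)
    (hXs : ∀ μ, ∀ φ ∈ Q, lieD (X μ) φ ∈ Q) :
    ∃ (L : ℕ) (γ : Fin L → Form M), kers X = iterSpan X γ := by
  classical
  obtain ⟨G, hGD, hG⟩ := Mon.exists_generators (S := D)
    (by rw [hD]; exact shift_mem_depSet hY hYs)
  -- The part of $dH_\mu$ lying in `Q`: its remainder after expansion in the independent
  -- derivatives. The generators are these remainders for the finitely many monomials generating
  -- `D`.
  let ρ : Mon K n → Form M := fun μ =>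
    d (monFn Y h μ) - ∑ ν ∈ (hX.finite (d (monFn Y h μ))).toFinset,
      X ν (d (monFn Y h μ)) • d (monFn Y h ν.1)
  have hρ : ∀ μ, ρ μ ∈ kers X := fun μ => hX.sub_mem (φ := d (monFn Y h μ))
    (s := (hX.finite (d (monFn Y h μ))).toFinset) fun j hj => (hX.finite _).mem_toFinset.2 hj
  let γ : Fin G.card → Form M := fun l => ρ (G.equivFin.symm l).1
  let A : Mon K n → Submodule (Fn M) (Form M) := fun μ =>
    Submodule.span (Fn M) ((fun ν => d (monFn Y h ν)) '' {ν | ν ∉ D ∧ ν ≤ μ})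
  have hle : iterSpan X γ ≤ kers X := by
    refine iterSpan_le (fun μ φ hφ => ?_) fun l => hρ _
    rw [hk] at hφ ⊢
    exact hXs μ φ hφ
  have hAmono : ∀ {μ ν : Mon K n}, μ ≤ ν → A μ ≤ A ν := fun hμν =>
    Submodule.span_mono (Set.image_mono fun _ h => ⟨h.1, h.2.trans hμν⟩)
  -- Since `Y j` annihilates `Q`, its Lie derivative on the kernel is a combination of those along
  -- the frame. So relations may be differentiated along the `Y j` without new generators.
  have hYiter : ∀ j, ∀ φ ∈ iterSpan X γ, lieD (Y j) φ ∈ iterSpan X γ := fun j φ hφ =>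
    hX.lieD_mem (hk.symm ▸ hYQ j) (hle hφ) fun μ => lieD_mem_iterSpan μ hφ
  have key : ∀ μ, d (monFn Y h μ) ∈ iterSpan X γ ⊔ A μ := by
    intro μ
    induction μ using WellFoundedLT.induction with
    | ind μ ih =>
      by_cases hμ : μ ∈ D
      · rcases hG μ hμ with hμG | ⟨j, ν, hν, rfl⟩
        · have h1 : ρ μ ∈ iterSpan X γ := by
            have := iterForm_mem_iterSpan (X := X) γ (G.equivFin ⟨μ, hμG⟩) []
            simpa only [γ, iterForm, List.foldr_nil, Equiv.symm_apply_apply] using this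
          rw [← sub_add_cancel (d (monFn Y h μ)) (∑ ν ∈ (hX.finite (d (monFn Y h μ))).toFinset,
            X ν (d (monFn Y h μ)) • d (monFn Y h ν.1))]
          refine Submodule.add_mem_sup h1 (Submodule.sum_mem _ fun ν hν => Submodule.smul_mem _ _
            (Submodule.subset_span ⟨ν.1, ⟨ν.2, ?_⟩, rfl⟩))
          by_contra hn
          refine (hX.finite _).mem_toFinset.1 hν ?_
          have hμ' := mem_sup_span_of_mem_depSet (fun μ => d (monFn Y h μ)) Q (hD ▸ hμ)
          rw [← hD] at hμ'
          refine (sup_le (hk ▸ iInf_le _ ν) (Submodule.span_le.2 ?_) : Q ⊔ Submodule.span (Fn M)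
            ((fun ν => d (monFn Y h ν)) '' {ν | ν ∉ D ∧ ν < μ}) ≤ LinearMap.ker (X ν))
            hμ'
          rintro _ ⟨ν', hν', rfl⟩
          refine hX.dual_ne ν ⟨ν', hν'.1⟩ fun he => hn ?_
          rw [he]
          exact hν'.2.le
        · have h1 := ih ν (Mon.lt_shift j ν)
          have h2 := lieD_d (Y j) (monFn Y h ν)
          rw [apply_d_monFn hY] at h2
          rw [← h2]
          obtain ⟨r, hr, ψ, hψ, he⟩ := Submodule.mem_sup.1 h1
          rw [← he, lieD_add]
          refine Submodule.add_mem _ (Submodule.mem_sup_left (hYiter j r hr))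
            (lieD_mem_span ?_ ?_ hψ)
          · rintro _ ⟨ν', hν', rfl⟩
            exact Submodule.mem_sup_right (Submodule.subset_span
              ⟨ν', ⟨hν'.1, hν'.2.trans (Mon.lt_shift j ν).le⟩, rfl⟩)
          · rintro _ ⟨ν', hν', rfl⟩
            -- The index `ν'` is independent and `ν` is not, so the inequality is strict and the
            -- induction hypothesis covers the shifted term.
            have hlt : Mon.shift j ν' < Mon.shift j ν := Mon.shift_lt_shift j
              (lt_of_le_of_ne hν'.2 fun he => hν'.1 (he ▸ hν))
            rw [lieD_d, apply_d_monFn hY]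
            exact sup_le_sup_left (hAmono hlt.le) _ (ih _ hlt)
      · exact Submodule.mem_sup_right (Submodule.subset_span ⟨μ, ⟨hμ, le_rfl⟩, rfl⟩)
  refine ⟨G.card, γ, le_antisymm (fun φ hφ => ?_) hle⟩
  have h1 : φ ∈ iterSpan X γ ⊔ Submodule.span (Fn M)
      (Set.range fun μ : {μ : Mon K n // μ ∉ D} => d (monFn Y h μ.1)) := by
    refine (htop ▸ Submodule.span_le.2 ?_ : (⊤ : Submodule (Fn M) (Form M)) ≤ _) trivial
    rintro _ ⟨μ, rfl⟩
    refine (sup_le_sup_left (Submodule.span_mono ?_) _ :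
      iterSpan X γ ⊔ A μ ≤ _) (key μ)
    rintro _ ⟨ν, hν, rfl⟩
    exact ⟨⟨ν, hν.1⟩, rfl⟩
  obtain ⟨r, hr, ψ, hψ, rfl⟩ := Submodule.mem_sup.1 h1
  obtain ⟨c, rfl⟩ := Finsupp.mem_span_range_iff_exists_finsupp.1 hψ
  -- For a form in the kernel the frame fields read off the coefficients of the independent
  -- derivatives as zero, leaving only the part in the span of the generators.
  have h2 : c = 0 := Finsupp.ext fun μ => by
    have h3 := mem_kers.1 hφ μ
    rw [map_add, mem_kers.1 (hle hr) μ, zero_add, Finsupp.sum, hX.apply_sum] at h3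
    by_contra hn
    rw [if_pos (Finsupp.mem_support_iff.2 hn)] at h3
    exact hn h3
  rw [h2, Finsupp.sum_zero_index, add_zero]
  exact hr

end Generic

/-- Flat submodules of diffieties are locally induced from diffieties. -/
theorem exists_projection_of_isDiffiety [Countable ι] {Ω R : Submodule (Fn M) (Form M)}
    (hΩ : IsDiffiety Ω) (hRΩ : R ≤ Ω) (hR : IsFlat R) {V : Opens (ι → ℝ)} (hV : V ≤ M)
    (hne : (V : Set (ι → ℝ)).Nonempty) :
    ∃ (U : Opens (ι → ℝ)) (hU : U ≤ M), U ≤ V ∧ (U : Set (ι → ℝ)).Nonempty ∧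
      ∃ (κ : Type) (_ : Countable κ) (N : Opens (κ → ℝ)) (m : Mor U N)
        (Θ : Submodule (Fn N) (Form N)),
        m.IsProjection ∧ IsDiffiety Θ ∧ (incl hU).extend R = m.extend Θ := by
  obtain ⟨hfd, W, hW⟩ := hΩ
  obtain ⟨U₁, hU₁V, hU₁, hne₁, n, b, Y, hY, hYk, E, B, hE, hYE⟩ := exists_frame hfd hV hne
  -- The fields `Y j` are combinations of restrictions of fields in $\mathcal H(\Omega)$, which lies
  -- in $\mathcal H(P)$ for every $P\subset\Omega$. This is used for $\Omega$, to make them commute,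
  -- and for $R$, to differentiate relations modulo $R$.
  have hstab : ∀ P : Submodule (Fn M) (Form M), P ≤ Ω → IsFlat P → ∀ j,
      ∀ φ ∈ (incl hU₁).extend P, lieD (Y j) φ ∈ (incl hU₁).extend P := by
    intro P hP hPf j φ hφ
    rw [hYE, lieD_sum_smul _ (fun k => resV hU₁ (E k)) fun k => ?_]
    · exact Submodule.sum_mem _ fun k _ => Submodule.smul_mem _ _
        (lieD_mem_extend hU₁ (fun ψ hψ => hPf.lieD_mem (orth_anti hP (hE k)) hψ) hφ)
    · exact (Submodule.mem_dualAnnihilator _).1 (resV_mem_orth hU₁ (hE k)) φ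
        (Mor.extend_mono _ hP hφ)
  have hYc : IsCommuting Y := hY.commute fun j φ hφ => by
    rw [hYk] at hφ ⊢
    exact hstab Ω le_rfl hW.isFlat j φ hφ
  obtain ⟨S, hS⟩ := hW.exists_finset hU₁ hY hYk
  let h : Fin S.card → Fn U₁ := fun r => coord U₁ (S.equivFin.symm r).1
  have htop : Submodule.span (Fn U₁) (Set.range fun μ => d (monFn Y h μ)) = ⊤ := by
    refine hS _ (fun j φ hφ => ?_) fun i hi => ?_
    · exact lieD_mem_span_monFn (v := id) hYc (fun j hj => absurd ⟨j, rfl⟩ hj) j hφ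
    · refine Submodule.subset_span ⟨Mon.mk (S.equivFin ⟨i, hi⟩) 0, ?_⟩
      simp only [monFn_zero, h, Equiv.symm_apply_apply]
  obtain ⟨U₂, hU₂, hne₂, hg⟩ := exists_isGeneric_monFn hYc h (hstab R hRΩ hR) hne₁
  rw [extend_extend] at hg
  have htop₂ : Submodule.span (Fn U₂) (Set.range fun μ =>
      d (monFn (fun j => resV hU₂ (Y j)) (fun r => res hU₂ (h r)) μ)) = ⊤ := by
    rw [← extend_top hU₂, ← htop, Mor.extend_span, ← Set.range_comp]
    congr 2
    funext μ
    rw [res_monFn, ← resForm_d]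
    rfl
  obtain ⟨X, hX, hk⟩ := exists_frame_of_isGeneric hg htop₂
  -- The frame of $R$ is constructed on the small open set only and is not given by restrictions
  -- from `M`, hence the flatness lemma based on cutoffs.
  have hXs : ∀ μ, ∀ φ ∈ kers X, lieD (X μ) φ ∈ kers X := fun μ φ hφ =>
    hR.lieD_mem_extend (hU₂.trans hU₁) hk μ hφ
  have hYQ : ∀ j, resV hU₂ (Y j) ∈ orth ((incl (hU₂.trans hU₁)).extend R) := fun j => by
    rw [← extend_extend hU₂ hU₁]
    refine resV_mem_orth hU₂ (orth_anti (Mor.extend_mono _ hRΩ) ?_)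
    rw [← hYk]
    exact mem_orth_kers Y j
  have hYs : ∀ j, ∀ φ ∈ (incl (hU₂.trans hU₁)).extend R,
      lieD (resV hU₂ (Y j)) φ ∈ (incl (hU₂.trans hU₁)).extend R := fun j φ hφ => by
    rw [← extend_extend hU₂ hU₁] at hφ ⊢
    exact lieD_mem_extend hU₂ (hstab R hRΩ hR j) hφ
  obtain ⟨L, γ, hγ⟩ := exists_kers_eq_iterSpan (hYc.res hU₂) htop₂ rfl hX hk hYQ hYs
    fun μ φ hφ => hk.le (hXs μ φ (hk.ge hφ))
  obtain ⟨s, hs⟩ := exists_expressedIn γ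
  obtain ⟨U, hU, hUne, κ, hκ, N, m, Θ, h1, h2, h3, -⟩ :=
    exists_projection hne₂ hX (hX.commute hXs) hγ hs
  refine ⟨U, hU.trans (hU₂.trans hU₁), (hU.trans hU₂).trans hU₁V, hUne, κ, hκ, N, m, Θ, h1, h2, ?_⟩
  rw [← h3, hk, extend_extend]

end Diffiety

end

/-! ### The two statements together -/

open Diffiety in
theorem theorem3p1 {ι : Type*} [Countable ι] (M : Opens (ι → ℝ)) :
    -- flat submodules of a diffiety
    (∀ Ω R : Submodule (Fn M) (Form M), IsDiffiety Ω → R ≤ Ω → IsFlat R →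
      ∀ V : Opens (ι → ℝ), V ≤ M → (V : Set (ι → ℝ)).Nonempty →
        ∃ (U : Opens (ι → ℝ)) (hU : U ≤ M), U ≤ V ∧ (U : Set (ι → ℝ)).Nonempty ∧
          ∃ (κ : Type) (_ : Countable κ) (N : Opens (κ → ℝ)) (m : Mor U N)
            (Θ : Submodule (Fn N) (Form N)),
            m.IsProjection ∧ IsDiffiety Θ ∧ (incl hU).extend R = m.extend Θ) ∧
    -- flat submodules with a good filtration generated by `Γ`, with the explicit construction
    (∀ R Γ : Submodule (Fn M) (Form M), IsFlat R → FinDim (Fn M) Γ →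
      IsGoodFiltration R (lieTower (orth R) Γ) →
      -- a basis of `Φ(M) / R` consisting of differentials `dx_j`, and the dual vector fields `X_j`
      ∀ (J : Type*) [DecidableEq J] (x : J → Fn M),
        LinearIndependent (Fn M) (fun j => R.mkQ (d (x j))) →
        Submodule.span (Fn M) (Set.range fun j => R.mkQ (d (x j))) = ⊤ →
      ∀ X : J → VField M, (∀ j, X j ∈ orth R) →
        (∀ i j, X i (d (x j)) = if i = j then 1 else 0) →
      -- a basis of `Γ`, expressed in terms of the coordinates `h^r` with `r ∈ s`
      ∀ (K : ℕ) (γ : Fin K → Form M), LinearIndependent (Fn M) γ →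
        Submodule.span (Fn M) (Set.range γ) = Γ →
      ∀ s : Finset ι, (∀ k, ExpressedIn s (γ k)) →
      ∀ V : Opens (ι → ℝ), V ≤ M → (V : Set (ι → ℝ)).Nonempty →
        ∃ (U : Opens (ι → ℝ)) (hU : U ≤ M), U ≤ V ∧ (U : Set (ι → ℝ)).Nonempty ∧
          ∃ (κ : Type) (_ : Countable κ) (N : Opens (κ → ℝ)) (m : Mor U N)
            (Θ : Submodule (Fn N) (Form N)),
            m.IsProjection ∧ IsDiffiety Θ ∧ (incl hU).extend R = m.extend Θ ∧
            -- the coordinates of `N` are chosen from the functions `X_{i_1} ⋯ X_{i_r} h^r`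
            (∀ a : κ, ∃ r ∈ s, ∃ w : List J,
              m.pull (coord N a) = (incl hU).pull (iterFn X w (coord M r))) ∧
            -- and all these functions are expressed in terms of them
            (∀ r ∈ s, ∀ w : List J, ∃ f : Fn N,
              m.pull f = (incl hU).pull (iterFn X w (coord M r))) ∧
            -- `Θ` is generated by forms corresponding to the iterated Lie derivatives of `Γ`
            ∃ θ : Fin K → List J → Form N,
              (∀ k w, m.pullForm (θ k w) = (incl hU).pullForm (iterForm X w (γ k))) ∧
              Θ = Submodule.span (Fn N) {φ | ∃ k w, φ = θ k w}) := by
  refine ⟨fun Ω R hΩ hRΩ hR V hV hne => exists_projection_of_isDiffiety hΩ hRΩ hR hV hne, ?_⟩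
  intro R Γ hR _ hgood J _ x _ hspan X hX hdual K γ _ hγ s hs V hV hne
  obtain ⟨hx, hk⟩ := isFrame_of_span hspan hX (fun j => by simpa using hdual j j)
    (fun i j hij => by rw [hdual, if_neg hij])
  have hcomm := hx.commute fun j φ hφ => by
    rw [hk] at hφ ⊢
    exact hR.lieD_mem (hX j) hφ
  have h := exists_projection_of_le hx hcomm (hx.kers_eq_iterSpan hk hR hgood hγ) hs hV hne
  rwa [hk] at h
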